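/- Let $\mathbb G=(\mathbb R^N,*,D_\lambda)$ be a Carnot group: $*$ is a Lie group law on $\mathbb R^N$ with neutral element $0$; the dilations $D_\lambda(x)=(\lambda^{\sigma_1}x_1,\dots,\lambda^{\sigma_N}x_N)$, $\lambda>0$, with integers $1=\sigma_1\le\dots\le\sigma_N$, are automorphisms of $(\mathbb R^N,*)$; and the Lie algebra $\mathfrak a$ of left-invariant vector fields is stratified, $\mathfrak a=\mathfrak a_1\oplus\dots\oplus\mathfrak a_s$ with $\mathfrak a_k=[\mathfrak a_1,\mathfrak a_{k-1}]$ for $2\le k\le s$ and $[\mathfrak a_1,\mathfrak a_s]=0$, where $\mathfrak a_1$ is spanned by linearly independent vector fields $Y_1,\dots,Y_m$ that are $1$-homogeneous with respect to $\{D_\lambda\}$. Assume that the homogeneous dimension $Q=\sum_{i=1}^N\sigma_i$ is greater than $2$. Put $\|x\|=\big(\sum_{i=1}^N|x_i|^{2\sigma_N!/\sigma_i}\big)^{1/(2\sigma_N!)}$ and $B_R(\bar x)=\{x:\|\bar x^{-1}*x\|<R\}$. Let $d_Y(x,y)$ be the control distance of $Y_1,\dots,Y_m$, i.e. the infimum of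 the $\delta>0$ for which there is an absolutely continuous curve $\gamma:[0,1]\to\mathbb R^N$ with $\gamma(0)=x$, $\gamma(1)=y$ and $\gamma'(t)=\sum_{i=1}^m a_i(t)\,(Y_i)_{\gamma(t)}$ for a.e. $t$, where $\|a_i\|_{L^\infty(0,1)}<\delta$ for all $i$. For $\Omega\subseteq\mathbb R^N$ and $\alpha\in(0,1)$ let $$|u|_{C^\alpha_Y(\Omega)}=\sup_{x,x'\in\Omega,\ x\ne x'}\frac{|u(x)-u(x')|}{d_Y(x,x')^\alpha},\qquad \|u\|_{C^\alpha_Y(\Omega)}=\sup_{\Omega}|u|+|u|_{C^\alpha_Y(\Omega)},$$ and let $C^\alpha_Y(\Omega)$ be the space of the functions $u$ on $\Omega$ with $\|u\|_{C^\alpha_Y(\Omega)}<\infty$. Derivatives $Y_iu$ are taken pointwise, along the integral curves of $Y_i$. Fix $\alpha\in(0,1)$. For $f\in C^\infty(\mathbb R^N\setminus\{0\})$ real-valued and homogeneous of degree $2-Q$ (that is, $f(D_\lambda x)=\lambda^{2-Q}f(x)$ for $\lambda>0$, $x\ne0$), $1\le h,l\le m$, and $\phi\in C^\alpha_Y(\mathbb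 R^N)$ with compact support, set $$(T_f\phi)(x)=Y_hY_l\int_{\mathbb R^N}f(y^{-1}*x)\,\phi(y)\,dy,\qquad x\in\mathbb R^N,$$ and $$\Theta_{f,3}=\sup_{k\le3}\ \sup_{1\le i_1,\dots,i_k\le m}\ \sup_{\|w\|=1}|Y_{i_1}\cdots Y_{i_k}f(w)|.$$ Then $T_f\phi$ is well defined at every point of $\mathbb R^N$ (the integral converges absolutely, and the two successive derivatives exist), and there is a constant $c_0=c_0(\mathbb G,\alpha,\Theta_{f,3})>0$ (depending on nothing else) such that for all such $f$, $h$, $l$, all $0<R\le1$, $\bar x\in\mathbb R^N$ and all $\phi\in C^\alpha_Y(\mathbb R^N)$ with $\operatorname{supp}\phi\subset B_R(\bar x)$, $$\|T_f\phi\|_{C^\alpha_Y(B_R(\bar x))}\le c_0\,|\phi|_{C^\alpha_Y(B_R(\bar x))}.$$ -/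

import Mathlib

open scoped ContDiff ENNReal NNReal Topology

/-- A Lie group law on `ℝ^N`, with neutral element the origin. (On a group carrying dilations
which are automorphisms, the neutral element is fixed by all dilations, hence it is the origin.) -/
structure LieGroupLaw (N : ℕ) where
  mul : (Fin N → ℝ) → (Fin N → ℝ) → (Fin N → ℝ)
  inv : (Fin N → ℝ) → (Fin N → ℝ)
  mul_assoc : ∀ x y z, mul (mul x y) z = mul x (mul y z)
  zero_mul : ∀ x, mul 0 x = x
  mul_zero : ∀ x, mul x 0 = x
  inv_mul : ∀ x, mul (inv x) x = 0
  mul_inv : ∀ x, mul x (inv x) = 0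
  contDiff_mul : ContDiff ℝ ∞ (fun p : (Fin N → ℝ) × (Fin N → ℝ) => mul p.1 p.2)
  contDiff_inv : ContDiff ℝ ∞ inv

namespace LieGroupLaw

/-- The space of (smooth) left-invariant vector fields: `(dL_x)_y V(y) = V(x * y)`. -/
def leftInvariant {N : ℕ} (L : LieGroupLaw N) : Submodule ℝ ((Fin N → ℝ) → (Fin N → ℝ)) where
  carrier := {V | ContDiff ℝ ∞ V ∧ ∀ x y, fderiv ℝ (fun z => L.mul x z) y (V y) = V (L.mul x y)}
  add_mem' := by
    rintro V W ⟨hV, hV'⟩ ⟨hW, hW'⟩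
    refine ⟨hV.add hW, fun x y => ?_⟩
    simp only [Pi.add_apply, map_add, hV', hW']
  zero_mem' := by
    refine ⟨contDiff_const, fun x y => ?_⟩
    simp only [Pi.zero_apply, map_zero]
  smul_mem' := by
    rintro c V ⟨hV, hV'⟩
    refine ⟨contDiff_const.smul hV, fun x y => ?_⟩
    simp only [Pi.smul_apply, map_smul, hV']

end LieGroupLaw

/-- The layers generated by the vector fields `Y_1, …, Y_m`: `layer Y 0` is their span and
`layer Y (k + 1) = [layer Y 0, layer Y k]` (the span of the Lie brackets). So `layer Y k` is the
stratum usually written with index `k + 1`. -/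
def layer {N m : ℕ} (Y : Fin m → (Fin N → ℝ) → (Fin N → ℝ)) :
    ℕ → Submodule ℝ ((Fin N → ℝ) → (Fin N → ℝ))
  | 0 => Submodule.span ℝ (Set.range Y)
  | k + 1 => Submodule.span ℝ
      {Z | ∃ V ∈ Submodule.span ℝ (Set.range Y), ∃ W ∈ layer Y k,
        Z = VectorField.lieBracket ℝ V W}

/-- The anisotropic dilation `D_λ(x) = (λ^{σ_1} x_1, …, λ^{σ_N} x_N)`. -/
def anisoDilation {N : ℕ} (σ : Fin N → ℕ) (r : ℝ) (x : Fin N → ℝ) : Fin N → ℝ :=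
  fun i => r ^ σ i * x i

/-- A Carnot group `(ℝ^N, *, D_λ)` with generators `Y_1, …, Y_m`. -/
structure CarnotGroup (N m : ℕ) extends LieGroupLaw N where
  /-- the exponents of the dilations, `1 = σ_1 ≤ … ≤ σ_N` -/
  σ : Fin N → ℕ
  σ_mono : Monotone σ
  σ_first : ∀ hN : 0 < N, σ ⟨0, hN⟩ = 1
  /-- the dilations are automorphisms -/
  dil_mul : ∀ r : ℝ, 0 < r → ∀ x y,
    anisoDilation σ r (mul x y) = mul (anisoDilation σ r x) (anisoDilation σ r y)
  /-- the generators `Y_1, …, Y_m` -/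
  Y : Fin m → (Fin N → ℝ) → (Fin N → ℝ)
  Y_mem : ∀ i, Y i ∈ toLieGroupLaw.leftInvariant
  Y_linearIndependent : LinearIndependent ℝ Y
  /-- `Y_i` is 1-homogeneous: `Y_i (g ∘ D_λ) = λ (Y_i g) ∘ D_λ` -/
  Y_homogeneous : ∀ i, ∀ r : ℝ, 0 < r → ∀ x,
    anisoDilation σ r (Y i x) = r • Y i (anisoDilation σ r x)
  /-- the Lie algebra of left-invariant vector fields is the direct sum of finitely many layers
  generated by the `Y_i`, and the next layer vanishes -/
  stratified : ∃ s : ℕ,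
    iSupIndep (fun k : Fin s => layer Y k) ∧
    (⨆ k : Fin s, layer Y k) = toLieGroupLaw.leftInvariant ∧
    layer Y s = ⊥

/-- `u` has derivative `v` at `x` along the vector field `V`, i.e. `v` is the derivative at `t = 0`
of `t ↦ u (γ t)`, where `γ` is the integral curve of `V` with `γ 0 = x` (whose germ is unique for
smooth `V`). No differentiability of `u` in other directions is required. -/
def HasDerivAlong {N : ℕ} (V : (Fin N → ℝ) → (Fin N → ℝ)) (u : (Fin N → ℝ) → ℝ) (v : ℝ)
    (x : Fin N → ℝ) : Prop :=
  ∃ γ : ℝ → (Fin N → ℝ), γ 0 = x ∧ IsIntegralCurveAt γ (fun _ => V) 0 ∧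
    HasDerivAt (fun t => u (γ t)) v 0

/-- `u` is differentiable at `x` along the vector field `V`. -/
def DifferentiableAlong {N : ℕ} (V : (Fin N → ℝ) → (Fin N → ℝ)) (u : (Fin N → ℝ) → ℝ)
    (x : Fin N → ℝ) : Prop :=
  ∃ v, HasDerivAlong V u v x

open Classical in
/-- The derivative `V u` of a function along a vector field (`0` at the points where it does
not exist). -/
noncomputable def derivAlong {N : ℕ} (V : (Fin N → ℝ) → (Fin N → ℝ)) (u : (Fin N → ℝ) → ℝ)
    (x : Fin N → ℝ) : ℝ :=
  if h : DifferentiableAlong V u x then h.choose else 0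

namespace CarnotGroup

variable {N m : ℕ}

/-- The homogeneous dimension `Q = σ_1 + … + σ_N`. -/
def Q (G : CarnotGroup N m) : ℕ := ∑ i, G.σ i

/-- The dilations `D_λ` of the group. -/
def dil (G : CarnotGroup N m) (r : ℝ) (x : Fin N → ℝ) : Fin N → ℝ := anisoDilation G.σ r x

/-- The largest dilation exponent `σ_N`. -/
def topWeight (G : CarnotGroup N m) : ℕ := Finset.univ.sup G.σ

/-- The smooth homogeneous norm `‖x‖ = (∑ |x_i| ^ (2 σ_N! / σ_i)) ^ (1 / (2 σ_N!))`. -/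
noncomputable def hnorm (G : CarnotGroup N m) (x : Fin N → ℝ) : ℝ :=
  (∑ i, |x i| ^ (2 * (G.topWeight.factorial : ℝ) / (G.σ i : ℝ))) ^
    (1 / (2 * (G.topWeight.factorial : ℝ)))

/-- The quasidistance `d(x, y) = ‖y⁻¹ * x‖`. -/
noncomputable def qdist (G : CarnotGroup N m) (x y : Fin N → ℝ) : ℝ :=
  G.hnorm (G.mul (G.inv y) x)

/-- The ball `B_r(x₀)` of the quasidistance `d`. -/
def ball (G : CarnotGroup N m) (x₀ : Fin N → ℝ) (r : ℝ) : Set (Fin N → ℝ) :=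
  {x | G.qdist x x₀ < r}

/-- The set `C_{x,y}(δ)` of absolutely continuous curves `γ : [0,1] → ℝ^N` from `x` to `y` with
`γ' = ∑ a_i (Y_i)_γ` a.e. in `(0,1)` and `‖a_i‖_{L^∞(0,1)} < δ` for all `i`. -/
def admissibleCurves (G : CarnotGroup N m) (x y : Fin N → ℝ) (δ : ℝ≥0) :
    Set (ℝ → (Fin N → ℝ)) :=
  {γ | AbsolutelyContinuousOnInterval γ 0 1 ∧ γ 0 = x ∧ γ 1 = y ∧
    ∃ a : Fin m → ℝ → ℝ,
      (∀ i, MeasureTheory.AEStronglyMeasurable (a i)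
        (MeasureTheory.volume.restrict (Set.Ioo 0 1))) ∧
      (∀ i, MeasureTheory.eLpNorm (a i) ⊤
        (MeasureTheory.volume.restrict (Set.Ioo (0 : ℝ) 1)) < δ) ∧
      ∀ᵐ t ∂(MeasureTheory.volume.restrict (Set.Ioo (0 : ℝ) 1)),
        HasDerivAt γ (∑ i, a i t • G.Y i (γ t)) t}

/-- The control (Carnot–Carathéodory) distance `d_Y`, with values in `[0, ∞]`. -/
noncomputable def ccDist (G : CarnotGroup N m) (x y : Fin N → ℝ) : ℝ≥0∞ :=
  ⨅ (δ : ℝ≥0) (_ : 0 < δ) (_ : (G.admissibleCurves x y δ).Nonempty), (δ : ℝ≥0∞)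

/-- The Hölder seminorm `|u|_{C^α_Y(Ω)}` with respect to the control distance. -/
noncomputable def holderSeminorm (G : CarnotGroup N m) (α : ℝ) (Ω : Set (Fin N → ℝ))
    (u : (Fin N → ℝ) → ℝ) : ℝ≥0∞ :=
  ⨆ (x ∈ Ω) (x' ∈ Ω) (_ : x ≠ x'), ‖u x - u x'‖ₑ / G.ccDist x x' ^ α

/-- The supremum of `|u|` over `Ω`. -/
noncomputable def supNormOn (Ω : Set (Fin N → ℝ)) (u : (Fin N → ℝ) → ℝ) : ℝ≥0∞ :=
  ⨆ x ∈ Ω, ‖u x‖ₑ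

/-- The Hölder norm `‖u‖_{C^α_Y(Ω)}`. -/
noncomputable def holderNorm (G : CarnotGroup N m) (α : ℝ) (Ω : Set (Fin N → ℝ))
    (u : (Fin N → ℝ) → ℝ) : ℝ≥0∞ :=
  supNormOn Ω u + G.holderSeminorm α Ω u

/-- The space `C^α_Y(Ω)`: bounded functions with finite Hölder seminorm. -/
def MemHolder (G : CarnotGroup N m) (α : ℝ) (Ω : Set (Fin N → ℝ))
    (u : (Fin N → ℝ) → ℝ) : Prop :=
  supNormOn Ω u < ⊤ ∧ G.holderSeminorm α Ω u < ⊤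

/-- The iterated derivative `Y_I u = Y_{i_1} (Y_{i_2} (⋯ Y_{i_k} u))` for `I = [i_1, …, i_k]`. -/
noncomputable def iterDeriv (G : CarnotGroup N m) :
    List (Fin m) → ((Fin N → ℝ) → ℝ) → ((Fin N → ℝ) → ℝ)
  | [], u => u
  | i :: I, u => derivAlong (G.Y i) (G.iterDeriv I u)

/-- `Θ_{f,k} = sup_{|I| ≤ k} sup_{‖w‖ = 1} |Y_I f(w)|`. -/
noncomputable def Theta (G : CarnotGroup N m) (f : (Fin N → ℝ) → ℝ) (k : ℕ) : ℝ≥0∞ :=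
  ⨆ (I : List (Fin m)) (_ : I.length ≤ k) (w : Fin N → ℝ) (_ : G.hnorm w = 1),
    ‖G.iterDeriv I f w‖ₑ

/-- `f` is homogeneous of degree `2 - Q` away from the origin. -/
def IsHomogeneousTwoSubQ (G : CarnotGroup N m) (f : (Fin N → ℝ) → ℝ) : Prop :=
  ∀ r : ℝ, 0 < r → ∀ x, x ≠ 0 → f (G.dil r x) = r ^ (2 - (G.Q : ℤ)) * f x

/-- The potential `x ↦ ∫ f(y⁻¹ * x) φ(y) dy`. The value of `f` at the origin is irrelevant. -/
noncomputable def potential (G : CarnotGroup N m) (f φ : (Fin N → ℝ) → ℝ)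
    (x : Fin N → ℝ) : ℝ :=
  ∫ y, f (G.mul (G.inv y) x) * φ y

/-- `T_f φ = Y_h Y_l ∫ f(y⁻¹ * x) φ(y) dy`. -/
noncomputable def T (G : CarnotGroup N m) (f : (Fin N → ℝ) → ℝ) (h l : Fin m)
    (φ : (Fin N → ℝ) → ℝ) : (Fin N → ℝ) → ℝ :=
  derivAlong (G.Y h) (derivAlong (G.Y l) (G.potential f φ))

/-- `T_f φ` is well defined everywhere: the integral converges absolutely and the two successive
derivatives exist, at every point. -/
def TWellDefined (G : CarnotGroup N m) (f : (Fin N → ℝ) → ℝ) (h l : Fin m)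
    (φ : (Fin N → ℝ) → ℝ) : Prop :=
  ∀ x, MeasureTheory.Integrable (fun y => f (G.mul (G.inv y) x) * φ y) ∧
    DifferentiableAlong (G.Y l) (G.potential f φ) x ∧
    DifferentiableAlong (G.Y h) (derivAlong (G.Y l) (G.potential f φ)) x

end CarnotGroup

/-!
# Hölder estimates for second horizontal derivatives of potentials on Carnot groups

The kernel `f` is decomposed dyadically. Let `ψ` be a smooth function with compact support in
`ℝ^N \ {0}` whose dilates `ψ (D_{2^j} z)`, `j ∈ ℤ`, add up to `1` off the origin
(`exists_dyadic_cutoff`). By homogeneity, the pieces of `f` are rescalings of the single test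
function `F = f ψ`: the piece at scale `r = 2^{-j}` is `r^{-(Q-2)} F (D_{1/r} z)`. The fields `Y_i`
are left-invariant, so a derivative of a potential along `Y_i` falls on its kernel, and they have
degree one, so `Y_h Y_l` turns the pieces into the rescalings `r^{-Q} K (D_{1/r} z)` of
`K = Y_h Y_l F`. These all have the same `L¹` norm, and `∫ K = 0`, since horizontal derivatives of
test functions have mean zero (`integral_YDeriv_eq_zero`).

For a Hölder continuous density `φ`, cancellation bounds the potential of a small piece by
`|φ|_{C^α} r^α`, and the size of the kernel bounds that of a large piece by a negative power of `r`.
The series therefore converges uniformly, after zero, one and two derivatives, and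
`T_f φ = ∑_j ∫ r_j^{-Q} K (D_{1/r_j} (y⁻¹ * x)) φ(y) dy` (`tWellDefined_and_hasSum_T`). No principal
value and no extra multiple of `φ` appears, because the derivatives are taken on smooth pieces. For
two points at distance `d`, the pieces with `r_j < d` contribute
`∑ r_j^α ≲ d^α` by cancellation, and those with `r_j ≥ d` contribute `∑ d r_j^{α-1} ≲ d^α` by the
Lipschitz bound of the kernel (`abs_sub_le_of_hasSum_potential`). This bounds the Hölder seminorm.
A function supported in a ball of radius at most one vanishes at bounded distance from
every point of the ball, so `sup |φ|` is bounded by its seminorm, and so is `sup |T_f φ|`. The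
derivatives of `F` up to order three are bounded by a multiple of `Θ_{f,3}`
(`exists_bound_iterYDeriv_mul`), so that the constants depend on `f` through this number only.

Two facts on the group are needed. The first is that Lebesgue measure is bi-invariant and invariant
under inversion, because the Jacobians of these maps are invariant under dilations, hence equal to
their value at the origin (`det_fderiv_eq_of_dil`). The second is Chow's theorem, in the form that
the control distance is finite and continuous at the diagonal. The vectors `Ad_g (Y_i 0)`, with `g`
at finite distance from the origin, span a subspace that is stable under brackets with the
horizontal fields, as one sees by differentiating `Ad` along their integral curves; so they span
`ℝ^N` (`reachSpan_eq_top`), and a product of conjugated horizontal flows is a submersion onto a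
neighbourhood of the origin (`exists_eventually_ccDist_le`). Dilations do the rest.
-/

section

open Set MeasureTheory Filter

/-! ### Absolutely continuous curves -/

theorem AbsolutelyContinuousOnInterval.comp_lipschitz {X Y : Type*} [PseudoMetricSpace X]
    [PseudoMetricSpace Y] {γ : ℝ → X} {a b : ℝ} (hγ : AbsolutelyContinuousOnInterval γ a b)
    {s : Set X} {g : X → Y} {K : ℝ≥0} (hg : LipschitzOnWith K g s)
    (hs : ∀ t ∈ uIcc a b, γ t ∈ s) :
    AbsolutelyContinuousOnInterval (fun t => g (γ t)) a b := by
  have h0 : Tendsto (fun E : ℕ × (ℕ → ℝ × ℝ) =>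
      (K : ℝ) * ∑ i ∈ Finset.range E.1, dist (γ (E.2 i).1) (γ (E.2 i).2))
      (AbsolutelyContinuousOnInterval.totalLengthFilter ⊓
        𝓟 (AbsolutelyContinuousOnInterval.disjWithin a b)) (𝓝 0) := by
    simpa using Tendsto.const_mul (K : ℝ) hγ
  refine squeeze_zero' (Eventually.of_forall fun E => Finset.sum_nonneg fun i _ => dist_nonneg)
    ?_ h0
  refine eventually_inf_principal.2 (Eventually.of_forall fun E hE => ?_)
  rw [Finset.mul_sum]
  exact Finset.sum_le_sum fun i hi =>
    hg.dist_le_mul _ (hs _ (hE.1 i hi).1) _ (hs _ (hE.1 i hi).2)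

/-- Absolute continuity survives reparametrization by a monotone or antitone Lipschitz map. -/
theorem AbsolutelyContinuousOnInterval.comp_monotone {X : Type*} [PseudoMetricSpace X]
    {γ : ℝ → X} {a b c d : ℝ} (hγ : AbsolutelyContinuousOnInterval γ a b) {p : ℝ → ℝ}
    (hp : Monotone p ∨ Antitone p) {K : ℝ≥0} (hK : LipschitzWith K p)
    (hm : ∀ t ∈ uIcc c d, p t ∈ uIcc a b) :
    AbsolutelyContinuousOnInterval (fun t => γ (p t)) c d := by
  rw [absolutelyContinuousOnInterval_iff] at hγ ⊢
  intro ε hε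
  obtain ⟨δ, hδ, h⟩ := hγ ε hε
  refine ⟨δ / (K + 1), by positivity, fun E hE hl => ?_⟩
  have hE' : ((E.1, fun i => (p (E.2 i).1, p (E.2 i).2)) : ℕ × (ℕ → ℝ × ℝ)) ∈
      AbsolutelyContinuousOnInterval.disjWithin a b := by
    refine ⟨fun i hi => ⟨hm _ (hE.1 i hi).1, hm _ (hE.1 i hi).2⟩, ?_⟩
    intro i hi j hj hij
    have := hE.2 hi hj hij
    simp only [Function.onFun, uIoc, Ioc_disjoint_Ioc] at this ⊢
    rcases hp with hp | hp
    · simpa only [hp.map_min, hp.map_max] using hp this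
    · simpa only [hp.map_min, hp.map_max] using hp this
  refine h _ hE' ?_
  calc ∑ i ∈ Finset.range E.1, dist (p (E.2 i).1) (p (E.2 i).2)
        ≤ ∑ i ∈ Finset.range E.1, (K : ℝ) * dist (E.2 i).1 (E.2 i).2 :=
          Finset.sum_le_sum fun i _ => hK.dist_le_mul _ _
      _ = K * ∑ i ∈ Finset.range E.1, dist (E.2 i).1 (E.2 i).2 := by rw [Finset.mul_sum]
      _ ≤ (K + 1) * ∑ i ∈ Finset.range E.1, dist (E.2 i).1 (E.2 i).2 := by
          gcongr
          linarith
      _ < (K + 1) * (δ / (K + 1)) := by gcongr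
      _ = δ := by field_simp

/-- A `C¹` map sends absolutely continuous curves to absolutely continuous curves. -/
theorem AbsolutelyContinuousOnInterval.comp_contDiff {E F : Type*} [NormedAddCommGroup E]
    [NormedSpace ℝ E] [FiniteDimensional ℝ E] [NormedAddCommGroup F] [NormedSpace ℝ F]
    {γ : ℝ → E} {a b : ℝ} (hγ : AbsolutelyContinuousOnInterval γ a b) {g : E → F}
    (hg : ContDiff ℝ 1 g) : AbsolutelyContinuousOnInterval (fun t => g (γ t)) a b := by
  obtain ⟨C, hC⟩ := hγ.exists_bound
  have : ProperSpace E := FiniteDimensional.proper ℝ E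
  obtain ⟨K, hK⟩ := hg.contDiffOn.exists_lipschitzOnWith (s := Metric.closedBall (0 : E) C)
    (by decide) (convex_closedBall _ _) (isCompact_closedBall _ _)
  exact hγ.comp_lipschitz hK fun t ht => by simpa using hC t ht

/-- An absolutely continuous real function with derivative a.e. bounded by `C` on `[0, 1]`
varies by at most `C`. -/
theorem AbsolutelyContinuousOnInterval.abs_sub_le {g : ℝ → ℝ}
    (hg : AbsolutelyContinuousOnInterval g 0 1) {C : ℝ}
    (hC : ∀ᵐ t ∂(volume.restrict (Ioo (0 : ℝ) 1)), |deriv g t| ≤ C) : |g 1 - g 0| ≤ C := by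
  rw [← hg.integral_deriv_eq_sub]
  have h : ∀ᵐ t, t ∈ uIoc (0 : ℝ) 1 → ‖deriv g t‖ ≤ C := by
    rw [uIoc_of_le zero_le_one, ← ae_restrict_iff' measurableSet_Ioc,
      ← restrict_Ioo_eq_restrict_Ioc]
    exact hC
  simpa using intervalIntegral.norm_integral_le_of_norm_le_const_ae h

theorem ae_comp_affine {P : ℝ → Prop} (h : ∀ᵐ t, P t) (p : ℝ) {q : ℝ} (hq : q ≠ 0) :
    ∀ᵐ t, P (p + q * t) := by
  have h1 : volume ((fun t => q * t) ⁻¹' ((fun t => p + t) ⁻¹' {t | ¬ P t})) = 0 := by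
    rw [Real.volume_preimage_mul_left hq, measure_preimage_add, ae_iff.1 h, mul_zero]
  exact ae_iff.2 h1

namespace LieGroupLaw

variable {N : ℕ} (L : LieGroupLaw N)

theorem inv_mul_cancel_left (x y : Fin N → ℝ) : L.mul (L.inv x) (L.mul x y) = y := by
  rw [← L.mul_assoc, L.inv_mul, L.zero_mul]

theorem mul_inv_cancel_left (x y : Fin N → ℝ) : L.mul x (L.mul (L.inv x) y) = y := by
  rw [← L.mul_assoc, L.mul_inv, L.zero_mul]

theorem inv_mul_cancel_right (x y : Fin N → ℝ) : L.mul (L.mul x (L.inv y)) y = x := by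
  rw [L.mul_assoc, L.inv_mul, L.mul_zero]

theorem mul_inv_cancel_right (x y : Fin N → ℝ) : L.mul (L.mul x y) (L.inv y) = x := by
  rw [L.mul_assoc, L.mul_inv, L.mul_zero]

theorem eq_inv_of_mul_eq_zero {x y : Fin N → ℝ} (h : L.mul x y = 0) : y = L.inv x := by
  rw [← L.inv_mul_cancel_left x y, h, L.mul_zero]

theorem inv_zero : L.inv 0 = 0 := (L.eq_inv_of_mul_eq_zero (L.zero_mul 0)).symm

theorem inv_inv (x : Fin N → ℝ) : L.inv (L.inv x) = x :=
  (L.eq_inv_of_mul_eq_zero (L.inv_mul x)).symm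

theorem inv_mul_rev (x y : Fin N → ℝ) : L.inv (L.mul x y) = L.mul (L.inv y) (L.inv x) := by
  refine (L.eq_inv_of_mul_eq_zero ?_).symm
  rw [L.mul_assoc, L.mul_inv_cancel_left, L.mul_inv]

theorem contDiff_mul_comp {E : Type*} [NormedAddCommGroup E] [NormedSpace ℝ E]
    {f g : E → Fin N → ℝ} {n : ℕ∞} (hf : ContDiff ℝ n f) (hg : ContDiff ℝ n g) :
    ContDiff ℝ n fun t => L.mul (f t) (g t) :=
  (L.contDiff_mul.of_le (by exact_mod_cast le_top)).comp (hf.prodMk hg)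

theorem contDiff_mul_left (x : Fin N → ℝ) : ContDiff ℝ ∞ (L.mul x) :=
  L.contDiff_mul_comp contDiff_const contDiff_id

theorem contDiff_mul_right (y : Fin N → ℝ) : ContDiff ℝ ∞ fun x => L.mul x y :=
  L.contDiff_mul_comp contDiff_id contDiff_const

theorem continuous_mul {X : Type*} [TopologicalSpace X] {f g : X → Fin N → ℝ}
    (hf : Continuous f) (hg : Continuous g) : Continuous fun t => L.mul (f t) (g t) :=
  L.contDiff_mul.continuous.comp (hf.prodMk hg)

theorem continuous_inv {X : Type*} [TopologicalSpace X] {f : X → Fin N → ℝ}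
    (hf : Continuous f) : Continuous fun t => L.inv (f t) :=
  L.contDiff_inv.continuous.comp hf

end LieGroupLaw

namespace CarnotGroup

variable {N m : ℕ} (G : CarnotGroup N m)

/-! ### Dilations -/

/-- The dilation `D_r` as a continuous linear map. -/
noncomputable def dilL (r : ℝ) : (Fin N → ℝ) →L[ℝ] (Fin N → ℝ) :=
  ContinuousLinearMap.pi fun i => (r ^ G.σ i) • ContinuousLinearMap.proj i

@[simp] theorem dilL_apply (r : ℝ) (x : Fin N → ℝ) : G.dilL r x = G.dil r x := by
  ext i; simp [dilL, dil, anisoDilation]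

theorem dil_apply (r : ℝ) (x : Fin N → ℝ) (i : Fin N) : G.dil r x i = r ^ G.σ i * x i := rfl

theorem contDiff_dil (r : ℝ) : ContDiff ℝ ∞ (G.dil r) := by
  have : G.dil r = G.dilL r := by ext1 x; simp
  rw [this]; exact (G.dilL r).contDiff

theorem hasFDerivAt_dil (r : ℝ) (x : Fin N → ℝ) : HasFDerivAt (G.dil r) (G.dilL r) x := by
  have : G.dil r = G.dilL r := by ext1 x; simp
  rw [this]; exact (G.dilL r).hasFDerivAt

theorem dil_dil (r s : ℝ) (x : Fin N → ℝ) : G.dil r (G.dil s x) = G.dil (r * s) x := by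
  ext i; simp only [dil_apply, mul_pow]; ring

@[simp] theorem dil_one (x : Fin N → ℝ) : G.dil 1 x = x := by ext i; simp [dil_apply]

@[simp] theorem dil_zero_right (r : ℝ) : G.dil r 0 = 0 := by ext i; simp [dil_apply]

theorem dil_inv_dil {r : ℝ} (hr : 0 < r) (x : Fin N → ℝ) : G.dil r⁻¹ (G.dil r x) = x := by
  rw [dil_dil, inv_mul_cancel₀ hr.ne', dil_one]

theorem dil_dil_inv {r : ℝ} (hr : 0 < r) (x : Fin N → ℝ) : G.dil r (G.dil r⁻¹ x) = x := by
  rw [dil_dil, mul_inv_cancel₀ hr.ne', dil_one]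

theorem dil_ne_zero {r : ℝ} (hr : 0 < r) {x : Fin N → ℝ} (hx : x ≠ 0) : G.dil r x ≠ 0 := by
  intro h; apply hx; rw [← G.dil_inv_dil hr x, h, dil_zero_right]

theorem dil_mul_eq {r : ℝ} (hr : 0 < r) (x y : Fin N → ℝ) :
    G.dil r (G.mul x y) = G.mul (G.dil r x) (G.dil r y) := G.dil_mul r hr x y

theorem dil_inv_eq {r : ℝ} (hr : 0 < r) (x : Fin N → ℝ) :
    G.dil r (G.inv x) = G.inv (G.dil r x) := by
  apply G.eq_inv_of_mul_eq_zero
  rw [← G.dil_mul_eq hr, G.mul_inv, dil_zero_right]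

theorem one_le_σ (i : Fin N) : 1 ≤ G.σ i := by
  have hN : 0 < N := i.pos
  rw [← G.σ_first hN]
  exact G.σ_mono (by simp [Fin.le_def])

/-! ### The horizontal fields -/

theorem contDiff_Y (i : Fin m) : ContDiff ℝ ∞ (G.Y i) := (G.Y_mem i).1

theorem fderiv_mul_left_Y (i : Fin m) (g x : Fin N → ℝ) :
    fderiv ℝ (G.mul g) x (G.Y i x) = G.Y i (G.mul g x) := (G.Y_mem i).2 g x

theorem dilL_Y (i : Fin m) {r : ℝ} (hr : 0 < r) (x : Fin N → ℝ) :
    G.dilL r (G.Y i x) = r • G.Y i (G.dil r x) := by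
  rw [dilL_apply]; exact G.Y_homogeneous i r hr x

/-! ### Admissible curves and the control distance -/

/-- Admissible curves may be described by controls that are measurable and bounded everywhere by
a number smaller than `δ`. -/
theorem mem_admissibleCurves_iff {x y : Fin N → ℝ} {δ : ℝ≥0} (hδ : 0 < δ)
    {γ : ℝ → Fin N → ℝ} :
    γ ∈ G.admissibleCurves x y δ ↔ AbsolutelyContinuousOnInterval γ 0 1 ∧ γ 0 = x ∧ γ 1 = y ∧
      ∃ c : ℝ≥0, c < δ ∧ ∃ a : Fin m → ℝ → ℝ, (∀ i, Measurable (a i)) ∧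
        (∀ i t, |a i t| ≤ c) ∧
        ∀ᵐ t, t ∈ Ioo (0 : ℝ) 1 → HasDerivAt γ (∑ i, a i t • G.Y i (γ t)) t := by
  constructor
  · rintro ⟨h1, h2, h3, a, ha, hb, hd⟩
    refine ⟨h1, h2, h3, Finset.univ.sup fun i =>
      (eLpNorm (a i) ⊤ (volume.restrict (Ioo (0 : ℝ) 1))).toNNReal, ?_, ?_⟩
    · rw [Finset.sup_lt_iff (by simpa using hδ)]
      intro i _
      have := hb i
      rw [← ENNReal.coe_toNNReal this.ne_top] at this
      exact_mod_cast this
    · set c : ℝ≥0 := Finset.univ.sup fun i =>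
        (eLpNorm (a i) ⊤ (volume.restrict (Ioo (0 : ℝ) 1))).toNNReal with hc
      -- truncation of a measurable representative at the essential supremum
      refine ⟨fun i t => max (-c) (min c ((ha i).mk _ t)), fun i => ?_, fun i t => ?_, ?_⟩
      · exact measurable_const.max (measurable_const.min (ha i).stronglyMeasurable_mk.measurable)
      · rw [abs_le]
        exact ⟨le_max_left _ _, max_le (by linarith [c.2]) (min_le_left _ _)⟩
      · rw [← ae_restrict_iff' measurableSet_Ioo]
        have hae : ∀ᵐ t ∂(volume.restrict (Ioo (0 : ℝ) 1)), ∀ i,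
            max (-(c : ℝ)) (min c ((ha i).mk _ t)) = a i t := by
          rw [ae_all_iff]
          intro i
          filter_upwards [(ha i).ae_eq_mk,
            ae_le_eLpNormEssSup (f := a i) (μ := volume.restrict (Ioo (0 : ℝ) 1))] with t h1 h2
          rw [← h1]
          have h3 : |a i t| ≤ c := by
            have h4 : ‖a i t‖ₑ ≤ (c : ℝ≥0∞) := by
              refine h2.trans ?_
              rw [← eLpNorm_exponent_top, ← ENNReal.coe_toNNReal (hb i).ne_top]
              exact_mod_cast Finset.le_sup (f := fun i =>
                (eLpNorm (a i) ⊤ (volume.restrict (Ioo (0 : ℝ) 1))).toNNReal) (Finset.mem_univ i)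
            have h5 : ‖a i t‖₊ ≤ c := by exact_mod_cast h4
            exact_mod_cast h5
          rw [min_eq_right (abs_le.1 h3).2, max_eq_right (abs_le.1 h3).1]
        filter_upwards [hae, hd] with t h1 h2
        simpa only [h1] using h2
  · rintro ⟨h1, h2, h3, c, hc, a, ha, hb, hd⟩
    refine ⟨h1, h2, h3, a, fun i => (ha i).aestronglyMeasurable, fun i => ?_, ?_⟩
    · refine lt_of_le_of_lt ?_ (ENNReal.coe_lt_coe.2 hc)
      rw [eLpNorm_exponent_top]
      refine eLpNormEssSup_le_of_ae_nnnorm_bound (Eventually.of_forall fun t => ?_)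
      exact_mod_cast hb i t
    · rwa [ae_restrict_iff' measurableSet_Ioo]

theorem ccDist_le {x y : Fin N → ℝ} {δ : ℝ≥0} (hδ : 0 < δ)
    (h : (G.admissibleCurves x y δ).Nonempty) : G.ccDist x y ≤ δ :=
  iInf_le_of_le δ (iInf_le_of_le hδ (iInf_le_of_le h le_rfl))

/-- Almost minimal admissible curves. -/
theorem exists_of_ccDist_lt {x y : Fin N → ℝ} {c : ℝ≥0∞} (h : G.ccDist x y < c) :
    ∃ δ : ℝ≥0, 0 < δ ∧ (δ : ℝ≥0∞) < c ∧ (G.admissibleCurves x y δ).Nonempty := by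
  simp only [ccDist, iInf_lt_iff] at h
  obtain ⟨δ, h1, h2, h3⟩ := h
  exact ⟨δ, h1, h3, h2⟩

theorem le_ccDist {x y : Fin N → ℝ} {c : ℝ≥0∞}
    (h : ∀ δ : ℝ≥0, 0 < δ → (G.admissibleCurves x y δ).Nonempty → c ≤ δ) : c ≤ G.ccDist x y :=
  le_iInf fun δ => le_iInf fun h1 => le_iInf fun h2 => h δ h1 h2

/-- A smooth map which multiplies the horizontal fields by `c` multiplies the control distance
by at most `c`. -/
theorem ccDist_map_le {Φ : (Fin N → ℝ) → Fin N → ℝ} (hΦ : ContDiff ℝ ∞ Φ) {c : ℝ≥0}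
    (hc : 0 < c) (h : ∀ i x, fderiv ℝ Φ x (G.Y i x) = (c : ℝ) • G.Y i (Φ x))
    (x y : Fin N → ℝ) : G.ccDist (Φ x) (Φ y) ≤ c * G.ccDist x y := by
  rw [mul_comm, ← ENNReal.div_le_iff (by exact_mod_cast hc.ne') ENNReal.coe_ne_top]
  refine G.le_ccDist fun δ hδ ⟨γ, hγ⟩ => ?_
  rw [ENNReal.div_le_iff (by exact_mod_cast hc.ne') ENNReal.coe_ne_top, mul_comm,
    ← ENNReal.coe_mul]
  have hcδ : 0 < c * δ := mul_pos hc hδ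
  refine G.ccDist_le hcδ ⟨fun t => Φ (γ t), (G.mem_admissibleCurves_iff hcδ).2 ?_⟩
  obtain ⟨h1, h2, h3, k, hk, a, ha, hb, hd⟩ := (G.mem_admissibleCurves_iff hδ).1 hγ
  refine ⟨h1.comp_contDiff (hΦ.of_le (by exact_mod_cast le_top)), by rw [h2], by rw [h3], c * k,
    mul_lt_mul_of_pos_left hk hc, fun i t => c * a i t, fun i => (ha i).const_mul _,
    fun i t => ?_, ?_⟩
  · rw [abs_mul, NNReal.coe_mul, NNReal.abs_eq]
    exact mul_le_mul_of_nonneg_left (hb i t) c.2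
  · filter_upwards [hd] with t ht h01
    have := ((hΦ.differentiable (by simp)) (γ t)).hasFDerivAt.comp_hasDerivAt t (ht h01)
    refine this.congr_deriv ?_
    rw [map_sum]
    refine Finset.sum_congr rfl fun i _ => ?_
    rw [map_smul, h, smul_smul, mul_comm]

theorem ccDist_mul_left_le (g x y : Fin N → ℝ) :
    G.ccDist (G.mul g x) (G.mul g y) ≤ G.ccDist x y := by
  simpa using G.ccDist_map_le (G.contDiff_mul_left g) (c := 1) one_pos
    (fun i x => by simpa using G.fderiv_mul_left_Y i g x) x y

theorem ccDist_mul_left (g x y : Fin N → ℝ) :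
    G.ccDist (G.mul g x) (G.mul g y) = G.ccDist x y := by
  refine le_antisymm (G.ccDist_mul_left_le g x y) ?_
  simpa [G.inv_mul_cancel_left] using G.ccDist_mul_left_le (G.inv g) (G.mul g x) (G.mul g y)

theorem ccDist_eq_zero_left (x y : Fin N → ℝ) :
    G.ccDist x y = G.ccDist 0 (G.mul (G.inv x) y) := by
  rw [← G.ccDist_mul_left (G.inv x) x y, G.inv_mul]

theorem ccDist_dil_le {r : ℝ≥0} (hr : 0 < r) (x y : Fin N → ℝ) :
    G.ccDist (G.dil r x) (G.dil r y) ≤ r * G.ccDist x y :=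
  G.ccDist_map_le (G.contDiff_dil r) hr (fun i x => by
    rw [(G.hasFDerivAt_dil r x).fderiv, G.dilL_Y i (by exact_mod_cast hr)]) x y

/-- Affine reparametrization of an admissible curve. -/
theorem admissibleCurves_comp_affine {x y : Fin N → ℝ} {δ : ℝ≥0} (hδ : 0 < δ)
    {γ : ℝ → Fin N → ℝ} (hγ : γ ∈ G.admissibleCurves x y δ) {p q : ℝ} (hq : q ≠ 0)
    (hp : p ∈ Icc (0 : ℝ) 1) (hpq : p + q ∈ Icc (0 : ℝ) 1) :
    (fun t => γ (p + q * t)) ∈ G.admissibleCurves (γ p) (γ (p + q)) δ := by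
  obtain ⟨h1, h2, h3, k, hk, a, ha, hb, hd⟩ := (G.mem_admissibleCurves_iff hδ).1 hγ
  have hq1 : |q| ≤ 1 := abs_le.2 ⟨by linarith [hp.2, hpq.1], by linarith [hp.1, hpq.2]⟩
  refine (G.mem_admissibleCurves_iff hδ).2 ⟨?_, by simp, by simp, k, hk,
    fun i t => q * a i (p + q * t), fun i => ?_, fun i t => ?_, ?_⟩
  · refine h1.comp_monotone (p := fun t => p + q * t) (K := Real.nnabs q) ?_ ?_ ?_
    · rcases le_total 0 q with h | h
      · exact Or.inl fun s t hst => by nlinarith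
      · exact Or.inr fun s t hst => by nlinarith
    · refine LipschitzWith.of_dist_le_mul fun s t => ?_
      rw [Real.dist_eq, Real.dist_eq, Real.coe_nnabs, ← abs_mul]
      ring_nf; rfl
    · intro t ht
      rw [uIcc_of_le zero_le_one] at ht ⊢
      constructor
      · nlinarith [hp.1, hpq.1, ht.1, ht.2]
      · nlinarith [hp.2, hpq.2, ht.1, ht.2]
  · exact ((ha i).comp (measurable_const.add (measurable_id.const_mul q))).const_mul q
  · rw [abs_mul]
    calc |q| * |a i (p + q * t)| ≤ 1 * k := by gcongr; exact hb i _
      _ = k := one_mul _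
  · filter_upwards [ae_comp_affine hd p hq] with t ht h01
    have hmem : p + q * t ∈ Ioo (0 : ℝ) 1 := by
      have h1t : 0 < 1 - t := sub_pos.2 h01.2
      have e : p + q * t = (1 - t) * p + t * (p + q) := by ring
      rw [e]
      rcases lt_or_gt_of_ne hq with h | h
      · constructor
        · nlinarith [hp.1, hpq.1, mul_pos h1t (neg_pos.2 h), h01.1]
        · nlinarith [hp.2, hpq.2, mul_pos h01.1 (neg_pos.2 h), h01.1]
      · constructor
        · nlinarith [hp.1, hpq.1, mul_pos h01.1 h, h01.1]
        · nlinarith [hp.2, hpq.2, mul_pos h1t h, h01.1]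
    have hl : HasDerivAt (fun t => p + q * t) q t := by
      simpa using ((hasDerivAt_id t).const_mul q).const_add p
    have := (ht hmem).scomp t hl
    refine this.congr_deriv ?_
    rw [Finset.smul_sum]
    exact Finset.sum_congr rfl fun i _ => by rw [smul_smul]

theorem ccDist_comm_le (x y : Fin N → ℝ) : G.ccDist x y ≤ G.ccDist y x := by
  refine G.le_ccDist fun δ hδ ⟨γ, hγ⟩ => G.ccDist_le hδ ⟨fun t => γ (1 + (-1) * t), ?_⟩
  have := G.admissibleCurves_comp_affine hδ hγ (p := 1) (q := -1) (by norm_num) (by simp)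
    (by simp)
  simpa [hγ.2.1, hγ.2.2.1] using this

theorem ccDist_comm (x y : Fin N → ℝ) : G.ccDist x y = G.ccDist y x :=
  le_antisymm (G.ccDist_comm_le x y) (G.ccDist_comm_le y x)

theorem ccDist_zero_inv (x : Fin N → ℝ) : G.ccDist 0 (G.inv x) = G.ccDist 0 x := by
  rw [G.ccDist_comm 0 x, G.ccDist_eq_zero_left x 0, G.mul_zero]

/-- An admissible curve that leaves the open set `U` reaches `U \ S` before, when `S ⊆ U` is
closed and contains the starting point. -/
theorem exists_mem_diff_of_exit {x y : Fin N → ℝ} {δ : ℝ≥0} (hδ : 0 < δ)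
    (h : (G.admissibleCurves x y δ).Nonempty) {S U : Set (Fin N → ℝ)} (hS : IsClosed S)
    (hU : IsOpen U) (hSU : S ⊆ U) (hx : x ∈ S) (hy : y ∉ U) :
    ∃ z ∈ U \ S, G.ccDist x z ≤ δ := by
  obtain ⟨γ, hγ⟩ := h
  have hc : ContinuousOn γ (Icc 0 1) := by
    simpa [uIcc_of_le] using hγ.1.continuousOn
  obtain ⟨z, ⟨t, ht, rfl⟩, hz⟩ := (isPreconnected_Icc.image γ hc) U Sᶜ hU hS.isOpen_compl
    (fun z _ => by by_cases hz : z ∈ S; exacts [Or.inl (hSU hz), Or.inr hz])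
    ⟨x, ⟨0, by simp, hγ.2.1⟩, hSU hx⟩ ⟨y, ⟨1, by simp, hγ.2.2.1⟩, fun h => hy (hSU h)⟩
  refine ⟨γ t, hz, G.ccDist_le hδ ⟨fun s => γ (0 + t * s), ?_⟩⟩
  have ht0 : t ≠ 0 := by rintro rfl; exact hz.2 (hγ.2.1 ▸ hx)
  have := G.admissibleCurves_comp_affine hδ hγ (p := 0) (q := t) ht0 (by simp) (by simpa using ht)
  simpa [hγ.2.1] using this

/-- Concatenation of admissible curves, each run at double speed. -/
theorem admissibleCurves_concat {x y z : Fin N → ℝ} {δ : ℝ≥0} (hδ : 0 < δ)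
    (h₁ : (G.admissibleCurves x y δ).Nonempty) (h₂ : (G.admissibleCurves y z δ).Nonempty) :
    (G.admissibleCurves x z (2 * δ)).Nonempty := by
  obtain ⟨γ, hγ⟩ := h₁
  obtain ⟨η, hη⟩ := h₂
  obtain ⟨hγ1, hγ2, hγ3, k, hk, a, ha, hb, hd⟩ := (G.mem_admissibleCurves_iff hδ).1 hγ
  obtain ⟨hη1, hη2, hη3, k', hk', a', ha', hb', hd'⟩ := (G.mem_admissibleCurves_iff hδ).1 hη
  have h2δ : 0 < 2 * δ := by positivity
  -- written as a sum, so that absolute continuity follows from that of the summands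
  set ζ : ℝ → Fin N → ℝ := fun t => γ (min (2 * t) 1) + η (max (2 * t - 1) 0) - y with hζ
  have hζ1 : ∀ t ≤ (1 / 2 : ℝ), ζ t = γ (2 * t) := fun t ht => by
    simp only [hζ]
    rw [min_eq_left (by linarith), max_eq_right (by linarith), hη2, add_sub_cancel_right]
  have hζ2 : ∀ t ≥ (1 / 2 : ℝ), ζ t = η (-1 + 2 * t) := fun t ht => by
    simp only [hζ]
    rw [min_eq_right (by linarith), max_eq_left (by linarith), hγ3, add_sub_cancel_left]
    ring_nf
  refine ⟨ζ, (G.mem_admissibleCurves_iff h2δ).2 ⟨?_, ?_, ?_, 2 * max k k', ?_,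
    fun i => (Iio (1 / 2 : ℝ)).piecewise (fun t => 2 * a i (2 * t))
      (fun t => 2 * a' i (-1 + 2 * t)), fun i => ?_, fun i t => ?_, ?_⟩⟩
  · have e1 : AbsolutelyContinuousOnInterval (fun t => γ (min (2 * t) 1)) 0 1 := by
      refine hγ1.comp_monotone (p := fun t => min (2 * t) 1) (K := 2) (Or.inl ?_) ?_ ?_
      · exact fun s t hst => min_le_min_right _ (by linarith)
      · refine LipschitzWith.of_dist_le_mul fun s t => ?_
        calc dist (min (2 * s) 1) (min (2 * t) 1) ≤ |2 * s - 2 * t| := by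
              rw [Real.dist_eq]; simpa using abs_min_sub_min_le_max (2 * s) 1 (2 * t) 1
          _ = (2 : ℝ≥0) * dist s t := by
              rw [Real.dist_eq, ← mul_sub, abs_mul]; simp
      · intro t ht
        rw [uIcc_of_le zero_le_one] at ht ⊢
        exact ⟨le_min (by linarith [ht.1]) zero_le_one, min_le_right _ _⟩
    have e2 : AbsolutelyContinuousOnInterval (fun t => η (max (2 * t - 1) 0)) 0 1 := by
      refine hη1.comp_monotone (p := fun t => max (2 * t - 1) 0) (K := 2) (Or.inl ?_) ?_ ?_
      · exact fun s t hst => max_le_max_right _ (by linarith)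
      · refine LipschitzWith.of_dist_le_mul fun s t => ?_
        calc dist (max (2 * s - 1) 0) (max (2 * t - 1) 0) ≤ |(2 * s - 1) - (2 * t - 1)| := by
              rw [Real.dist_eq]; simpa using abs_max_sub_max_le_max (2 * s - 1) 0 (2 * t - 1) 0
          _ = (2 : ℝ≥0) * dist s t := by
              rw [Real.dist_eq, sub_sub_sub_cancel_right, ← mul_sub, abs_mul]; simp
      · intro t ht
        rw [uIcc_of_le zero_le_one] at ht ⊢
        exact ⟨le_max_right _ _, max_le (by linarith [ht.2]) zero_le_one⟩
    have e3 : AbsolutelyContinuousOnInterval (fun _ : ℝ => y) 0 1 :=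
      (LipschitzWith.const y).lipschitzOnWith.absolutelyContinuousOnInterval
    exact (e1.add e2).sub e3
  · rw [hζ1 0 (by norm_num)]; simpa using hγ2
  · rw [hζ2 1 (by norm_num)]; convert hη3 using 2; norm_num
  · exact mul_lt_mul_of_pos_left (max_lt hk hk') two_pos
  · refine Measurable.piecewise measurableSet_Iio ?_ ?_
    · exact ((ha i).comp (measurable_id.const_mul 2)).const_mul 2
    · exact ((ha' i).comp (measurable_const.add (measurable_id.const_mul 2))).const_mul 2
  · by_cases ht : t ∈ Iio (1 / 2 : ℝ)
    · beta_reduce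
      rw [piecewise_eq_of_mem _ _ _ ht, abs_mul]
      have := (hb i (2 * t)).trans (NNReal.coe_le_coe.2 (le_max_left k k'))
      simpa using this
    · beta_reduce
      rw [piecewise_eq_of_notMem _ _ _ ht, abs_mul]
      have := (hb' i (-1 + 2 * t)).trans (NNReal.coe_le_coe.2 (le_max_right k k'))
      simpa using this
  · filter_upwards [ae_comp_affine hd 0 two_ne_zero, ae_comp_affine hd' (-1) two_ne_zero,
      Measure.ae_ne volume (1 / 2 : ℝ)] with t h1 h2 hne h01
    have hl : ∀ p : ℝ, HasDerivAt (fun t => p + 2 * t) 2 t := fun p => by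
      simpa using ((hasDerivAt_id t).const_mul (2 : ℝ)).const_add p
    rcases lt_or_gt_of_ne hne with h | h
    · have hev : ζ =ᶠ[𝓝 t] fun t => γ (0 + 2 * t) := by
        filter_upwards [Iio_mem_nhds h] with s hs
        rw [hζ1 s (le_of_lt hs), zero_add]
      refine HasDerivAt.congr_of_eventuallyEq ?_ hev
      have := (h1 ⟨by linarith [h01.1], by linarith⟩).scomp t (hl 0)
      refine this.congr_deriv ?_
      rw [Finset.smul_sum]
      refine Finset.sum_congr rfl fun i _ => ?_
      rw [piecewise_eq_of_mem _ _ _ (mem_Iio.2 h), hζ1 t h.le, smul_smul, zero_add]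
    · have hev : ζ =ᶠ[𝓝 t] fun t => η (-1 + 2 * t) := by
        filter_upwards [Ioi_mem_nhds h] with s hs
        rw [hζ2 s (le_of_lt hs)]
      refine HasDerivAt.congr_of_eventuallyEq ?_ hev
      have := (h2 ⟨by linarith, by linarith [h01.2]⟩).scomp t (hl (-1))
      refine this.congr_deriv ?_
      rw [Finset.smul_sum]
      refine Finset.sum_congr rfl fun i _ => ?_
      rw [piecewise_eq_of_notMem _ _ _ (by simpa using h.le), hζ2 t h.le, smul_smul]

/-- A quasi-triangle inequality, enough for finiteness and local boundedness of `ccDist`. -/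
theorem ccDist_le_two_mul_max (x y z : Fin N → ℝ) :
    G.ccDist x z ≤ 2 * max (G.ccDist x y) (G.ccDist y z) := by
  rw [mul_comm, ← ENNReal.div_le_iff two_ne_zero ENNReal.ofNat_ne_top]
  refine le_of_forall_gt fun c hc => ?_
  obtain ⟨δ₁, hδ₁, h1, h1'⟩ := G.exists_of_ccDist_lt (lt_of_le_of_lt (le_max_left _ _) hc)
  obtain ⟨δ₂, hδ₂, h2, h2'⟩ := G.exists_of_ccDist_lt (lt_of_le_of_lt (le_max_right _ _) hc)
  have mono : ∀ {x y : Fin N → ℝ} {δ δ' : ℝ≥0}, δ ≤ δ' → (G.admissibleCurves x y δ).Nonempty →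
      (G.admissibleCurves x y δ').Nonempty := by
    rintro x y δ δ' hle ⟨γ, g1, g2, g3, a, ha, hb, hd⟩
    exact ⟨γ, g1, g2, g3, a, ha, fun i => (hb i).trans_le (by exact_mod_cast hle), hd⟩
  have hpos : 0 < max δ₁ δ₂ := lt_max_of_lt_left hδ₁
  have := G.ccDist_le (by positivity) (G.admissibleCurves_concat hpos (mono (le_max_left _ _) h1')
    (mono (le_max_right _ _) h2'))
  refine lt_of_le_of_lt ?_ (max_lt h1 h2)
  rw [ENNReal.div_le_iff two_ne_zero ENNReal.ofNat_ne_top, mul_comm]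
  simpa using this

/-- A function whose horizontal derivatives are bounded by `M` is Lipschitz for `ccDist`. -/
theorem enorm_sub_le_ccDist {K : (Fin N → ℝ) → ℝ} (hK : ContDiff ℝ 1 K) {M : ℝ} (hM : 0 ≤ M)
    (h : ∀ i x, |fderiv ℝ K x (G.Y i x)| ≤ M) (x y : Fin N → ℝ) :
    ‖K y - K x‖ₑ ≤ ENNReal.ofReal (m * M + 1) * G.ccDist x y := by
  have hpos : 0 < m * M + 1 := by positivity
  rw [mul_comm, ← ENNReal.div_le_iff (by simpa using hpos) ENNReal.ofReal_ne_top]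
  refine G.le_ccDist fun δ hδ ⟨γ, hγ⟩ => ?_
  rw [ENNReal.div_le_iff (by simpa using hpos) ENNReal.ofReal_ne_top]
  obtain ⟨h1, h2, h3, k, hk, a, ha, hb, hd⟩ := (G.mem_admissibleCurves_iff hδ).1 hγ
  have hb1 := (h1.comp_contDiff hK).abs_sub_le (C := m * M * δ) ?_
  · rw [h2, h3] at hb1
    rw [Real.enorm_eq_ofReal_abs, ← ENNReal.ofReal_coe_nnreal, ← ENNReal.ofReal_mul (by positivity)]
    refine ENNReal.ofReal_le_ofReal (hb1.trans ?_)
    nlinarith [δ.2]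
  · rw [ae_restrict_iff' measurableSet_Ioo]
    filter_upwards [hd] with t ht h01
    have := ((hK.differentiable (by simp)) (γ t)).hasFDerivAt.comp_hasDerivAt t (ht h01)
    have e : deriv (fun t => K (γ t)) t = ∑ i, a i t * fderiv ℝ K (γ t) (G.Y i (γ t)) := by
      rw [show (fun t => K (γ t)) = K ∘ γ from rfl, this.deriv, map_sum]
      exact Finset.sum_congr rfl fun i _ => by rw [map_smul, smul_eq_mul]
    rw [e]
    calc |∑ i, a i t * fderiv ℝ K (γ t) (G.Y i (γ t))|
        ≤ ∑ i, |a i t * fderiv ℝ K (γ t) (G.Y i (γ t))| := Finset.abs_sum_le_sum_abs _ _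
      _ ≤ ∑ _i : Fin m, (δ : ℝ) * M := by
          refine Finset.sum_le_sum fun i _ => ?_
          rw [abs_mul]
          exact mul_le_mul ((hb i t).trans (by exact_mod_cast hk.le)) (h i _) (abs_nonneg _) δ.2
      _ = m * M * δ := by simp; ring

end CarnotGroup

namespace LieGroupLaw

variable {N : ℕ} (L : LieGroupLaw N)

/-! ### The adjoint action -/

/-- The derivative of the group law as a map of two variables. -/
noncomputable def dmul (p : (Fin N → ℝ) × (Fin N → ℝ)) :
    (Fin N → ℝ) × (Fin N → ℝ) →L[ℝ] (Fin N → ℝ) :=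
  fderiv ℝ (fun p : (Fin N → ℝ) × (Fin N → ℝ) => L.mul p.1 p.2) p

theorem hasStrictFDerivAt_mul (p : (Fin N → ℝ) × (Fin N → ℝ)) :
    HasStrictFDerivAt (fun p : (Fin N → ℝ) × (Fin N → ℝ) => L.mul p.1 p.2) (L.dmul p) p :=
  (L.contDiff_mul.contDiffAt).hasStrictFDerivAt (by simp)

theorem hasFDerivAt_mul (p : (Fin N → ℝ) × (Fin N → ℝ)) :
    HasFDerivAt (fun p : (Fin N → ℝ) × (Fin N → ℝ) => L.mul p.1 p.2) (L.dmul p) p :=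
  (L.hasStrictFDerivAt_mul p).hasFDerivAt

theorem hasStrictFDerivAt_mul_comp {X : Type*} [NormedAddCommGroup X] [NormedSpace ℝ X]
    {f g : X → Fin N → ℝ} {f' g' : X →L[ℝ] Fin N → ℝ} {x : X} (hf : HasStrictFDerivAt f f' x)
    (hg : HasStrictFDerivAt g g' x) :
    HasStrictFDerivAt (fun t => L.mul (f t) (g t)) ((L.dmul (f x, g x)).comp (f'.prod g')) x :=
  HasStrictFDerivAt.comp (g := fun p : (Fin N → ℝ) × (Fin N → ℝ) => L.mul p.1 p.2)
    (f := fun t => (f t, g t)) x (L.hasStrictFDerivAt_mul (f x, g x)) (hf.prodMk hg)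

theorem hasFDerivAt_mul_comp {X : Type*} [NormedAddCommGroup X] [NormedSpace ℝ X]
    {f g : X → Fin N → ℝ} {f' g' : X →L[ℝ] Fin N → ℝ} {x : X} (hf : HasFDerivAt f f' x)
    (hg : HasFDerivAt g g' x) :
    HasFDerivAt (fun t => L.mul (f t) (g t)) ((L.dmul (f x, g x)).comp (f'.prod g')) x :=
  HasFDerivAt.comp (g := fun p : (Fin N → ℝ) × (Fin N → ℝ) => L.mul p.1 p.2)
    (f := fun t => (f t, g t)) x (L.hasFDerivAt_mul (f x, g x)) (hf.prodMk hg)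

theorem hasFDerivAt_mul_left (x y : Fin N → ℝ) :
    HasFDerivAt (L.mul x) ((L.dmul (x, y)).comp (ContinuousLinearMap.inr ℝ _ _)) y :=
  L.hasFDerivAt_mul_comp (hasFDerivAt_const x y) (hasFDerivAt_id y)

theorem hasFDerivAt_mul_right (x y : Fin N → ℝ) :
    HasFDerivAt (fun z => L.mul z y) ((L.dmul (x, y)).comp (ContinuousLinearMap.inl ℝ _ _)) x :=
  L.hasFDerivAt_mul_comp (hasFDerivAt_id x) (hasFDerivAt_const y x)

theorem dmul_zero_right (x v : Fin N → ℝ) : L.dmul (x, 0) (v, 0) = v := by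
  have h := L.hasFDerivAt_mul_right x 0
  simp only [L.mul_zero] at h
  simpa using DFunLike.congr_fun (h.unique (hasFDerivAt_id x)) v

theorem dmul_zero_left (x v : Fin N → ℝ) : L.dmul (0, x) (0, v) = v := by
  have h := L.hasFDerivAt_mul_left 0 x
  have e : L.mul 0 = id := funext L.zero_mul
  rw [e] at h
  simpa using DFunLike.congr_fun (h.unique (hasFDerivAt_id x)) v

theorem dmul_zero_zero (v w : Fin N → ℝ) : L.dmul (0, 0) (v, w) = v + w := by
  have : (v, w) = (v, (0 : Fin N → ℝ)) + ((0 : Fin N → ℝ), w) := by simp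
  rw [this, map_add, dmul_zero_right, dmul_zero_left]

/-- The adjoint action on the tangent space at the origin. -/
noncomputable def Ad (g : Fin N → ℝ) : (Fin N → ℝ) →L[ℝ] (Fin N → ℝ) :=
  fderiv ℝ (fun z => L.mul (L.mul g z) (L.inv g)) 0

theorem contDiff_conj (g : Fin N → ℝ) :
    ContDiff ℝ ∞ fun z => L.mul (L.mul g z) (L.inv g) :=
  L.contDiff_mul_comp (L.contDiff_mul_left g) contDiff_const

theorem hasStrictFDerivAt_conj (g : Fin N → ℝ) :
    HasStrictFDerivAt (fun z => L.mul (L.mul g z) (L.inv g)) (L.Ad g) 0 :=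
  (L.contDiff_conj g).contDiffAt.hasStrictFDerivAt (by simp)

theorem Ad_mul (g h v : Fin N → ℝ) : L.Ad (L.mul g h) v = L.Ad g (L.Ad h v) := by
  have h0 : L.mul (L.mul h 0) (L.inv h) = 0 := by rw [L.mul_zero, L.mul_inv]
  have h1 := (L.hasStrictFDerivAt_conj g).hasFDerivAt
  rw [← h0] at h1
  have h2 := h1.comp (0 : Fin N → ℝ) (L.hasStrictFDerivAt_conj h).hasFDerivAt
  have e : (fun z => L.mul (L.mul (L.mul g h) z) (L.inv (L.mul g h))) =
      (fun z => L.mul (L.mul g z) (L.inv g)) ∘ fun z => L.mul (L.mul h z) (L.inv h) := by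
    ext1 z
    simp only [Function.comp, L.inv_mul_rev, L.mul_assoc]
  rw [← e] at h2
  exact DFunLike.congr_fun ((L.hasStrictFDerivAt_conj (L.mul g h)).hasFDerivAt.unique h2) v

theorem Ad_zero (v : Fin N → ℝ) : L.Ad 0 v = v := by
  have e : (fun z => L.mul (L.mul 0 z) (L.inv 0)) = id := by
    ext1 z; simp [L.zero_mul, L.inv_zero, L.mul_zero]
  simp [Ad, e]

/-- A left-invariant field is determined by its value at the origin. -/
theorem leftInvariant_apply_eq {W : (Fin N → ℝ) → Fin N → ℝ} (hW : W ∈ L.leftInvariant)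
    (g : Fin N → ℝ) : W g = L.dmul (g, 0) (0, W 0) := by
  have := hW.2 g 0
  rw [(L.hasFDerivAt_mul_left g 0).fderiv, L.mul_zero] at this
  simpa using this.symm

/-- Conjugation by `g` is left translation, which carries `W 0` to `W g`, followed by right
translation by the inverse. -/
theorem Ad_apply_eq {W : (Fin N → ℝ) → Fin N → ℝ} (hW : W ∈ L.leftInvariant)
    (g : Fin N → ℝ) : L.Ad g (W 0) = L.dmul (g, L.inv g) (W g, 0) := by
  have h1 := L.hasFDerivAt_mul_right g (L.inv g)
  have h2 := L.hasFDerivAt_mul_left g 0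
  have h1' : HasFDerivAt (fun z => L.mul z (L.inv g))
      ((L.dmul (g, L.inv g)).comp (ContinuousLinearMap.inl ℝ _ _)) (L.mul g 0) := by
    rwa [L.mul_zero]
  have h3 := h1'.comp (0 : Fin N → ℝ) h2
  have := DFunLike.congr_fun ((L.hasStrictFDerivAt_conj g).hasFDerivAt.unique h3) (W 0)
  rw [this, L.leftInvariant_apply_eq hW g]
  simp

/-- Every tangent vector at the origin extends to a left-invariant field. -/
theorem exists_leftInvariant (v : Fin N → ℝ) : ∃ W ∈ L.leftInvariant, W 0 = v := by
  refine ⟨fun x => L.dmul (x, 0) (0, v), ⟨?_, fun x y => ?_⟩, L.dmul_zero_left 0 v⟩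
  · have h : ContDiff ℝ ∞ L.dmul := L.contDiff_mul.fderiv_right (by simp)
    exact (h.comp (contDiff_id.prodMk contDiff_const)).clm_apply contDiff_const
  · have h1 : HasFDerivAt (L.mul x) ((L.dmul (x, y)).comp (ContinuousLinearMap.inr ℝ _ _))
        (L.mul y 0) := by rw [L.mul_zero]; exact L.hasFDerivAt_mul_left x y
    have h2 := h1.comp (0 : Fin N → ℝ) (L.hasFDerivAt_mul_left y 0)
    have e : L.mul x ∘ L.mul y = L.mul (L.mul x y) := by
      ext1 z; simp [L.mul_assoc]
    rw [e] at h2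
    have := DFunLike.congr_fun (h2.unique (L.hasFDerivAt_mul_left (L.mul x y) 0)) v
    rw [(L.hasFDerivAt_mul_left x y).fderiv]
    simpa using this

theorem hasFDerivAt_inv_zero :
    HasFDerivAt L.inv (-ContinuousLinearMap.id ℝ (Fin N → ℝ)) 0 := by
  have h1 : HasFDerivAt L.inv (fderiv ℝ L.inv 0) 0 :=
    ((L.contDiff_inv.differentiable (by simp)) 0).hasFDerivAt
  have h2 : HasFDerivAt (fun p : (Fin N → ℝ) × (Fin N → ℝ) => L.mul p.1 p.2)
      (L.dmul (0, 0)) ((0 : Fin N → ℝ), L.inv 0) := by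
    rw [L.inv_zero]; exact L.hasFDerivAt_mul (0, 0)
  have h3 := h2.comp (0 : Fin N → ℝ) ((hasFDerivAt_id (0 : Fin N → ℝ)).prodMk h1)
  have e : (fun p : (Fin N → ℝ) × (Fin N → ℝ) => L.mul p.1 p.2) ∘ (fun x => (id x, L.inv x)) =
      fun _ => 0 := by
    ext1 x; simp [L.mul_inv]
  rw [e] at h3
  have h4 := h3.unique (hasFDerivAt_const 0 0)
  convert h1 using 1
  ext1 v
  have := DFunLike.congr_fun h4 v
  simp only [ContinuousLinearMap.comp_apply, ContinuousLinearMap.prod_apply,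
    dmul_zero_zero] at this
  simp only [neg_apply, ContinuousLinearMap.id_apply]
  exact neg_eq_of_add_eq_zero_right (by simpa using this)

/-- The infinitesimal adjoint action is the Lie bracket. -/
theorem hasDerivAt_Ad {V W : (Fin N → ℝ) → Fin N → ℝ} (hV : V ∈ L.leftInvariant)
    (hW : W ∈ L.leftInvariant) {γ : ℝ → Fin N → ℝ} (h0 : γ 0 = 0)
    (hγ : HasDerivAt γ (V 0) 0) :
    HasDerivAt (fun t => L.Ad (γ t) (W 0)) (VectorField.lieBracket ℝ V W 0) 0 := by
  have hd : ContDiff ℝ ∞ L.dmul := L.contDiff_mul.fderiv_right (by simp)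
  set B := fderiv ℝ L.dmul (0, 0) with hB
  have hB' : HasFDerivAt L.dmul B ((0 : Fin N → ℝ), (0 : Fin N → ℝ)) :=
    ((hd.differentiable (by simp)) _).hasFDerivAt
  have hsymm : ∀ p q, B p q = B q p :=
    (L.contDiff_mul.contDiffAt (x := ((0 : Fin N → ℝ), (0 : Fin N → ℝ)))).isSymmSndFDerivAt
      (n := ∞) (by
        rw [minSmoothness_of_isRCLikeNormedField]
        exact WithTop.coe_le_coe.2 (le_top : (2 : ℕ∞) ≤ ⊤))
  have hB0 : HasFDerivAt (fun x => L.dmul (x, 0)) (B.comp (ContinuousLinearMap.inl ℝ _ _)) 0 :=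
    HasFDerivAt.comp (f := fun x : Fin N → ℝ => (x, (0 : Fin N → ℝ))) 0 hB'
      (hasFDerivAt_prodMk_left 0 0)
  -- `mul x 0 = x` has vanishing second derivative in `x`
  have hB1 : ∀ u w : Fin N → ℝ, B (u, 0) (w, 0) = 0 := fun u w => by
    have h1 := hB0.clm_apply (hasFDerivAt_const (w, (0 : Fin N → ℝ)) (0 : Fin N → ℝ))
    simp only [dmul_zero_right] at h1
    simpa using DFunLike.congr_fun (h1.unique (hasFDerivAt_const w (0 : Fin N → ℝ))) u
  have hB2 : ∀ w : Fin N → ℝ, B (w, 0) (0, V 0) = fderiv ℝ V 0 w := fun w => by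
    have h1 := hB0.clm_apply (hasFDerivAt_const ((0 : Fin N → ℝ), V 0) (0 : Fin N → ℝ))
    have e : (fun y => L.dmul (y, 0) (0, V 0)) = V :=
      funext fun y => (L.leftInvariant_apply_eq hV y).symm
    rw [e] at h1
    rw [h1.fderiv]
    simp
  have hWd : HasFDerivAt W (fderiv ℝ W 0) (γ 0) := by
    rw [h0]; exact ((hW.1.differentiable (by simp)) 0).hasFDerivAt
  have hi : HasFDerivAt L.inv (-ContinuousLinearMap.id ℝ (Fin N → ℝ)) (γ 0) := by
    rw [h0]; exact L.hasFDerivAt_inv_zero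
  have hg2 : HasDerivAt (fun t => (γ t, L.inv (γ t))) (V 0, -V 0) 0 := by
    have hi' : HasDerivAt (fun t => L.inv (γ t)) (-V 0) 0 := by
      simpa using! hi.comp_hasDerivAt 0 hγ
    exact hγ.prodMk hi'
  have hB3 : HasFDerivAt L.dmul B ((fun t => (γ t, L.inv (γ t))) 0) := by
    simpa [h0, L.inv_zero] using hB'
  have h4 : HasDerivAt (fun t => L.dmul (γ t, L.inv (γ t))) (B (V 0, -V 0)) 0 :=
    hB3.comp_hasDerivAt 0 hg2
  have h5 : HasDerivAt (fun t => (W (γ t), (0 : Fin N → ℝ))) (fderiv ℝ W 0 (V 0), 0) 0 :=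
    (hWd.comp_hasDerivAt 0 hγ).prodMk (hasDerivAt_const (0 : ℝ) (0 : Fin N → ℝ))
  have h6 := h4.clm_apply h5
  have e : (fun t => L.Ad (γ t) (W 0)) = fun t => L.dmul (γ t, L.inv (γ t)) (W (γ t), 0) :=
    funext fun t => L.Ad_apply_eq hW (γ t)
  rw [e]
  refine h6.congr_deriv ?_
  have e2 : ((V 0, -V 0) : (Fin N → ℝ) × (Fin N → ℝ)) = (V 0, 0) - (0, V 0) := by simp
  rw [h0, L.inv_zero, L.dmul_zero_zero, add_zero, e2, map_sub, sub_apply, hB1,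
    hsymm, hB2, VectorField.lieBracket]
  abel

end LieGroupLaw

namespace CarnotGroup

variable {N m : ℕ} (G : CarnotGroup N m)

/-! ### Reachability -/

theorem exists_integralCurve {V : (Fin N → ℝ) → Fin N → ℝ} (hV : ContDiff ℝ 1 V)
    (x : Fin N → ℝ) :
    ∃ γ : ℝ → Fin N → ℝ, γ 0 = x ∧ IsIntegralCurveAt γ (fun _ => V) 0 := by
  obtain ⟨γ, h0, ε, hε, h⟩ := hV.contDiffAt (x := x)
    |>.exists_forall_mem_closedBall_exists_eq_forall_mem_Ioo_hasDerivAt₀ 0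
  refine ⟨γ, h0, ?_⟩
  filter_upwards [Ioo_mem_nhds (show (0 : ℝ) - ε < 0 by linarith) (show 0 < 0 + ε by linarith)]
    with t ht using h t ht

/-- Points on integral curves of horizontal left-invariant fields are near their origin in the
control distance, uniformly for small times. -/
theorem eventually_ccDist_integralCurve_le {V : (Fin N → ℝ) → Fin N → ℝ}
    (hV : V ∈ Submodule.span ℝ (range G.Y)) {γ : ℝ → Fin N → ℝ}
    (hγ : IsIntegralCurveAt γ (fun _ => V) 0) : ∀ᶠ t in 𝓝 0, G.ccDist (γ 0) (γ t) ≤ 1 := by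
  obtain ⟨c, rfl⟩ := (Submodule.mem_span_range_iff_exists_fun ℝ).1 hV
  obtain ⟨ε, hε, h⟩ := Metric.eventually_nhds_iff_ball.1 hγ
  have hsmall : ∀ᶠ t : ℝ in 𝓝 0, ∀ i, |t * c i| < 1 / 2 := by
    refine eventually_all.2 fun i => ?_
    have : Tendsto (fun t : ℝ => |t * c i|) (𝓝 0) (𝓝 0) := by
      have : Continuous fun t : ℝ => |t * c i| := by fun_prop
      simpa using this.tendsto 0
    exact this.eventually (gt_mem_nhds (by norm_num))
  filter_upwards [Metric.ball_mem_nhds (0 : ℝ) hε, hsmall] with t ht hc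
  have hball : ∀ s ∈ Icc (0 : ℝ) 1, t * s ∈ Metric.ball (0 : ℝ) ε := fun s hs => by
    rw [mem_ball_zero_iff, Real.norm_eq_abs, abs_mul, abs_of_nonneg hs.1]
    rw [mem_ball_zero_iff, Real.norm_eq_abs] at ht
    nlinarith [abs_nonneg t, hs.1, hs.2]
  have hder : ∀ s ∈ Icc (0 : ℝ) 1, HasDerivAt (fun s => γ (t * s))
      (∑ i, (t * c i) • G.Y i (γ (t * s))) s := fun s hs => by
    have hl : HasDerivAt (fun s => t * s) t s := by
      simpa using (hasDerivAt_id s).const_mul t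
    have := (h _ (hball s hs)).scomp s hl
    refine this.congr_deriv ?_
    simp [Finset.smul_sum, smul_smul]
  rw [show (1 : ℝ≥0∞) = ((1 : ℝ≥0) : ℝ≥0∞) by simp]
  refine G.ccDist_le one_pos ⟨fun s => γ (t * s), (G.mem_admissibleCurves_iff one_pos).2
    ⟨?_, by simp, by simp, 1 / 2, by exact_mod_cast (one_half_lt_one : (1 / 2 : ℝ) < 1),
      fun i _ => t * c i, fun i => measurable_const, fun i s => ?_, ?_⟩⟩
  · have hcont : ContinuousOn (fun s => γ (t * s)) (Icc 0 1) := fun s hs =>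
      (hder s hs).continuousAt.continuousWithinAt
    have hYc : ContinuousOn (fun s => ∑ i, (t * c i) • G.Y i (γ (t * s))) (Icc 0 1) :=
      continuousOn_finsetSum _ fun i _ =>
        ((G.contDiff_Y i).continuous.comp_continuousOn hcont).const_smul (t * c i)
    obtain ⟨C, hC⟩ := isCompact_Icc.exists_bound_of_continuousOn hYc
    rw [← uIcc_of_le (zero_le_one' ℝ)] at hder hC
    refine LipschitzOnWith.absolutelyContinuousOnInterval (K := C.toNNReal) ?_
    refine (convex_uIcc (0 : ℝ) 1).lipschitzOnWith_of_nnnorm_hasDerivWithin_le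
      (fun s hs => (hder s hs).hasDerivWithinAt) fun s hs => ?_
    rw [← NNReal.coe_le_coe, coe_nnnorm]
    exact (hC s hs).trans (Real.le_coe_toNNReal C)
  · simpa using (hc i).le
  · exact Eventually.of_forall fun s hs => hder s ⟨hs.1.le, hs.2.le⟩

theorem ccDist_zero_mul_lt_top {x y : Fin N → ℝ} (hx : G.ccDist 0 x < ⊤)
    (hy : G.ccDist 0 y < ⊤) : G.ccDist 0 (G.mul x y) < ⊤ := by
  refine (G.ccDist_le_two_mul_max 0 x _).trans_lt (ENNReal.mul_lt_top (by simp) (max_lt hx ?_))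
  have := G.ccDist_mul_left x 0 y
  rw [G.mul_zero] at this
  rwa [this]

/-- The span of the conjugates of the horizontal directions by the points at finite control
distance from the origin. -/
def reachSpan : Submodule ℝ (Fin N → ℝ) :=
  Submodule.span ℝ {v | ∃ g i, G.ccDist 0 g < ⊤ ∧ v = G.Ad g (G.Y i 0)}

theorem Ad_mem_reachSpan {g v : Fin N → ℝ} (hg : G.ccDist 0 g < ⊤) (hv : v ∈ G.reachSpan) :
    G.Ad g v ∈ G.reachSpan := by
  induction hv using Submodule.span_induction with
  | mem v hv =>
    obtain ⟨h, i, hh, rfl⟩ := hv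
    refine Submodule.subset_span ⟨G.mul g h, i, G.ccDist_zero_mul_lt_top hg hh, ?_⟩
    rw [G.Ad_mul]
  | zero => simp
  | add v w _ _ hv hw => rw [map_add]; exact add_mem hv hw
  | smul c v _ hv => rw [map_smul]; exact Submodule.smul_mem _ c hv

theorem ccDist_self (x : Fin N → ℝ) : G.ccDist x x = 0 := by
  refine le_antisymm (ENNReal.le_of_forall_pos_le_add fun ε hε _ => ?_) zero_le
  rw [zero_add]
  refine G.ccDist_le hε ⟨fun _ => x, (G.mem_admissibleCurves_iff hε).2 ⟨?_, rfl, rfl, 0, hε,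
    fun _ _ => 0, fun _ => measurable_const, by simp, Eventually.of_forall fun t _ => ?_⟩⟩
  · exact (LipschitzWith.const x).lipschitzOnWith.absolutelyContinuousOnInterval
  · simpa using hasDerivAt_const t x

theorem layer_zero_le_leftInvariant :
    Submodule.span ℝ (range G.Y) ≤ G.leftInvariant :=
  Submodule.span_le.2 (by rintro _ ⟨i, rfl⟩; exact G.Y_mem i)

/-- Bracketing with a horizontal field preserves `reachSpan`: differentiate the adjoint action
along an integral curve. -/
theorem lieBracket_mem_reachSpan {V W : (Fin N → ℝ) → Fin N → ℝ}
    (hV : V ∈ Submodule.span ℝ (range G.Y)) (hW : W ∈ G.leftInvariant)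
    (hW0 : W 0 ∈ G.reachSpan) : VectorField.lieBracket ℝ V W 0 ∈ G.reachSpan := by
  have hVl := G.layer_zero_le_leftInvariant hV
  obtain ⟨γ, h0, hγ⟩ := exists_integralCurve (hVl.1.of_le (by exact_mod_cast le_top)) 0
  have hd : HasDerivAt γ (V 0) 0 := by simpa [h0] using hγ.self_of_nhds
  have h := G.hasDerivAt_Ad hVl hW h0 hd
  have hev : ∀ᶠ t in 𝓝 (0 : ℝ), G.Ad (γ t) (W 0) ∈ G.reachSpan := by
    filter_upwards [G.eventually_ccDist_integralCurve_le hV hγ] with t ht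
    rw [h0] at ht
    exact G.Ad_mem_reachSpan (ht.trans_lt (by simp)) hW0
  have hcl : IsClosed (G.reachSpan : Set (Fin N → ℝ)) := Submodule.closed_of_finiteDimensional _
  refine hcl.mem_of_tendsto h.tendsto_slope ?_
  filter_upwards [hev.filter_mono nhdsWithin_le_nhds] with t ht
  rw [slope_def_module]
  refine Submodule.smul_mem _ _ (sub_mem ht ?_)
  rw [h0, G.Ad_zero]
  exact hW0

/-- The stratification is used here: the layers are generated by brackets with horizontal fields
and exhaust the left-invariant fields, whose values at the origin are arbitrary. -/
theorem reachSpan_eq_top : G.reachSpan = ⊤ := by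
  obtain ⟨s, -, hs, -⟩ := G.stratified
  have hlay : ∀ k < s, ∀ W ∈ layer G.Y k, W 0 ∈ G.reachSpan := by
    intro k
    induction k with
    | zero =>
      intro _ W hW
      have : layer G.Y 0 ≤ G.reachSpan.comap (LinearMap.proj 0) := by
        refine Submodule.span_le.2 ?_
        rintro _ ⟨i, rfl⟩
        exact Submodule.subset_span ⟨0, i, by simp [ccDist_self], (G.Ad_zero _).symm⟩
      exact this hW
    | succ k ih =>
      intro hk W hW
      have : layer G.Y (k + 1) ≤ G.reachSpan.comap (LinearMap.proj 0) := by
        refine Submodule.span_le.2 ?_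
        rintro _ ⟨V, hV, W, hW, rfl⟩
        have hWl : W ∈ G.leftInvariant := by
          rw [← hs]
          exact (le_iSup (fun k : Fin s => layer G.Y k) ⟨k, by lia⟩) hW
        exact G.lieBracket_mem_reachSpan hV hWl (ih (by lia) W hW)
      exact this hW
  refine eq_top_iff.2 fun v _ => ?_
  obtain ⟨W, hW, rfl⟩ := G.exists_leftInvariant v
  rw [← hs] at hW
  have : (⨆ k : Fin s, layer G.Y k) ≤ G.reachSpan.comap (LinearMap.proj 0) :=
    iSup_le fun k W hW => hlay k k.2 W hW
  exact this hW

/-- Products of conjugated horizontal flows: for every finite set of generators of `reachSpan`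
there is a map into the reachable set whose derivative at the origin has their span as range. -/
theorem exists_reachable_submersion (T : Finset (Fin N → ℝ))
    (hT : ∀ v ∈ T, ∃ g i, G.ccDist 0 g < ⊤ ∧ v = G.Ad g (G.Y i 0)) :
    ∃ (X : Type) (_ : NormedAddCommGroup X) (_ : NormedSpace ℝ X) (_ : CompleteSpace X)
      (Φ : X → Fin N → ℝ) (Φ' : X →L[ℝ] Fin N → ℝ) (C : ℝ≥0∞), Φ 0 = 0 ∧
      HasStrictFDerivAt Φ Φ' 0 ∧ Submodule.span ℝ (T : Set (Fin N → ℝ)) ≤ Φ'.range ∧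
      C < ⊤ ∧ ∀ᶠ x in 𝓝 0, G.ccDist 0 (Φ x) ≤ C := by
  classical
  induction T using Finset.induction_on with
  | empty =>
    exact ⟨ℝ, inferInstance, inferInstance, inferInstance, fun _ => 0, 0, 0, rfl,
      hasStrictFDerivAt_const _ _, by simp, by simp, by simp [ccDist_self]⟩
  | insert v T _ ih =>
    obtain ⟨X, _, _, _, Φ, Φ', C, h0, hd, hr, hC, hev⟩ := ih fun w hw =>
      hT w (Finset.mem_insert_of_mem hw)
    obtain ⟨g, i, hg, rfl⟩ := hT v (Finset.mem_insert_self _ _)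
    obtain ⟨γ, hγ0, hγ⟩ := exists_integralCurve
      ((G.contDiff_Y i).of_le (by exact_mod_cast le_top)) (0 : Fin N → ℝ)
    have hγd : HasStrictDerivAt γ (G.Y i (γ 0)) 0 :=
      hasStrictDerivAt_of_hasDerivAt_of_continuousAt hγ
        ((G.contDiff_Y i).continuous.continuousAt.comp hγ.self_of_nhds.continuousAt)
    have hc1 : HasStrictFDerivAt (fun z => G.mul (G.mul g z) (G.inv g)) (G.Ad g) (γ 0) := by
      rw [hγ0]; exact G.hasStrictFDerivAt_conj g
    have hc : HasStrictFDerivAt (fun t => G.mul (G.mul g (γ t)) (G.inv g))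
        ((G.Ad g).comp (ContinuousLinearMap.toSpanSingleton ℝ (G.Y i (γ 0)))) 0 :=
      hc1.comp (0 : ℝ) hγd.hasStrictFDerivAt
    have hcz : G.mul (G.mul g (γ 0)) (G.inv g) = 0 := by rw [hγ0, G.mul_zero, G.mul_inv]
    have hΦ1 : HasStrictFDerivAt (fun p : X × ℝ => Φ p.1)
        (Φ'.comp (ContinuousLinearMap.fst ℝ X ℝ)) (0, 0) :=
      HasStrictFDerivAt.comp (f := Prod.fst) ((0 : X), (0 : ℝ)) hd hasStrictFDerivAt_fst
    have hc2 : HasStrictFDerivAt (fun p : X × ℝ => G.mul (G.mul g (γ p.2)) (G.inv g))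
        (((G.Ad g).comp (ContinuousLinearMap.toSpanSingleton ℝ (G.Y i (γ 0)))).comp
          (ContinuousLinearMap.snd ℝ X ℝ)) (0, 0) :=
      HasStrictFDerivAt.comp (f := Prod.snd) ((0 : X), (0 : ℝ)) hc hasStrictFDerivAt_snd
    have hΨ := G.hasStrictFDerivAt_mul_comp hΦ1 hc2
    simp only [h0, hcz] at hΨ
    -- the new factor is the flow of `Y_i` conjugated by `g`; the bound is that for the product of
    -- `Φ x`, `g`, `γ t` and `g⁻¹`
    refine ⟨X × ℝ, inferInstance, inferInstance, inferInstance, _, _,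
      2 * max C (2 * max (2 * max (G.ccDist 0 g) 1) (G.ccDist 0 g)), ?_, hΨ, ?_, ?_, ?_⟩
    · simp [h0, hcz, G.mul_zero]
    · rw [Finset.coe_insert, Submodule.span_insert, sup_le_iff]
      constructor
      · rw [Submodule.span_singleton_le_iff_mem]
        refine ⟨(0, 1), ?_⟩
        simp [G.dmul_zero_left, hγ0]
      · refine hr.trans ?_
        rintro _ ⟨x, rfl⟩
        refine ⟨(x, 0), ?_⟩
        simp [G.dmul_zero_right]
    · have h2 : (2 : ℝ≥0∞) < ⊤ := by simp
      exact ENNReal.mul_lt_top h2 (max_lt hC (ENNReal.mul_lt_top h2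
        (max_lt (ENNReal.mul_lt_top h2 (max_lt hg (by simp))) hg)))
    · have h1 : ∀ᶠ p : X × ℝ in 𝓝 (0, 0), G.ccDist 0 (Φ p.1) ≤ C :=
        (continuous_fst.tendsto ((0 : X), (0 : ℝ))).eventually hev
      have h2 : ∀ᶠ p : X × ℝ in 𝓝 (0, 0), G.ccDist 0 (γ p.2) ≤ 1 := by
        have := G.eventually_ccDist_integralCurve_le (V := G.Y i)
          (Submodule.subset_span ⟨i, rfl⟩) hγ
        rw [hγ0] at this
        exact (continuous_snd.tendsto ((0 : X), (0 : ℝ))).eventually this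
      have hmul : ∀ {x y : Fin N → ℝ} {a b : ℝ≥0∞}, G.ccDist 0 x ≤ a → G.ccDist 0 y ≤ b →
          G.ccDist 0 (G.mul x y) ≤ 2 * max a b := by
        intro x y a b ha hb
        refine (G.ccDist_le_two_mul_max 0 x _).trans ?_
        have := G.ccDist_mul_left x 0 y
        rw [G.mul_zero] at this
        rw [this]
        gcongr
      filter_upwards [h1, h2] with p hp1 hp2
      exact hmul hp1 (hmul (hmul le_rfl hp2) (G.ccDist_zero_inv g).le)

/-- The control distance from the origin is bounded near the origin. -/
theorem exists_eventually_ccDist_le : ∃ C : ℝ≥0, ∀ᶠ z in 𝓝 0, G.ccDist 0 z ≤ C := by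
  have hfg : (Submodule.span ℝ {v | ∃ g i, G.ccDist 0 g < ⊤ ∧ v = G.Ad g (G.Y i 0)}).FG :=
    Submodule.FG.of_finite
  obtain ⟨T, hT, hspan⟩ := (Submodule.fg_span_iff_fg_span_finset_subset _).1 hfg
  obtain ⟨X, _, _, _, Φ, Φ', C, h0, hd, hr, hC, hev⟩ := G.exists_reachable_submersion T
    fun v hv => hT hv
  have hr' : Φ'.range = ⊤ := by
    rw [eq_top_iff, ← G.reachSpan_eq_top]
    exact hspan.le.trans hr
  have := hd.map_nhds_eq_of_surj hr'
  rw [h0] at this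
  refine ⟨C.toNNReal, ?_⟩
  rw [ENNReal.coe_toNNReal hC.ne, ← this]
  exact hev

theorem continuous_dil_uncurry : Continuous fun p : ℝ × (Fin N → ℝ) => G.dil p.1 p.2 :=
  continuous_pi fun i => by simp only [dil_apply]; fun_prop

theorem dil_zero_left (x : Fin N → ℝ) : G.dil 0 x = 0 := by
  ext i
  have := G.one_le_σ i
  simp [dil_apply, zero_pow (by lia : G.σ i ≠ 0)]

/-- Compact sets are at bounded control distance from the origin, since dilations contract them
into any neighbourhood of it. -/
theorem exists_ccDist_le_of_isCompact {S : Set (Fin N → ℝ)} (hS : IsCompact S) :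
    ∃ C : ℝ≥0, ∀ z ∈ S, G.ccDist 0 z ≤ C := by
  obtain ⟨C, hC⟩ := G.exists_eventually_ccDist_le
  have h1 : ∀ᶠ r : ℝ in 𝓝 0, ∀ z ∈ S, G.ccDist 0 (G.dil r z) ≤ C := by
    refine hS.eventually_forall_of_forall_eventually fun z _ => ?_
    have := (G.continuous_dil_uncurry.tendsto (0, z))
    rw [G.dil_zero_left] at this
    exact this.eventually hC
  obtain ⟨ε, hε, h⟩ := Metric.eventually_nhds_iff_ball.1 h1
  set r : ℝ≥0 := ⟨ε / 2, by positivity⟩ with hr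
  have hr0 : 0 < r := by rw [← NNReal.coe_pos]; exact half_pos hε
  have hrb : (r : ℝ) ∈ Metric.ball (0 : ℝ) ε := by
    rw [mem_ball_zero_iff, Real.norm_eq_abs, NNReal.abs_eq]
    exact half_lt_self hε
  refine ⟨r⁻¹ * C, fun z hz => ?_⟩
  have h2 := G.ccDist_dil_le (inv_pos.2 hr0) 0 (G.dil r z)
  rw [NNReal.coe_inv, G.dil_inv_dil (by exact_mod_cast hr0), dil_zero_right] at h2
  rw [ENNReal.coe_mul]
  exact h2.trans (by gcongr; exact h r hrb z hz)

theorem ccDist_lt_top (x y : Fin N → ℝ) : G.ccDist x y < ⊤ := by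
  rw [G.ccDist_eq_zero_left]
  obtain ⟨C, hC⟩ := G.exists_ccDist_le_of_isCompact (isCompact_singleton (x := G.mul (G.inv x) y))
  exact (hC _ rfl).trans_lt (by simp)

/-- By homogeneity, boundedness near the origin improves to continuity at the origin. -/
theorem tendsto_ccDist_zero : Tendsto (fun z => G.ccDist 0 z) (𝓝 0) (𝓝 0) := by
  obtain ⟨C, hC⟩ := G.exists_eventually_ccDist_le
  rw [ENNReal.tendsto_nhds_zero]
  intro ε hε
  obtain ⟨r, hr0, hr⟩ : ∃ r : ℝ≥0, 0 < r ∧ (r : ℝ≥0∞) * C ≤ ε := by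
    have : Tendsto (fun r : ℝ≥0 => (r : ℝ≥0∞) * C) (𝓝 0) (𝓝 0) := by
      have h : Continuous fun r : ℝ≥0 => (r : ℝ≥0∞) * C := by
        simp_rw [← ENNReal.coe_mul]; fun_prop
      simpa using h.tendsto 0
    have h1 := (this.eventually (ge_mem_nhds hε)).filter_mono
      (nhdsWithin_le_nhds (s := Ioi 0))
    obtain ⟨r, hr, hr0⟩ := (h1.and self_mem_nhdsWithin).exists
    exact ⟨r, hr0, hr⟩
  have hcont : Tendsto (G.dil (r : ℝ)⁻¹) (𝓝 0) (𝓝 0) := by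
    simpa using (G.contDiff_dil (r : ℝ)⁻¹).continuous.tendsto 0
  filter_upwards [hcont.eventually hC] with z hz
  have h2 := G.ccDist_dil_le hr0 0 (G.dil (r : ℝ)⁻¹ z)
  rw [G.dil_dil_inv (by exact_mod_cast hr0), dil_zero_right] at h2
  exact h2.trans (le_trans (by gcongr) hr)

/-! ### Invariance of Lebesgue measure -/

/-- A smooth bijection of `ℝ^N` with Jacobian `±1` preserves Lebesgue measure. -/
theorem measurePreserving_of_abs_det_eq_one {f : (Fin N → ℝ) → Fin N → ℝ}
    (hf : ContDiff ℝ 1 f) (hbij : Function.Bijective f)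
    (hdet : ∀ x, |(fderiv ℝ f x).det| = 1) : MeasurePreserving f := by
  refine ⟨hf.continuous.measurable, Measure.ext fun s hs => ?_⟩
  have hms : MeasurableSet (f ⁻¹' s) := hf.continuous.measurable hs
  rw [Measure.map_apply hf.continuous.measurable hs]
  have := lintegral_abs_det_fderiv_eq_addHaar_image volume hms
    (fun x _ => ((hf.differentiable (by simp)) x).hasFDerivAt.hasFDerivWithinAt)
    hbij.injective.injOn
  rw [image_preimage_eq s hbij.surjective] at this
  rw [← this]
  simp [hdet]

theorem det_dilL_ne_zero {r : ℝ} (hr : 0 < r) : (G.dilL r).det ≠ 0 := by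
  have h : (G.dilL r⁻¹).comp (G.dilL r) = ContinuousLinearMap.id ℝ _ := by
    ext1 x; simp [G.dil_inv_dil hr]
  have h2 := congrArg ContinuousLinearMap.det h
  intro h0
  simp only [ContinuousLinearMap.det, ContinuousLinearMap.toLinearMap_comp,
    LinearMap.det_comp] at h2 h0
  rw [h0, mul_zero] at h2
  simp at h2

/-- The Jacobian of a family of maps compatible with the dilations is constant: it is invariant
under dilating the parameter and the point, and dilations contract both to the origin. -/
theorem det_fderiv_eq_of_dil {Φ : (Fin N → ℝ) → (Fin N → ℝ) → Fin N → ℝ}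
    (hΦ : ContDiff ℝ ∞ fun p : (Fin N → ℝ) × (Fin N → ℝ) => Φ p.1 p.2)
    (hdil : ∀ r : ℝ, 0 < r → ∀ p x, Φ (G.dil r p) (G.dil r x) = G.dil r (Φ p x))
    (p x : Fin N → ℝ) : (fderiv ℝ (Φ p) x).det = (fderiv ℝ (Φ 0) 0).det := by
  have hJ : ∀ p x, HasFDerivAt (Φ p) ((fderiv ℝ (fun q : (Fin N → ℝ) × (Fin N → ℝ) =>
      Φ q.1 q.2) (p, x)).comp (ContinuousLinearMap.inr ℝ _ _)) x := fun p x =>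
    HasFDerivAt.comp (g := fun q : (Fin N → ℝ) × (Fin N → ℝ) => Φ q.1 q.2)
      (f := fun x => (p, x)) x ((hΦ.differentiable (by simp)) _).hasFDerivAt
      (hasFDerivAt_prodMk_right p x)
  have hcont : Continuous fun q : (Fin N → ℝ) × (Fin N → ℝ) => (fderiv ℝ (Φ q.1) q.2).det := by
    have e : (fun q : (Fin N → ℝ) × (Fin N → ℝ) => (fderiv ℝ (Φ q.1) q.2).det) =
        fun q => ((fderiv ℝ (fun q : (Fin N → ℝ) × (Fin N → ℝ) => Φ q.1 q.2) q).comp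
          (ContinuousLinearMap.inr ℝ _ _)).det := by
      ext1 q; rw [(hJ q.1 q.2).fderiv]
    rw [e]
    exact ContinuousLinearMap.continuous_det.comp
      ((hΦ.continuous_fderiv (by simp)).clm_comp continuous_const)
  have hconst : ∀ r : ℝ, 0 < r →
      (fderiv ℝ (Φ (G.dil r p)) (G.dil r x)).det = (fderiv ℝ (Φ p) x).det := fun r hr => by
    have h1 := (hJ (G.dil r p) (G.dil r x)).differentiableAt.hasFDerivAt.comp x
      (G.hasFDerivAt_dil r x)
    have h2 := (G.hasFDerivAt_dil r (Φ p x)).comp x (hJ p x).differentiableAt.hasFDerivAt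
    have e : Φ (G.dil r p) ∘ G.dil r = G.dil r ∘ Φ p := by
      ext1 y; exact hdil r hr p y
    rw [e] at h1
    have h3 := congrArg ContinuousLinearMap.det (h1.unique h2)
    have h4 := G.det_dilL_ne_zero hr
    simp only [ContinuousLinearMap.det, ContinuousLinearMap.toLinearMap_comp,
      LinearMap.det_comp] at h3 h4 ⊢
    rw [mul_comm] at h3
    exact mul_left_cancel₀ h4 h3
  have hlim : Tendsto (fun r : ℝ => (fderiv ℝ (Φ (G.dil r p)) (G.dil r x)).det) (𝓝[>] 0)
      (𝓝 (fderiv ℝ (Φ 0) 0).det) := by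
    have h : Continuous fun r : ℝ => (fderiv ℝ (Φ (G.dil r p)) (G.dil r x)).det :=
      hcont.comp ((G.continuous_dil_uncurry.comp (continuous_id.prodMk continuous_const)).prodMk
        (G.continuous_dil_uncurry.comp (continuous_id.prodMk continuous_const)))
    have := h.tendsto 0
    simp only [dil_zero_left] at this
    exact this.mono_left nhdsWithin_le_nhds
  refine tendsto_nhds_unique (tendsto_const_nhds.congr' ?_) hlim
  filter_upwards [self_mem_nhdsWithin] with r hr using (hconst r hr).symm

/-- The Jacobian of a left translation is constant in the point and in the translating element, and
the translation by the origin is the identity. -/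
theorem measurePreserving_mul_left (g : Fin N → ℝ) :
    MeasurePreserving (G.mul g) := by
  refine measurePreserving_of_abs_det_eq_one
    ((G.contDiff_mul_left g).of_le (by exact_mod_cast le_top)) ⟨fun x y h => ?_, fun y =>
      ⟨G.mul (G.inv g) y, G.mul_inv_cancel_left g y⟩⟩ fun x => ?_
  · rw [← G.inv_mul_cancel_left g x, h, G.inv_mul_cancel_left]
  · rw [G.det_fderiv_eq_of_dil (Φ := G.mul) G.contDiff_mul
      fun r hr p x => (G.dil_mul_eq hr p x).symm]
    have e : G.mul 0 = id := funext G.zero_mul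
    simp [e, ContinuousLinearMap.det]

theorem measurePreserving_mul_right (g : Fin N → ℝ) :
    MeasurePreserving fun x => G.mul x g := by
  refine measurePreserving_of_abs_det_eq_one
    ((G.contDiff_mul_right g).of_le (by exact_mod_cast le_top)) ⟨fun x y h => ?_, fun y =>
      ⟨G.mul y (G.inv g), G.inv_mul_cancel_right y g⟩⟩ fun x => ?_
  · rw [← G.mul_inv_cancel_right x g]
    simp only at h
    rw [h, G.mul_inv_cancel_right]
  · rw [G.det_fderiv_eq_of_dil (Φ := fun p x => G.mul x p)
      (G.contDiff_mul_comp contDiff_snd contDiff_fst) fun r hr p x => (G.dil_mul_eq hr x p).symm]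
    have e : (fun x => G.mul x 0) = id := funext G.mul_zero
    simp [e, ContinuousLinearMap.det]

theorem mul_inv_inv_mul (x y : Fin N → ℝ) : G.mul x (G.inv (G.mul (G.inv y) x)) = y := by
  rw [G.inv_mul_rev, G.inv_inv, G.mul_inv_cancel_left]

theorem inv_mul_inv_mul (x z : Fin N → ℝ) : G.mul (G.inv (G.mul x (G.inv z))) x = z := by
  rw [G.inv_mul_rev, G.inv_inv, G.inv_mul_cancel_right]

/-- The Jacobian is that of the inversion at the origin, whose differential there is `-id`. -/
theorem measurePreserving_inv_mul (x : Fin N → ℝ) :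
    MeasurePreserving fun y => G.mul (G.inv y) x := by
  have hc : ContDiff ℝ ∞ fun p : (Fin N → ℝ) × (Fin N → ℝ) => G.mul (G.inv p.2) p.1 :=
    G.contDiff_mul_comp (G.contDiff_inv.comp contDiff_snd) contDiff_fst
  refine measurePreserving_of_abs_det_eq_one
    ((hc.comp (contDiff_const.prodMk contDiff_id)).of_le (by exact_mod_cast le_top))
    ⟨fun y z h => ?_, fun z => ⟨G.mul x (G.inv z), G.inv_mul_inv_mul x z⟩⟩ fun y => ?_
  · simp only at h
    rw [← G.mul_inv_inv_mul x y, h, G.mul_inv_inv_mul]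
  · rw [G.det_fderiv_eq_of_dil (Φ := fun p x => G.mul (G.inv x) p) hc fun r hr p x => by
      rw [G.dil_mul_eq hr, G.dil_inv_eq hr]]
    have e : (fun x => G.mul (G.inv x) 0) = G.inv := funext fun x => G.mul_zero _
    rw [e, G.hasFDerivAt_inv_zero.fderiv]
    have e2 : (-LinearMap.id : (Fin N → ℝ) →ₗ[ℝ] Fin N → ℝ) = (-1 : ℝ) • LinearMap.id :=
      (neg_one_smul ℝ _).symm
    have e3 : (-ContinuousLinearMap.id ℝ (Fin N → ℝ)).det =
        LinearMap.det (-LinearMap.id : (Fin N → ℝ) →ₗ[ℝ] Fin N → ℝ) := rfl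
    rw [e3, e2, LinearMap.det_smul]
    simp

theorem measurableEmbedding_inv_mul (x : Fin N → ℝ) :
    MeasurableEmbedding fun y => G.mul (G.inv y) x := by
  refine (G.continuous_mul (G.continuous_inv continuous_id) continuous_const).measurableEmbedding
    fun y z h => ?_
  simp only at h
  rw [← G.mul_inv_inv_mul x y]
  simp only [id] at h
  rw [h, G.mul_inv_inv_mul]

theorem integral_inv_mul (x : Fin N → ℝ) (g : (Fin N → ℝ) → ℝ) :
    ∫ y, g (G.mul (G.inv y) x) = ∫ z, g z :=
  (G.measurePreserving_inv_mul x).integral_comp (G.measurableEmbedding_inv_mul x) g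

theorem measurableEmbedding_mul_right (g : Fin N → ℝ) :
    MeasurableEmbedding fun x => G.mul x g := by
  refine (G.contDiff_mul_right g).continuous.measurableEmbedding fun y z h => ?_
  simp only at h
  rw [← G.mul_inv_cancel_right y g, h, G.mul_inv_cancel_right]

theorem integral_mul_right (x : Fin N → ℝ) (g : (Fin N → ℝ) → ℝ) :
    ∫ y, g (G.mul y x) = ∫ z, g z :=
  (G.measurePreserving_mul_right x).integral_comp (G.measurableEmbedding_mul_right x) g

theorem map_dil_volume {r : ℝ} (hr : 0 < r) :
    Measure.map (G.dil r) volume = ENNReal.ofReal (r ^ G.Q)⁻¹ • volume := by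
  have hdet : LinearMap.det (G.dilL r : (Fin N → ℝ) →ₗ[ℝ] Fin N → ℝ) = r ^ G.Q := by
    have e : (G.dilL r : (Fin N → ℝ) →ₗ[ℝ] Fin N → ℝ) =
        Matrix.toLin' (Matrix.diagonal fun i => r ^ G.σ i) := by
      ext1 i; ext x
      simp [dil_apply, Matrix.mulVec_diagonal]
    rw [e, LinearMap.det_toLin', Matrix.det_diagonal, Q, Finset.prod_pow_eq_pow_sum]
  have h := Real.map_linearMap_volume_pi_eq_smul_volume_pi
    (f := (G.dilL r : (Fin N → ℝ) →ₗ[ℝ] Fin N → ℝ)) (by rw [hdet]; positivity)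
  rw [hdet, abs_of_pos (by positivity)] at h
  rw [← h]
  congr 1

theorem measurableEmbedding_dil {r : ℝ} (hr : 0 < r) : MeasurableEmbedding (G.dil r) := by
  refine (G.contDiff_dil r).continuous.measurableEmbedding fun y z h => ?_
  rw [← G.dil_inv_dil hr y, h, G.dil_inv_dil hr]

theorem integral_dil {r : ℝ} (hr : 0 < r) (g : (Fin N → ℝ) → ℝ) :
    ∫ y, g (G.dil r y) = (r ^ G.Q)⁻¹ * ∫ z, g z := by
  rw [← (G.measurableEmbedding_dil hr).integral_map, G.map_dil_volume hr, integral_smul_measure,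
    ENNReal.toReal_ofReal (by positivity), smul_eq_mul]

theorem integral_dil_inv {r : ℝ} (hr : 0 < r) (g : (Fin N → ℝ) → ℝ) :
    ∫ y, g (G.dil r⁻¹ y) = r ^ G.Q * ∫ z, g z := by
  rw [G.integral_dil (inv_pos.2 hr), inv_pow, inv_inv]

/-! ### Horizontal derivatives of smooth functions -/

/-- The derivative `Y_i g` of a differentiable function `g`, as the Fréchet derivative of `g` in
the direction of the field. -/
noncomputable def YDeriv (i : Fin m) (g : (Fin N → ℝ) → ℝ) (x : Fin N → ℝ) : ℝ :=
  fderiv ℝ g x (G.Y i x)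

theorem contDiff_YDeriv (i : Fin m) {g : (Fin N → ℝ) → ℝ} (hg : ContDiff ℝ ∞ g) :
    ContDiff ℝ ∞ (G.YDeriv i g) :=
  (hg.fderiv_right (by simp)).clm_apply (G.contDiff_Y i)

theorem hasCompactSupport_YDeriv (i : Fin m) {g : (Fin N → ℝ) → ℝ} (hg : HasCompactSupport g) :
    HasCompactSupport (G.YDeriv i g) := by
  refine hg.mono' fun x hx => ?_
  refine support_fderiv_subset ℝ (f := g) fun h => hx ?_
  simp [YDeriv, h]

/-- By left invariance, left translates of integral curves of `Y_i` are integral curves of `Y_i`. -/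
theorem hasDerivAt_comp_mul_left (i : Fin m) {k : (Fin N → ℝ) → ℝ} {g : Fin N → ℝ}
    {γ : ℝ → Fin N → ℝ} {t : ℝ} (hγ : HasDerivAt γ (G.Y i (γ t)) t)
    (hk : DifferentiableAt ℝ k (G.mul g (γ t))) :
    HasDerivAt (fun t => k (G.mul g (γ t))) (G.YDeriv i k (G.mul g (γ t))) t := by
  have h1 : HasDerivAt (fun t => G.mul g (γ t)) (G.Y i (G.mul g (γ t))) t := by
    rw [← G.fderiv_mul_left_Y]
    exact (((G.contDiff_mul_left g).differentiable (by simp)) _).hasFDerivAt.comp_hasDerivAt t hγ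
  exact hk.hasFDerivAt.comp_hasDerivAt t h1

/-- `Y_i` has degree one with respect to the dilations. -/
theorem YDeriv_dil (i : Fin m) {k : (Fin N → ℝ) → ℝ} {r : ℝ} (hr : 0 < r) (c : ℝ)
    {x : Fin N → ℝ} (hk : DifferentiableAt ℝ k (G.dil r x)) :
    G.YDeriv i (fun z => c * k (G.dil r z)) x = c * r * G.YDeriv i k (G.dil r x) := by
  have h1 : HasFDerivAt (fun z => k (G.dil r z)) _ x :=
    hk.hasFDerivAt.comp x (G.hasFDerivAt_dil r x)
  have h := h1.const_mul c
  rw [YDeriv, h.fderiv, YDeriv]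
  simp only [smul_apply, ContinuousLinearMap.comp_apply, G.dilL_Y i hr,
    map_smul, smul_eq_mul]
  ring

/-! ### Potentials with smooth kernels -/

/-- After the change of variables `z = y⁻¹ * x`, the potential is a left convolution. -/
theorem potential_eq (k φ : (Fin N → ℝ) → ℝ) (x : Fin N → ℝ) :
    G.potential k φ x = ∫ z, k z * φ (G.mul x (G.inv z)) := by
  rw [← G.integral_inv_mul x]
  simp only [G.mul_inv_inv_mul]
  rfl

theorem integrable_potential {k φ : (Fin N → ℝ) → ℝ} (hk : Continuous k) (hφ : Continuous φ)
    (hc : HasCompactSupport φ) (x : Fin N → ℝ) :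
    Integrable fun y => k (G.mul (G.inv y) x) * φ y :=
  ((hk.comp (G.continuous_mul (G.continuous_inv continuous_id) continuous_const)).mul
    hφ).integrable_of_hasCompactSupport hc.mul_left

/-- Differentiation of a potential with smooth kernel along an integral curve of `Y_i` falls on
the kernel, as `Y_i` is left-invariant. -/
theorem hasDerivAt_potential (i : Fin m) {k φ : (Fin N → ℝ) → ℝ} (hk : ContDiff ℝ ∞ k)
    (hkc : HasCompactSupport k) (hφ : Continuous φ) (hc : HasCompactSupport φ)
    {γ : ℝ → Fin N → ℝ} {t : ℝ} (hγ : IsIntegralCurveAt γ (fun _ => G.Y i) t) :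
    HasDerivAt (fun s => G.potential k φ (γ s)) (G.potential (G.YDeriv i k) φ (γ t)) t := by
  have hYk := G.contDiff_YDeriv i hk
  obtain ⟨M, hM⟩ := (G.hasCompactSupport_YDeriv i hkc).exists_bound_of_continuous hYk.continuous
  refine (hasDerivAt_integral_of_dominated_loc_of_deriv_le hγ
    (F := fun s y => k (G.mul (G.inv y) (γ s)) * φ y)
    (F' := fun s y => G.YDeriv i k (G.mul (G.inv y) (γ s)) * φ y)
    (bound := fun y => M * ‖φ y‖)
    (Eventually.of_forall fun s => (G.integrable_potential hk.continuous hφ hc _).1)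
    (G.integrable_potential hk.continuous hφ hc _)
    (G.integrable_potential hYk.continuous hφ hc _).1 ?_ ?_ ?_).2
  · refine Eventually.of_forall fun y s _ => ?_
    rw [norm_mul]
    exact mul_le_mul_of_nonneg_right (hM _) (norm_nonneg _)
  · exact ((hφ.integrable_of_hasCompactSupport hc).norm).const_mul M
  · refine Eventually.of_forall fun y s hs => ?_
    exact (G.hasDerivAt_comp_mul_left i hs ((hk.differentiable (by simp)) _)).mul_const _

/-- Horizontal derivatives of test functions have mean zero, by right invariance of Lebesgue
measure. -/
theorem integral_YDeriv_eq_zero (i : Fin m) {k : (Fin N → ℝ) → ℝ} (hk : ContDiff ℝ ∞ k)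
    (hkc : HasCompactSupport k) : ∫ z, G.YDeriv i k z = 0 := by
  obtain ⟨γ, hγ0, hγ⟩ := exists_integralCurve
    ((G.contDiff_Y i).of_le (by exact_mod_cast le_top)) (0 : Fin N → ℝ)
  obtain ⟨ε, hε, h⟩ := Metric.eventually_nhds_iff_ball.1 hγ
  -- a test function `b` equal to `1` on the points `γ t * z⁻¹` with `t` small and `k z ≠ 0`
  have hcγ : ContinuousOn γ (Icc (-(ε / 2)) (ε / 2)) := fun t ht =>
    (h t (by rw [mem_ball_zero_iff, Real.norm_eq_abs]
             exact (abs_le.2 ht).trans_lt (half_lt_self hε))).continuousAt.continuousWithinAt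
  have hcomp : IsCompact ((fun p : (Fin N → ℝ) × (Fin N → ℝ) => G.mul p.1 (G.inv p.2)) ''
      ((γ '' Icc (-(ε / 2)) (ε / 2)) ×ˢ tsupport k)) :=
    ((isCompact_Icc.image_of_continuousOn hcγ).prod hkc.isCompact).image
      (G.continuous_mul continuous_fst (G.continuous_inv continuous_snd))
  obtain ⟨R, hR⟩ := hcomp.isBounded.subset_closedBall 0
  let b : ContDiffBump (0 : Fin N → ℝ) := ⟨|R| + 1, |R| + 2, by positivity, by linarith⟩
  have hη : ∀ t ∈ Icc (-(ε / 2)) (ε / 2), ∀ z ∈ tsupport k, b (G.mul (γ t) (G.inv z)) = 1 :=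
    fun t ht z hz => b.one_of_mem_closedBall <|
      Metric.closedBall_subset_closedBall ((le_abs_self R).trans (by simp [b]))
        (hR ⟨(γ t, z), ⟨⟨t, ht, rfl⟩, hz⟩, rfl⟩)
  have hpot : ∀ {g : (Fin N → ℝ) → ℝ}, Function.support g ⊆ tsupport k →
      ∀ t ∈ Icc (-(ε / 2)) (ε / 2), G.potential g b (γ t) = ∫ z, g z := by
    intro g hg t ht
    rw [G.potential_eq]
    refine integral_congr_ae (Eventually.of_forall fun z => ?_)
    by_cases hz : g z = 0
    · simp [hz]
    · simp [hη t ht z (hg hz)]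
  have hd := G.hasDerivAt_potential i hk hkc b.continuous b.hasCompactSupport hγ
  have hnhds : Icc (-(ε / 2)) (ε / 2) ∈ 𝓝 (0 : ℝ) := Icc_mem_nhds (by linarith) (by linarith)
  -- the potential of `k` with density `b` is constant along `γ`
  have hd2 : HasDerivAt (fun s => G.potential k b (γ s)) 0 0 := by
    refine (hasDerivAt_const (0 : ℝ) (∫ z, k z)).congr_of_eventuallyEq ?_
    filter_upwards [hnhds] with t ht using hpot (subset_tsupport k) t ht
  rw [hpot ?_ 0 (mem_of_mem_nhds hnhds)] at hd
  · exact hd.unique hd2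
  · intro x hx
    exact support_fderiv_subset ℝ (f := k) fun h => hx (by simp [YDeriv, h])

/-! ### Size of potentials -/

/-- Bound by the `L¹` norm of the kernel and the supremum of the density. -/
theorem abs_potential_le_of_bound {k φ : (Fin N → ℝ) → ℝ} (hk : Integrable k) {A : ℝ}
    (hA : ∀ x, |φ x| ≤ A) (x : Fin N → ℝ) : |G.potential k φ x| ≤ (∫ z, |k z|) * A := by
  rw [G.potential_eq, ← integral_mul_const, ← Real.norm_eq_abs]
  refine norm_integral_le_of_norm_le (hk.abs.mul_const A) (Eventually.of_forall fun z => ?_)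
  rw [norm_mul, Real.norm_eq_abs, Real.norm_eq_abs]
  exact mul_le_mul_of_nonneg_left (hA _) (abs_nonneg _)

/-- Bound by the supremum of the kernel and the `L¹` norm of the density. -/
theorem abs_potential_le_of_kernel_bound {k φ : (Fin N → ℝ) → ℝ} (hφ : Integrable φ) {B : ℝ}
    (hB : ∀ z, |k z| ≤ B) (x : Fin N → ℝ) : |G.potential k φ x| ≤ B * ∫ y, |φ y| := by
  rw [potential, ← integral_const_mul, ← Real.norm_eq_abs]
  refine norm_integral_le_of_norm_le (hφ.abs.const_mul B) (Eventually.of_forall fun z => ?_)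
  rw [norm_mul, Real.norm_eq_abs, Real.norm_eq_abs]
  exact mul_le_mul_of_nonneg_right (hB _) (abs_nonneg _)

/-- A kernel with mean zero only sees the oscillation of the density on its support. -/
theorem abs_potential_le_of_integral_eq_zero {k φ : (Fin N → ℝ) → ℝ} (hk : Continuous k)
    (hkc : HasCompactSupport k) (hφ : Continuous φ) (h0 : ∫ z, k z = 0) {A : ℝ} {x : Fin N → ℝ}
    (hA : ∀ z, k z ≠ 0 → |φ (G.mul x (G.inv z)) - φ x| ≤ A) :
    |G.potential k φ x| ≤ (∫ z, |k z|) * A := by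
  have hki : Integrable k := hk.integrable_of_hasCompactSupport hkc
  have h1 : Integrable fun z => k z * φ (G.mul x (G.inv z)) :=
    (hk.mul (hφ.comp (G.continuous_mul continuous_const
      (G.continuous_inv continuous_id)))).integrable_of_hasCompactSupport hkc.mul_right
  have h2 : G.potential k φ x = ∫ z, k z * (φ (G.mul x (G.inv z)) - φ x) := by
    simp only [mul_sub]
    rw [integral_sub h1 (hki.mul_const _), integral_mul_const, h0, zero_mul, sub_zero,
      G.potential_eq]
  rw [h2, ← integral_mul_const, ← Real.norm_eq_abs]
  refine norm_integral_le_of_norm_le (hki.abs.mul_const A) (Eventually.of_forall fun z => ?_)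
  rw [norm_mul, Real.norm_eq_abs, Real.norm_eq_abs]
  by_cases hz : k z = 0
  · simp [hz]
  · exact mul_le_mul_of_nonneg_left (hA z hz) (abs_nonneg _)

/-- Translating the argument of a potential amounts to translating the kernel. -/
theorem potential_mul_sub (k φ : (Fin N → ℝ) → ℝ) (hk : Continuous k) (hφ : Continuous φ)
    (hc : HasCompactSupport φ) (x a : Fin N → ℝ) :
    G.potential k φ (G.mul x a) - G.potential k φ x =
      G.potential (fun z => k (G.mul z a) - k z) φ x := by
  have h1 := G.integrable_potential hk hφ hc (G.mul x a)
  have h2 := G.integrable_potential hk hφ hc x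
  simp only [potential]
  rw [← integral_sub h1 h2]
  refine integral_congr_ae (Eventually.of_forall fun y => ?_)
  simp only [G.mul_assoc]
  ring

/-! ### The control distance as a real number -/

/-- The control distance as a real-valued function; it is finite everywhere. -/
noncomputable def cc (x y : Fin N → ℝ) : ℝ := (G.ccDist x y).toReal

theorem cc_nonneg (x y : Fin N → ℝ) : 0 ≤ G.cc x y := ENNReal.toReal_nonneg

theorem cc_comm (x y : Fin N → ℝ) : G.cc x y = G.cc y x := by rw [cc, G.ccDist_comm, cc]

theorem cc_mul_left (g x y : Fin N → ℝ) : G.cc (G.mul g x) (G.mul g y) = G.cc x y := by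
  rw [cc, G.ccDist_mul_left, cc]

theorem cc_eq_zero_left (x y : Fin N → ℝ) : G.cc x y = G.cc 0 (G.mul (G.inv x) y) := by
  rw [cc, G.ccDist_eq_zero_left, cc]

theorem cc_mul_inv (x z : Fin N → ℝ) : G.cc (G.mul x (G.inv z)) x = G.cc 0 z := by
  have h := G.cc_mul_left x (G.inv z) 0
  rw [G.mul_zero] at h
  rw [h, G.cc_comm, cc, G.ccDist_zero_inv, cc]

theorem ofReal_cc (x y : Fin N → ℝ) : ENNReal.ofReal (G.cc x y) = G.ccDist x y :=
  ENNReal.ofReal_toReal (G.ccDist_lt_top x y).ne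

theorem cc_dil_le {r : ℝ} (hr : 0 < r) (x y : Fin N → ℝ) :
    G.cc (G.dil r x) (G.dil r y) ≤ r * G.cc x y := by
  have h := G.ccDist_dil_le (r := ⟨r, hr.le⟩) (by exact_mod_cast hr) x y
  have h2 := ENNReal.toReal_mono (ENNReal.mul_ne_top ENNReal.coe_ne_top (G.ccDist_lt_top x y).ne) h
  rwa [ENNReal.toReal_mul] at h2

/-- The summand `1` in the Lipschitz constant keeps it positive when `M = 0`. -/
theorem abs_sub_le_cc {K : (Fin N → ℝ) → ℝ} (hK : ContDiff ℝ ∞ K) {M : ℝ} (hM : 0 ≤ M)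
    (h : ∀ i x, |G.YDeriv i K x| ≤ M) (x y : Fin N → ℝ) :
    |K y - K x| ≤ (m * M + 1) * G.cc x y := by
  have h1 := G.enorm_sub_le_ccDist (hK.of_le (by exact_mod_cast le_top)) hM h x y
  rw [Real.enorm_eq_ofReal_abs, ← G.ofReal_cc, ← ENNReal.ofReal_mul (by positivity)] at h1
  exact (ENNReal.ofReal_le_ofReal_iff
    (mul_nonneg (by positivity) (G.cc_nonneg x y))).1 h1

theorem tendsto_cc_nhds (x : Fin N → ℝ) : Tendsto (G.cc x) (𝓝 x) (𝓝 0) := by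
  have h1 : Tendsto (fun y => G.mul (G.inv x) y) (𝓝 x) (𝓝 0) := by
    have := (G.contDiff_mul_left (G.inv x)).continuous.tendsto x
    rwa [G.inv_mul] at this
  have h2 := (ENNReal.tendsto_toReal ENNReal.zero_ne_top).comp (G.tendsto_ccDist_zero.comp h1)
  refine h2.congr fun y => ?_
  simp only [Function.comp]
  rw [← G.ccDist_eq_zero_left, cc]

/-- Hölder continuity for the control distance implies continuity for the Euclidean topology. -/
theorem continuous_of_holder {φ : (Fin N → ℝ) → ℝ} {H α : ℝ} (hα : 0 < α)
    (h : ∀ x y, |φ x - φ y| ≤ H * G.cc x y ^ α) : Continuous φ := by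
  refine continuous_iff_continuousAt.2 fun x => ?_
  refine tendsto_iff_dist_tendsto_zero.2 ?_
  have h1 : Tendsto (fun y => H * G.cc x y ^ α) (𝓝 x) (𝓝 0) := by
    have := ((G.tendsto_cc_nhds x).rpow_const (p := α) (Or.inr hα.le)).const_mul H
    simpa [Real.zero_rpow hα.ne'] using this
  refine squeeze_zero (fun y => dist_nonneg) (fun y => ?_) h1
  rw [dist_comm, Real.dist_eq]
  exact h x y

end CarnotGroup

/-! ### Two-sided geometric series -/

theorem summable_pow_natAbs {κ : ℝ} (h0 : 0 ≤ κ) (h1 : κ < 1) :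
    Summable fun j : ℤ => κ ^ j.natAbs := by
  refine Summable.of_nat_of_neg_add_one ?_ ?_
  · simpa using summable_geometric_of_lt_one h0 h1
  · have h : ∀ n : ℕ, (-((n : ℤ) + 1)).natAbs = n + 1 := fun n => by lia
    simp only [h]
    exact (summable_nat_add_iff 1).2 (summable_geometric_of_lt_one h0 h1)

/-- At the scale `2^{-j} ≤ 1`, the power `α` is geometric in `|j|`. -/
theorem two_zpow_neg_rpow_of_nonneg {α : ℝ} {j : ℤ} (hj : 0 ≤ j) :
    ((2 : ℝ) ^ (-j)) ^ α = ((2 : ℝ) ^ (-α)) ^ j.natAbs := by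
  rw [← Real.rpow_intCast, ← Real.rpow_mul two_pos.le, ← Real.rpow_natCast,
    ← Real.rpow_mul two_pos.le]
  congr 1
  have : ((j.natAbs : ℕ) : ℝ) = (j : ℝ) := by
    rw [← Int.cast_natCast, Int.natAbs_of_nonneg hj]
  rw [this]; push_cast; ring

/-- At the scale `2^{-j} ≥ 1`, the power `-α` is geometric in `|j|`. -/
theorem two_zpow_neg_rpow_of_nonpos {α : ℝ} {j : ℤ} (hj : j ≤ 0) :
    ((2 : ℝ) ^ (-j)) ^ (-α) = ((2 : ℝ) ^ (-α)) ^ j.natAbs := by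
  rw [← Real.rpow_intCast, ← Real.rpow_mul two_pos.le, ← Real.rpow_natCast,
    ← Real.rpow_mul two_pos.le]
  congr 1
  have : ((j.natAbs : ℕ) : ℝ) = -(j : ℝ) := by
    rw [← Int.cast_natCast, Int.ofNat_natAbs_of_nonpos hj]; simp
  rw [this]; push_cast; ring

/-- A telescoping series over `ℤ` with eventually constant terms. -/
theorem hasSum_telescope {a : ℤ → ℝ} {J : ℕ} (h0 : ∀ n : ℕ, J ≤ n → a n = 0)
    (h1 : ∀ n : ℕ, J ≤ n → a (-n) = 1) : HasSum (fun j => a j - a (j + 1)) 1 := by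
  have e1 : HasSum (fun n : ℕ => a n - a (n + 1)) (a 0) := by
    have h := hasSum_sum_of_ne_finset_zero (L := .unconditional ℕ)
      (f := fun n : ℕ => a n - a (n + 1))
      (s := Finset.range J) (fun n hn => by
        rw [Finset.mem_range, not_lt] at hn
        have h2 := h0 (n + 1) (by lia)
        push_cast at h2
        rw [h0 n hn, h2, sub_zero])
    have h3 := Finset.sum_range_sub' (fun n : ℕ => a n) J
    push_cast at h3
    rw [h3, h0 J le_rfl, sub_zero] at h
    exact h
  have e2 : HasSum (fun n : ℕ => a (-(n + 1)) - a (-(n + 1) + 1)) (1 - a 0) := by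
    have e : ∀ n : ℕ, (-((n : ℤ) + 1) + 1) = -n := fun n => by ring
    simp only [e]
    have h := hasSum_sum_of_ne_finset_zero (L := .unconditional ℕ)
      (f := fun n : ℕ => a (-(n + 1)) - a (-n))
      (s := Finset.range J) (fun n hn => by
        rw [Finset.mem_range, not_lt] at hn
        have h2 := h1 (n + 1) (by lia)
        push_cast at h2
        rw [h1 n hn, h2, sub_self])
    have h3 := Finset.sum_range_sub (fun n : ℕ => a (-n)) J
    push_cast at h3
    rw [h3, h1 J le_rfl, neg_zero] at h
    exact h
  have := HasSum.of_nat_of_neg_add_one (f := fun j : ℤ => a j - a (j + 1)) e1 e2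
  rwa [add_sub_cancel] at this

/-- A pointwise convergent series whose norms have summable integrals has an integrable sum, and
may be integrated term by term. -/
theorem integrable_and_hasSum_integral {X : Type*} [MeasurableSpace X] {μ : Measure X}
    {F : ℤ → X → ℝ} {f : X → ℝ} (hf : AEStronglyMeasurable f μ) (hF : ∀ j, Integrable (F j) μ)
    (hs : Summable fun j => ∫ a, ‖F j a‖ ∂μ) (h : ∀ᵐ a ∂μ, HasSum (fun j => F j a) (f a)) :
    Integrable f μ ∧ HasSum (fun j => ∫ a, F j a ∂μ) (∫ a, f a ∂μ) := by
  constructor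
  · refine ⟨hf, ?_⟩
    have h1 : ∫⁻ a, ‖f a‖ₑ ∂μ ≤ ∫⁻ a, ∑' j, ‖F j a‖ₑ ∂μ := by
      refine lintegral_mono_ae (h.mono fun a ha => ?_)
      rw [← ha.tsum_eq]
      exact enorm_tsum_le_tsum_enorm
    refine h1.trans_lt ?_
    rw [lintegral_tsum fun j => (hF j).1.enorm]
    have h2 : ∀ j, ∫⁻ a, ‖F j a‖ₑ ∂μ = ENNReal.ofReal (∫ a, ‖F j a‖ ∂μ) := fun j =>
      (ofReal_integral_norm_eq_lintegral_enorm (hF j)).symm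
    simp only [h2]
    rw [← ENNReal.ofReal_tsum_of_nonneg (fun j => integral_nonneg fun a => norm_nonneg _) hs]
    exact ENNReal.ofReal_lt_top
  · have h1 := hasSum_integral_of_summable_integral_norm hF hs
    rwa [integral_congr_ae (h.mono fun a ha => ha.tsum_eq)] at h1

namespace CarnotGroup

variable {N m : ℕ} (G : CarnotGroup N m)

/-! ### Dyadic pieces -/

/-- The kernel `K` rescaled to size `r`, with homogeneity `-n`. -/
noncomputable def rescale (n : ℕ) (r : ℝ) (K : (Fin N → ℝ) → ℝ) (z : Fin N → ℝ) : ℝ :=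
  (r ^ n)⁻¹ * K (G.dil r⁻¹ z)

variable {G}

theorem contDiff_rescale (n : ℕ) (r : ℝ) {K : (Fin N → ℝ) → ℝ} (hK : ContDiff ℝ ∞ K) :
    ContDiff ℝ ∞ (G.rescale n r K) :=
  contDiff_const.mul (hK.comp (G.contDiff_dil r⁻¹))

theorem continuous_rescale (n : ℕ) (r : ℝ) {K : (Fin N → ℝ) → ℝ} (hK : Continuous K) :
    Continuous (G.rescale n r K) :=
  continuous_const.mul (hK.comp (G.contDiff_dil r⁻¹).continuous)

theorem hasCompactSupport_rescale (n : ℕ) {r : ℝ} (hr : 0 < r) {K : (Fin N → ℝ) → ℝ}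
    (hK : HasCompactSupport K) : HasCompactSupport (G.rescale n r K) := by
  refine HasCompactSupport.intro (hK.isCompact.image (G.contDiff_dil r).continuous) fun z hz => ?_
  rw [rescale, image_eq_zero_of_notMem_tsupport fun h => hz ⟨_, h, G.dil_dil_inv hr z⟩, mul_zero]

/-- A horizontal derivative lowers the degree of homogeneity by one. -/
theorem YDeriv_rescale (i : Fin m) (n : ℕ) {r : ℝ} (hr : 0 < r) {K : (Fin N → ℝ) → ℝ}
    (hK : ContDiff ℝ ∞ K) :
    G.YDeriv i (G.rescale n r K) = G.rescale (n + 1) r (G.YDeriv i K) := by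
  ext1 z
  have := G.YDeriv_dil i (inv_pos.2 hr) (r ^ n)⁻¹ ((hK.differentiable (by simp)) (G.dil r⁻¹ z))
  rw [rescale, pow_succ, mul_inv]
  exact this

theorem abs_rescale (n : ℕ) {r : ℝ} (hr : 0 < r) (K : (Fin N → ℝ) → ℝ) (z : Fin N → ℝ) :
    |G.rescale n r K z| = G.rescale n r (fun z => |K z|) z := by
  rw [rescale, rescale, abs_mul, abs_of_pos (by positivity : 0 < (r ^ n)⁻¹)]

/-- In degree `-Q` the rescaling preserves the integral. -/
theorem integral_rescale {n : ℕ} (hn : n ≤ G.Q) {r : ℝ} (hr : 0 < r) (K : (Fin N → ℝ) → ℝ) :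
    ∫ z, G.rescale n r K z = r ^ (G.Q - n) * ∫ z, K z := by
  simp only [rescale]
  rw [integral_const_mul, G.integral_dil_inv hr, ← mul_assoc]
  congr 1
  rw [inv_mul_eq_iff_eq_mul₀ (by positivity), ← pow_add, Nat.add_sub_cancel' hn]

variable {K φ : (Fin N → ℝ) → ℝ} {α : ℝ}

/-- Large pieces: the kernel is small. -/
theorem abs_potential_rescale_le_of_one_le {n : ℕ} (hn : 1 ≤ n) {r : ℝ} (hr : 1 ≤ r)
    (hα : α ≤ 1) (hφ : Integrable φ) {B : ℝ} (hB : ∀ z, |K z| ≤ B) (x : Fin N → ℝ) :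
    |G.potential (G.rescale n r K) φ x| ≤ B * (∫ y, |φ y|) * r ^ (-α) := by
  have hr0 : 0 < r := zero_lt_one.trans_le hr
  have hB0 : 0 ≤ B := (abs_nonneg _).trans (hB 0)
  have h1 : (r ^ n)⁻¹ ≤ r ^ (-α) := by
    rw [← Real.rpow_natCast, ← Real.rpow_neg hr0.le]
    refine Real.rpow_le_rpow_of_exponent_le hr (neg_le_neg (hα.trans ?_))
    exact_mod_cast hn
  have h2 := G.abs_potential_le_of_kernel_bound (k := G.rescale n r K) hφ (B := r ^ (-α) * B)
    (fun z => by
      rw [rescale, abs_mul, abs_of_pos (by positivity : 0 < (r ^ n)⁻¹)]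
      exact mul_le_mul h1 (hB _) (abs_nonneg _) (by positivity)) x
  linarith [h2]

/-- Small pieces of a kernel with an integrable singularity. -/
theorem abs_potential_rescale_le_of_le_one {n : ℕ} (hn : n < G.Q) {r : ℝ} (hr : 0 < r)
    (hr1 : r ≤ 1) (hα : α ≤ 1) (hK : Continuous K) (hKc : HasCompactSupport K) {A : ℝ}
    (hA : ∀ x, |φ x| ≤ A) (x : Fin N → ℝ) :
    |G.potential (G.rescale n r K) φ x| ≤ (∫ z, |K z|) * A * r ^ α := by
  have hA0 : 0 ≤ A := (abs_nonneg _).trans (hA 0)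
  have hK0 : 0 ≤ ∫ z, |K z| := integral_nonneg fun z => abs_nonneg _
  have h2 := G.abs_potential_le_of_bound (k := G.rescale n r K)
    ((continuous_rescale n r hK).integrable_of_hasCompactSupport
      (hasCompactSupport_rescale n hr hKc)) hA x
  simp only [abs_rescale n hr] at h2
  rw [integral_rescale hn.le hr] at h2
  have h1 : r ^ (G.Q - n) ≤ r ^ α := by
    rw [← Real.rpow_natCast]
    refine Real.rpow_le_rpow_of_exponent_ge hr hr1 (hα.trans ?_)
    exact_mod_cast (by lia : 1 ≤ G.Q - n)
  refine h2.trans ?_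
  calc r ^ (G.Q - n) * (∫ z, |K z|) * A ≤ r ^ α * (∫ z, |K z|) * A := by gcongr
    _ = _ := by ring

/-- Pieces of a singular kernel with mean zero: the density only enters through its modulus of
continuity. -/
theorem abs_potential_rescale_le_of_integral_eq_zero {r : ℝ} (hr : 0 < r) (hα : 0 ≤ α)
    (hK : Continuous K) (hKc : HasCompactSupport K) (h0 : ∫ z, K z = 0) (hφ : Continuous φ)
    {H C : ℝ} (hH0 : 0 ≤ H) (hH : ∀ x y, |φ x - φ y| ≤ H * G.cc x y ^ α) (hC0 : 0 ≤ C)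
    (hC : ∀ z, K z ≠ 0 → G.cc 0 z ≤ C) (x : Fin N → ℝ) :
    |G.potential (G.rescale G.Q r K) φ x| ≤ (∫ z, |K z|) * (H * C ^ α) * r ^ α := by
  have h2 := G.abs_potential_le_of_integral_eq_zero (continuous_rescale G.Q r hK)
    (hasCompactSupport_rescale G.Q hr hKc) hφ
    (by rw [integral_rescale le_rfl hr, h0, mul_zero]) (A := H * C ^ α * r ^ α) (x := x)
    (fun z hz => by
      refine (hH _ _).trans ?_
      rw [G.cc_mul_inv, mul_assoc, ← Real.mul_rpow hC0 hr.le]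
      refine mul_le_mul_of_nonneg_left (Real.rpow_le_rpow (G.cc_nonneg _ _) ?_ hα) hH0
      have h3 := G.cc_dil_le hr 0 (G.dil r⁻¹ z)
      rw [G.dil_zero_right, G.dil_dil_inv hr] at h3
      rw [mul_comm]
      refine h3.trans (mul_le_mul_of_nonneg_left (hC _ fun h => hz ?_) hr.le)
      rw [rescale, h, mul_zero])
  simp only [abs_rescale G.Q hr] at h2
  rw [integral_rescale le_rfl hr, Nat.sub_self, pow_zero, one_mul] at h2
  linarith [h2]

/-- Combination of a bound for small pieces with a bound for large pieces. -/
theorem le_geometric_of_le {t : ℤ → ℝ} {a b : ℝ} (ha : 0 ≤ a) (hb : 0 ≤ b)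
    (h1 : ∀ j, (2 : ℝ) ^ (-j) ≤ 1 → t j ≤ a * ((2 : ℝ) ^ (-j)) ^ α)
    (h2 : ∀ j, 1 ≤ (2 : ℝ) ^ (-j) → t j ≤ b * ((2 : ℝ) ^ (-j)) ^ (-α)) (j : ℤ) :
    t j ≤ (a + b) * ((2 : ℝ) ^ (-α)) ^ j.natAbs := by
  have hκ : 0 ≤ ((2 : ℝ) ^ (-α)) ^ j.natAbs := by positivity
  rcases le_total 0 j with hj | hj
  · refine (h1 j (zpow_le_one_of_nonpos₀ one_le_two (by lia))).trans ?_
    rw [two_zpow_neg_rpow_of_nonneg hj]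
    nlinarith
  · refine (h2 j (one_le_zpow₀ one_le_two (by lia))).trans ?_
    rw [two_zpow_neg_rpow_of_nonpos hj]
    nlinarith

theorem two_rpow_neg_lt_one (hα : 0 < α) : (2 : ℝ) ^ (-α) < 1 :=
  Real.rpow_lt_one_of_one_lt_of_neg one_lt_two (neg_lt_zero.2 hα)

/-- Summable bound for the dyadic potentials of a kernel with integrable singularity. -/
theorem exists_bound_potential_rescale {n : ℕ} (hn1 : 1 ≤ n) (hn : n < G.Q)
    (hα1 : α ≤ 1) (hK : Continuous K) (hKc : HasCompactSupport K) (hφ : Continuous φ)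
    (hφc : HasCompactSupport φ) : ∃ C, ∀ (j : ℤ) (x : Fin N → ℝ),
      |G.potential (G.rescale n ((2 : ℝ) ^ (-j)) K) φ x| ≤ C * ((2 : ℝ) ^ (-α)) ^ j.natAbs := by
  obtain ⟨A, hA⟩ := hφc.exists_bound_of_continuous hφ
  obtain ⟨B, hB⟩ := hKc.exists_bound_of_continuous hK
  have hφi : Integrable φ := hφ.integrable_of_hasCompactSupport hφc
  have hA0 : 0 ≤ A := (norm_nonneg _).trans (hA 0)
  have hB0 : 0 ≤ B := (norm_nonneg _).trans (hB 0)
  have hK0 : 0 ≤ ∫ z, |K z| := integral_nonneg fun z => abs_nonneg _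
  have hφ0 : 0 ≤ ∫ z, |φ z| := integral_nonneg fun z => abs_nonneg _
  exact ⟨_, fun j x => le_geometric_of_le (mul_nonneg hK0 hA0) (mul_nonneg hB0 hφ0)
    (t := fun j => |G.potential (G.rescale n ((2 : ℝ) ^ (-j)) K) φ x|)
    (fun j hj => abs_potential_rescale_le_of_le_one hn (by positivity) hj hα1 hK hKc hA x)
    (fun j hj => abs_potential_rescale_le_of_one_le hn1 hj hα1 hφi hB x) j⟩

/-- Bound for the dyadic potentials of a singular kernel with mean zero. -/
theorem abs_potential_rescale_Q_le (hQ : 1 ≤ G.Q) (hα : 0 < α)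
    (hα1 : α ≤ 1) (hK : Continuous K) (hKc : HasCompactSupport K) (h0 : ∫ z, K z = 0)
    (hφ : Continuous φ) (hφc : HasCompactSupport φ)
    {H C B : ℝ} (hH0 : 0 ≤ H) (hH : ∀ x y, |φ x - φ y| ≤ H * G.cc x y ^ α) (hC0 : 0 ≤ C)
    (hC : ∀ z, K z ≠ 0 → G.cc 0 z ≤ C) (hB : ∀ z, |K z| ≤ B) (j : ℤ) (x : Fin N → ℝ) :
    |G.potential (G.rescale G.Q ((2 : ℝ) ^ (-j)) K) φ x| ≤
      ((∫ z, |K z|) * (H * C ^ α) + B * ∫ y, |φ y|) * ((2 : ℝ) ^ (-α)) ^ j.natAbs := by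
  have hφi : Integrable φ := hφ.integrable_of_hasCompactSupport hφc
  have hB0 : 0 ≤ B := (abs_nonneg _).trans (hB 0)
  have hK0 : 0 ≤ ∫ z, |K z| := integral_nonneg fun z => abs_nonneg _
  have hφ0 : 0 ≤ ∫ z, |φ z| := integral_nonneg fun z => abs_nonneg _
  exact le_geometric_of_le (by positivity) (mul_nonneg hB0 hφ0)
    (t := fun j => |G.potential (G.rescale G.Q ((2 : ℝ) ^ (-j)) K) φ x|)
    (fun j hj => abs_potential_rescale_le_of_integral_eq_zero (by positivity) hα.le hK hKc h0 hφ
      hH0 hH hC0 hC x)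
    (fun j hj => abs_potential_rescale_le_of_one_le hQ hj hα1 hφi hB x) j

/-- Regularity of the dyadic potentials at distances below the size of the kernel. -/
theorem abs_potential_rescale_sub_le {r : ℝ} (hr : 0 < r) (hα : 0 ≤ α)
    (hK : ContDiff ℝ ∞ K) (hKc : HasCompactSupport K)
    (hφ : Continuous φ) (hφc : HasCompactSupport φ)
    {H C M : ℝ} (hH0 : 0 ≤ H) (hH : ∀ x y, |φ x - φ y| ≤ H * G.cc x y ^ α) (hC0 : 0 ≤ C)
    {S : Set (Fin N → ℝ)} (hS : IsCompact S) (hKS : ∀ z, K z ≠ 0 → z ∈ S)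
    (hC : ∀ z ∈ S, G.cc 0 z ≤ C)
    (hM : 0 ≤ M) (hYK : ∀ i x, |G.YDeriv i K x| ≤ M) (x x' : Fin N → ℝ) (hd : G.cc x x' ≤ r) :
    |G.potential (G.rescale G.Q r K) φ x' - G.potential (G.rescale G.Q r K) φ x| ≤
      2 * (volume S).toReal * (m * M + 1) * (H * (C ^ α + 1)) * G.cc x x' * r ^ (α - 1) := by
  set a := G.mul (G.inv x) x' with ha
  set d := G.cc x x' with hd'
  have hd0 : 0 ≤ d := G.cc_nonneg _ _
  have hx' : x' = G.mul x a := (G.mul_inv_cancel_left x x').symm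
  set k := G.rescale G.Q r K with hk
  have hkc : Continuous k := continuous_rescale _ _ hK.continuous
  have hks : HasCompactSupport k := hasCompactSupport_rescale _ hr hKc
  have hki : Integrable k := hkc.integrable_of_hasCompactSupport hks
  have hkac : Continuous fun z => k (G.mul z a) - k z :=
    (hkc.comp (G.contDiff_mul_right a).continuous).sub hkc
  have hka : HasCompactSupport fun z => k (G.mul z a) := by
    refine HasCompactSupport.intro
      (hks.isCompact.image (G.contDiff_mul_right (G.inv a)).continuous) fun z hz => ?_
    exact image_eq_zero_of_notMem_tsupport fun h => hz ⟨_, h, G.mul_inv_cancel_right z a⟩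
  have hkas : HasCompactSupport fun z => k (G.mul z a) - k z := hka.sub hks
  have hkai : Integrable fun z => k (G.mul z a) :=
    (hkc.comp (G.contDiff_mul_right a).continuous).integrable_of_hasCompactSupport hka
  -- by right invariance, the difference of the kernels has mean zero whether or not `K` does
  have hint : ∫ z, (k (G.mul z a) - k z) = 0 := by
    rw [integral_sub hkai hki, G.integral_mul_right a, sub_self]
  -- the points where `k` does not vanish are at distance at most `C * r` from the origin
  have hsupp : ∀ z, k z ≠ 0 → G.cc 0 z ≤ C * r := fun z hz => by
    have h3 := G.cc_dil_le hr 0 (G.dil r⁻¹ z)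
    rw [G.dil_zero_right, G.dil_dil_inv hr] at h3
    rw [mul_comm]
    refine h3.trans (mul_le_mul_of_nonneg_left (hC _ (hKS _ fun h => hz ?_)) hr.le)
    rw [hk, rescale, h, mul_zero]
  have hosc : ∀ y z, k z ≠ 0 → |φ (G.mul y (G.inv z)) - φ y| ≤ H * (C * r) ^ α := fun y z hz => by
    refine (hH _ _).trans (mul_le_mul_of_nonneg_left
      (Real.rpow_le_rpow (G.cc_nonneg _ _) ?_ hα) hH0)
    rw [G.cc_mul_inv]
    exact hsupp z hz
  have h1 := G.abs_potential_le_of_integral_eq_zero hkac hkas hφ hint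
    (A := H * (C * r) ^ α + H * r ^ α) (x := x) (fun z hz => by
      by_cases hz1 : k z = 0
      · have hz2 : k (G.mul z a) ≠ 0 := by
          intro h; apply hz; rw [h, hz1, sub_zero]
        have e : G.mul x (G.inv z) = G.mul x' (G.inv (G.mul z a)) := by
          rw [hx', G.inv_mul_rev, G.mul_assoc, ← G.mul_assoc a, G.mul_inv, G.zero_mul]
        have h2 := hosc x' _ hz2
        rw [← e] at h2
        have h3 : |φ x' - φ x| ≤ H * r ^ α := by
          refine (hH _ _).trans (mul_le_mul_of_nonneg_left
            (Real.rpow_le_rpow (G.cc_nonneg _ _) ?_ hα) hH0)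
          rw [G.cc_comm]; exact hd
        exact (abs_sub_le _ (φ x') _).trans (add_le_add h2 h3)
      · have h2 := hosc x z hz1
        have : 0 ≤ H * r ^ α := by positivity
        linarith)
  rw [hx', G.potential_mul_sub k φ hkc hφ hφc]
  refine h1.trans ?_
  -- the `L¹` norm of the difference of the kernels
  set V := (volume S).toReal with hV
  set I : (Fin N → ℝ) → ℝ := S.indicator fun _ => 1 with hI
  have hIi : Integrable I := (integrable_indicator_iff hS.measurableSet).2
    (integrableOn_const (hs := hS.measure_lt_top.ne))
  have hIint : ∫ z, I z = V := by
    rw [hI, integral_indicator hS.measurableSet]; simp [hV, Measure.real]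
  have hIr : ∫ z, I (G.dil r⁻¹ z) = r ^ G.Q * V := by rw [G.integral_dil_inv hr, hIint]
  have hIri : Integrable fun z => I (G.dil r⁻¹ z) := by
    have hmap := G.map_dil_volume (inv_pos.2 hr)
    refine ((G.measurableEmbedding_dil (inv_pos.2 hr)).integrable_map_iff (g := I)).1 ?_
    rw [hmap]
    exact hIi.smul_measure ENNReal.ofReal_ne_top
  have hIra : Integrable fun z => I (G.dil r⁻¹ (G.mul z a)) :=
    ((G.measurePreserving_mul_right a).integrable_comp_emb (G.measurableEmbedding_mul_right a)
      (g := fun z => I (G.dil r⁻¹ z))).2 hIri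
  set c := (r ^ G.Q)⁻¹ * ((m * M + 1) * (r⁻¹ * d)) with hc
  have hc0 : 0 ≤ c := by positivity
  have hlip : ∀ z, |k (G.mul z a) - k z| ≤ c := fun z => by
    rw [hk, rescale, rescale, ← mul_sub, abs_mul, abs_of_pos (by positivity : 0 < (r ^ G.Q)⁻¹)]
    refine mul_le_mul_of_nonneg_left ?_ (by positivity)
    refine (G.abs_sub_le_cc hK hM hYK (G.dil r⁻¹ z) (G.dil r⁻¹ (G.mul z a))).trans ?_
    refine mul_le_mul_of_nonneg_left ?_ (by positivity)
    refine (G.cc_dil_le (inv_pos.2 hr) _ _).trans (mul_le_mul_of_nonneg_left (le_of_eq ?_)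
      (by positivity))
    rw [G.cc_eq_zero_left, G.inv_mul_cancel_left, hd', G.cc_eq_zero_left x x', ha]
  have hL1 : ∫ z, |k (G.mul z a) - k z| ≤ c * (2 * (r ^ G.Q * V)) := by
    have hle : ∀ z, |k (G.mul z a) - k z| ≤
        c * (I (G.dil r⁻¹ (G.mul z a)) + I (G.dil r⁻¹ z)) := fun z => by
      have hI0 : ∀ y, 0 ≤ I y := fun y => indicator_nonneg (fun _ _ => zero_le_one) y
      have hI1 : ∀ y, k y ≠ 0 → I (G.dil r⁻¹ y) = 1 := fun y hy =>
        indicator_of_mem (hKS _ fun h => hy (by rw [hk, rescale, h, mul_zero])) _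
      by_cases hz1 : k z = 0
      · by_cases hz2 : k (G.mul z a) = 0
        · rw [hz1, hz2, sub_zero, abs_zero]
          exact mul_nonneg hc0 (add_nonneg (hI0 _) (hI0 _))
        · rw [hI1 _ hz2]
          refine (hlip z).trans (le_mul_of_one_le_right hc0 ?_)
          linarith [hI0 (G.dil r⁻¹ z)]
      · rw [hI1 _ hz1]
        refine (hlip z).trans (le_mul_of_one_le_right hc0 ?_)
        linarith [hI0 (G.dil r⁻¹ (G.mul z a))]
    refine (integral_mono (hkai.sub hki).abs ((hIra.add hIri).const_mul c) hle).trans (le_of_eq ?_)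
    rw [integral_const_mul]
    congr 1
    have e1 := integral_add hIra hIri
    rw [G.integral_mul_right a (fun z => I (G.dil r⁻¹ z)), hIr] at e1
    simp only [Pi.add_apply]
    rw [e1]; ring
  have hV0 : 0 ≤ V := ENNReal.toReal_nonneg
  have hA0 : 0 ≤ H * (C * r) ^ α + H * r ^ α := by positivity
  refine (mul_le_mul_of_nonneg_right hL1 hA0).trans (le_of_eq ?_)
  rw [hc, Real.mul_rpow hC0 hr.le, Real.rpow_sub_one hr.ne']
  field_simp

end CarnotGroup

/-! ### Derivatives along integral curves -/

/-- If `u` has the same derivative `v` along every integral curve through `x`, then this is its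
derivative along the field. -/
theorem differentiableAlong_and_derivAlong_eq {N : ℕ} {V : (Fin N → ℝ) → Fin N → ℝ}
    (hV : ContDiff ℝ 1 V) {u : (Fin N → ℝ) → ℝ} {v : ℝ} {x : Fin N → ℝ}
    (h : ∀ γ : ℝ → Fin N → ℝ, γ 0 = x → IsIntegralCurveAt γ (fun _ => V) 0 →
      HasDerivAt (fun t => u (γ t)) v 0) :
    DifferentiableAlong V u x ∧ derivAlong V u x = v := by
  obtain ⟨γ, h0, hγ⟩ := CarnotGroup.exists_integralCurve hV x
  have hd : DifferentiableAlong V u x := ⟨v, γ, h0, hγ, h γ h0 hγ⟩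
  refine ⟨hd, ?_⟩
  rw [derivAlong, dif_pos hd]
  obtain ⟨η, h1, hη, h2⟩ := hd.choose_spec
  exact h2.unique (h η h1 hη)

/-- For differentiable functions, the derivative along a field is a directional derivative. -/
theorem derivAlong_eq_fderiv {N : ℕ} {V : (Fin N → ℝ) → Fin N → ℝ}
    (hV : ContDiff ℝ 1 V) {u : (Fin N → ℝ) → ℝ} {x : Fin N → ℝ} (hu : DifferentiableAt ℝ u x) :
    derivAlong V u x = fderiv ℝ u x (V x) := by
  refine (differentiableAlong_and_derivAlong_eq hV fun γ h0 hγ => ?_).2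
  have h1 : HasDerivAt γ (V x) 0 := by simpa [h0] using hγ.self_of_nhds
  have h2 : HasFDerivAt u (fderiv ℝ u x) (γ 0) := by rw [h0]; exact hu.hasFDerivAt
  exact h2.comp_hasDerivAt 0 h1

namespace CarnotGroup

variable {N m : ℕ} (G : CarnotGroup N m)

/-! ### Iterated horizontal derivatives -/

/-- The iterated Fréchet derivative `Y_{i_1} ⋯ Y_{i_k} g`. -/
noncomputable def iterYDeriv : List (Fin m) → ((Fin N → ℝ) → ℝ) → ((Fin N → ℝ) → ℝ)
  | [], g => g
  | i :: I, g => G.YDeriv i (iterYDeriv I g)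

variable {U : Set (Fin N → ℝ)} {f g : (Fin N → ℝ) → ℝ}

theorem contDiffOn_YDeriv (hU : IsOpen U) (i : Fin m) (hg : ContDiffOn ℝ ∞ g U) :
    ContDiffOn ℝ ∞ (G.YDeriv i g) U :=
  (hg.fderiv_of_isOpen hU (by simp)).clm_apply (G.contDiff_Y i).contDiffOn

theorem contDiffOn_iterYDeriv (hU : IsOpen U) (hg : ContDiffOn ℝ ∞ g U) (I : List (Fin m)) :
    ContDiffOn ℝ ∞ (G.iterYDeriv I g) U := by
  induction I with
  | nil => exact hg
  | cons i I ih => exact G.contDiffOn_YDeriv hU i ih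

theorem YDeriv_congr (hU : IsOpen U) (i : Fin m) (h : EqOn f g U) :
    EqOn (G.YDeriv i f) (G.YDeriv i g) U := fun x hx => by
  rw [YDeriv, YDeriv, (h.eventuallyEq_of_mem (hU.mem_nhds hx)).fderiv_eq]

theorem iterYDeriv_congr (hU : IsOpen U) (h : EqOn f g U) (I : List (Fin m)) :
    EqOn (G.iterYDeriv I f) (G.iterYDeriv I g) U := by
  induction I with
  | nil => exact h
  | cons i I ih => exact G.YDeriv_congr hU i ih

/-- The innermost derivative is the last letter of the word. -/
theorem iterYDeriv_concat (I : List (Fin m)) (i : Fin m) (g : (Fin N → ℝ) → ℝ) :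
    G.iterYDeriv (I ++ [i]) g = G.iterYDeriv I (G.YDeriv i g) := by
  induction I with
  | nil => rfl
  | cons j I ih => rw [List.cons_append, iterYDeriv, ih, iterYDeriv]

theorem iterYDeriv_add (hU : IsOpen U) (hf : ContDiffOn ℝ ∞ f U) (hg : ContDiffOn ℝ ∞ g U)
    (I : List (Fin m)) :
    EqOn (G.iterYDeriv I fun x => f x + g x)
      (fun x => G.iterYDeriv I f x + G.iterYDeriv I g x) U := by
  induction I with
  | nil => exact fun x _ => rfl
  | cons i I ih =>
    intro x hx
    have hd : ∀ {h : (Fin N → ℝ) → ℝ}, ContDiffOn ℝ ∞ h U → DifferentiableAt ℝ h x := fun h =>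
      (h.differentiableOn (by simp)).differentiableAt (hU.mem_nhds hx)
    rw [iterYDeriv, G.YDeriv_congr hU i ih hx, YDeriv,
      fderiv_fun_add (hd (G.contDiffOn_iterYDeriv hU hf I))
        (hd (G.contDiffOn_iterYDeriv hU hg I))]
    rfl

theorem YDeriv_mul (hU : IsOpen U) (hf : ContDiffOn ℝ ∞ f U) (hg : ContDiffOn ℝ ∞ g U)
    (i : Fin m) :
    EqOn (G.YDeriv i fun x => f x * g x) (fun x => G.YDeriv i f x * g x + f x * G.YDeriv i g x)
      U := fun x hx => by
  have hd : ∀ {h : (Fin N → ℝ) → ℝ}, ContDiffOn ℝ ∞ h U → DifferentiableAt ℝ h x := fun h =>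
    (h.differentiableOn (by simp)).differentiableAt (hU.mem_nhds hx)
  rw [YDeriv, fderiv_fun_mul (hd hf) (hd hg)]
  simp only [YDeriv, add_apply, smul_apply, smul_eq_mul]
  ring

/-- Leibniz' rule, as a bound. -/
theorem abs_iterYDeriv_mul_le (hU : IsOpen U) {A B : ℝ} {x : Fin N → ℝ} (hx : x ∈ U) {k : ℕ} :
    ∀ {f g : (Fin N → ℝ) → ℝ}, ContDiffOn ℝ ∞ f U → ContDiffOn ℝ ∞ g U →
    (∀ I : List (Fin m), I.length ≤ k → |G.iterYDeriv I f x| ≤ A) →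
    (∀ I : List (Fin m), I.length ≤ k → |G.iterYDeriv I g x| ≤ B) →
    ∀ I : List (Fin m), I.length ≤ k →
      |G.iterYDeriv I (fun x => f x * g x) x| ≤ 2 ^ k * (A * B) := by
  induction k with
  | zero =>
    intro f g hf hg hA hB I hI
    have hI0 : I = [] := List.length_eq_zero_iff.1 (by lia)
    subst hI0
    have h1 := hA [] le_rfl
    have h2 := hB [] le_rfl
    simp only [iterYDeriv] at h1 h2 ⊢
    rw [abs_mul, pow_zero, one_mul]
    exact mul_le_mul h1 h2 (abs_nonneg _) ((abs_nonneg _).trans h1)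
  | succ k ih =>
    intro f g hf hg hA hB I hI
    have hA0 : 0 ≤ A := (abs_nonneg _).trans (hA [] (by simp))
    have hB0 : 0 ≤ B := (abs_nonneg _).trans (hB [] (by simp))
    rcases I.eq_nil_or_concat with rfl | ⟨J, i, rfl⟩
    · refine (ih hf hg (fun I hI => hA I (by lia)) (fun I hI => hB I (by lia)) []
        (by simp)).trans ?_
      rw [pow_succ]
      nlinarith [mul_nonneg (pow_nonneg (zero_le_two (α := ℝ)) k) (mul_nonneg hA0 hB0)]
    · have hJ : J.length ≤ k := by simpa using hI
      have hf' := G.contDiffOn_YDeriv hU i hf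
      have hg' := G.contDiffOn_YDeriv hU i hg
      have hA' : ∀ I : List (Fin m), I.length ≤ k →
          |G.iterYDeriv I (G.YDeriv i f) x| ≤ A := fun I hI => by
        rw [← iterYDeriv_concat]; exact hA _ (by simpa using hI)
      have hB' : ∀ I : List (Fin m), I.length ≤ k →
          |G.iterYDeriv I (G.YDeriv i g) x| ≤ B := fun I hI => by
        rw [← iterYDeriv_concat]; exact hB _ (by simpa using hI)
      rw [List.concat_eq_append, iterYDeriv_concat,
        G.iterYDeriv_congr hU (G.YDeriv_mul hU hf hg i) J hx,
        G.iterYDeriv_add hU (hf'.mul hg) (hf.mul hg') J hx]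
      have h1 := ih hf' hg hA' (fun I hI => hB I (by lia)) J hJ
      have h2 := ih hf hg' (fun I hI => hA I (by lia)) hB' J hJ
      refine (abs_add_le _ _).trans ((add_le_add h1 h2).trans (le_of_eq ?_))
      rw [pow_succ]; ring

theorem tsupport_YDeriv_subset (i : Fin m) (g : (Fin N → ℝ) → ℝ) :
    tsupport (G.YDeriv i g) ⊆ tsupport g := by
  refine closure_minimal (fun x hx => ?_) (isClosed_tsupport g)
  exact support_fderiv_subset ℝ (f := g) fun h => hx (by simp [YDeriv, h])

theorem tsupport_iterYDeriv_subset (I : List (Fin m)) (g : (Fin N → ℝ) → ℝ) :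
    tsupport (G.iterYDeriv I g) ⊆ tsupport g := by
  induction I with
  | nil => exact subset_rfl
  | cons i I ih => exact (G.tsupport_YDeriv_subset i _).trans ih

theorem contDiff_iterYDeriv (hg : ContDiff ℝ ∞ g) (I : List (Fin m)) :
    ContDiff ℝ ∞ (G.iterYDeriv I g) := by
  rw [← contDiffOn_univ] at hg ⊢
  exact G.contDiffOn_iterYDeriv isOpen_univ hg I

/-- Families indexed by words of bounded length are finite, so pointwise bounds are uniform. -/
theorem exists_bound_of_length_le {F : List (Fin m) → (Fin N → ℝ) → ℝ} {T : Set (Fin N → ℝ)}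
    (k : ℕ) (h : ∀ I, ∃ C, ∀ x ∈ T, |F I x| ≤ C) :
    ∃ C : ℝ, 0 ≤ C ∧ ∀ I : List (Fin m), I.length ≤ k → ∀ x ∈ T, |F I x| ≤ C := by
  choose C hC using h
  obtain ⟨D, hD⟩ := ((List.finite_length_le (Fin m) k).image C).bddAbove
  exact ⟨max D 0, le_max_right _ _, fun I hI x hx =>
    (hC I x hx).trans ((hD ⟨I, hI, rfl⟩).trans (le_max_left _ _))⟩

theorem iterDeriv_eq_iterYDeriv (hU : IsOpen U) (hf : ContDiffOn ℝ ∞ f U) (I : List (Fin m)) :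
    EqOn (G.iterDeriv I f) (G.iterYDeriv I f) U := by
  induction I with
  | nil => exact fun x _ => rfl
  | cons i I ih =>
    intro x hx
    have hev := ih.eventuallyEq_of_mem (hU.mem_nhds hx)
    have hd : DifferentiableAt ℝ (G.iterYDeriv I f) x :=
      ((G.contDiffOn_iterYDeriv hU hf I).differentiableOn (by simp)).differentiableAt
        (hU.mem_nhds hx)
    rw [iterDeriv, derivAlong_eq_fderiv ((G.contDiff_Y i).of_le (by exact_mod_cast le_top))
      (hd.congr_of_eventuallyEq hev), hev.fderiv_eq]
    rfl

/-- A horizontal derivative of order `k` of a homogeneous function of degree `-n` is homogeneous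
of degree `-(n + k)`. -/
theorem iterYDeriv_homogeneous (hf : ContDiffOn ℝ ∞ f {0}ᶜ) {n : ℕ}
    (h : ∀ r : ℝ, 0 < r → ∀ x, x ≠ 0 → r ^ n * f (G.dil r x) = f x) (I : List (Fin m)) {r : ℝ}
    (hr : 0 < r) : ∀ x, x ≠ 0 →
      r ^ (n + I.length) * G.iterYDeriv I f (G.dil r x) = G.iterYDeriv I f x := by
  induction I with
  | nil => exact h r hr
  | cons i I ih =>
    intro x hx
    have hU : IsOpen ({0}ᶜ : Set (Fin N → ℝ)) := isOpen_compl_singleton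
    have hd : DifferentiableAt ℝ (G.iterYDeriv I f) (G.dil r x) :=
      ((G.contDiffOn_iterYDeriv hU hf I).differentiableOn (by simp)).differentiableAt
        (hU.mem_nhds (G.dil_ne_zero hr hx))
    have h1 := G.YDeriv_dil i hr (r ^ (n + I.length)) hd
    rw [G.YDeriv_congr hU i (fun z hz => ih z hz) hx] at h1
    rw [iterYDeriv, h1, List.length_cons, ← add_assoc, pow_succ]

/-! ### The homogeneous norm -/

theorem topWeight_div_pos (i : Fin N) :
    0 < 2 * (G.topWeight.factorial : ℝ) / (G.σ i : ℝ) := by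
  have h1 : (0 : ℝ) < G.σ i := by exact_mod_cast G.one_le_σ i
  have h2 : (0 : ℝ) < G.topWeight.factorial := by exact_mod_cast Nat.factorial_pos _
  positivity

theorem continuous_hnorm : Continuous G.hnorm := by
  unfold hnorm
  refine Continuous.rpow_const (continuous_finsetSum _ fun i _ => ?_)
    fun x => Or.inr (by positivity)
  exact (continuous_apply i).abs.rpow_const fun x => Or.inr (G.topWeight_div_pos i).le

theorem hnorm_zero : G.hnorm 0 = 0 := by
  have h2 : (0 : ℝ) < G.topWeight.factorial := by exact_mod_cast Nat.factorial_pos _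
  have h : ∀ i, |(0 : Fin N → ℝ) i| ^ (2 * (G.topWeight.factorial : ℝ) / (G.σ i : ℝ)) = 0 :=
    fun i => by simp [Real.zero_rpow (G.topWeight_div_pos i).ne']
  rw [hnorm, Finset.sum_eq_zero fun i _ => h i, Real.zero_rpow (by positivity)]

theorem hnorm_pos {x : Fin N → ℝ} (hx : x ≠ 0) : 0 < G.hnorm x := by
  obtain ⟨i, hi⟩ := Function.ne_iff.1 hx
  refine Real.rpow_pos_of_pos (Finset.sum_pos' (fun i _ => by positivity)
    ⟨i, Finset.mem_univ i, Real.rpow_pos_of_pos (abs_pos.2 hi) _⟩) _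

theorem hnorm_dil {r : ℝ} (hr : 0 < r) (x : Fin N → ℝ) :
    G.hnorm (G.dil r x) = r * G.hnorm x := by
  have h2 : (0 : ℝ) < G.topWeight.factorial := by exact_mod_cast Nat.factorial_pos _
  have h : ∀ i, |G.dil r x i| ^ (2 * (G.topWeight.factorial : ℝ) / (G.σ i : ℝ)) =
      r ^ (2 * (G.topWeight.factorial : ℝ)) *
        |x i| ^ (2 * (G.topWeight.factorial : ℝ) / (G.σ i : ℝ)) := fun i => by
    have h1 : (0 : ℝ) < G.σ i := by exact_mod_cast G.one_le_σ i
    rw [dil_apply, abs_mul, abs_of_pos (by positivity : 0 < r ^ G.σ i),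
      Real.mul_rpow (by positivity) (abs_nonneg _), ← Real.rpow_natCast r, ← Real.rpow_mul hr.le]
    congr 2
    field_simp
  rw [hnorm, Finset.sum_congr rfl fun i _ => h i, ← Finset.mul_sum,
    Real.mul_rpow (by positivity) (Finset.sum_nonneg fun i _ => by positivity),
    ← Real.rpow_mul hr.le, mul_one_div_cancel (by positivity), Real.rpow_one, hnorm]

/-- On the unit ball of the homogeneous norm every summand of the norm is at most one. -/
theorem norm_le_one_of_hnorm_le_one {x : Fin N → ℝ} (hx : G.hnorm x ≤ 1) : ‖x‖ ≤ 1 := by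
  refine (pi_norm_le_iff_of_nonneg zero_le_one).2 fun i => ?_
  by_contra! hlt
  rw [Real.norm_eq_abs] at hlt
  have h2 : (0 : ℝ) < G.topWeight.factorial := by exact_mod_cast Nat.factorial_pos _
  have h1 : 1 < ∑ i, |x i| ^ (2 * (G.topWeight.factorial : ℝ) / (G.σ i : ℝ)) :=
    (Real.one_lt_rpow hlt (G.topWeight_div_pos i)).trans_le
      (Finset.single_le_sum (f := fun i => |x i| ^ (2 * (G.topWeight.factorial : ℝ) / (G.σ i : ℝ)))
        (fun i _ => by positivity) (Finset.mem_univ i))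
  exact absurd hx (not_le.2 (Real.one_lt_rpow h1 (by positivity)))

theorem isCompact_hnorm_le_one : IsCompact {x | G.hnorm x ≤ 1} :=
  (isCompact_closedBall (0 : Fin N → ℝ) 1).of_isClosed_subset
    (isClosed_le G.continuous_hnorm continuous_const)
    fun x hx => by simpa using G.norm_le_one_of_hnorm_le_one hx

theorem exists_hnorm_eq_one {x : Fin N → ℝ} (hx : x ≠ 0) :
    G.hnorm (G.dil (G.hnorm x)⁻¹ x) = 1 := by
  rw [G.hnorm_dil (inv_pos.2 (G.hnorm_pos hx)), inv_mul_cancel₀ (G.hnorm_pos hx).ne']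

/-! ### The constant `Θ` -/

/-- Off the origin `f` is smooth, so the derivatives in the definition of `Θ` are Fréchet
derivatives. -/
theorem abs_iterYDeriv_le_Theta (hf : ContDiffOn ℝ ∞ f {0}ᶜ) {k : ℕ} (hΘ : G.Theta f k ≠ ⊤)
    {I : List (Fin m)} (hI : I.length ≤ k) {w : Fin N → ℝ} (hw : G.hnorm w = 1) :
    |G.iterYDeriv I f w| ≤ (G.Theta f k).toReal := by
  have hw0 : w ≠ 0 := by rintro rfl; rw [G.hnorm_zero] at hw; exact zero_ne_one hw
  have h : ‖G.iterDeriv I f w‖ₑ ≤ G.Theta f k := by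
    unfold Theta
    exact le_iSup₂_of_le I hI (le_iSup₂_of_le w hw le_rfl)
  rw [G.iterDeriv_eq_iterYDeriv isOpen_compl_singleton hf I hw0] at h
  have h2 := ENNReal.toReal_mono hΘ h
  simpa using h2

/-- The unit sphere of the homogeneous norm is compact and avoids the origin. -/
theorem Theta_ne_top (hf : ContDiffOn ℝ ∞ f {0}ᶜ) (k : ℕ) : G.Theta f k ≠ ⊤ := by
  have hcomp : IsCompact {w | G.hnorm w = 1} :=
    G.isCompact_hnorm_le_one.of_isClosed_subset
      (isClosed_eq G.continuous_hnorm continuous_const) fun x hx => le_of_eq hx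
  have hne : ∀ w : Fin N → ℝ, G.hnorm w = 1 → w ∈ ({0}ᶜ : Set (Fin N → ℝ)) := by
    rintro w hw rfl; rw [G.hnorm_zero] at hw; exact zero_ne_one hw
  obtain ⟨C, -, hC⟩ := exists_bound_of_length_le (F := fun I => G.iterYDeriv I f)
    (T := {w | G.hnorm w = 1}) k fun I =>
      hcomp.exists_bound_of_continuousOn
        ((G.contDiffOn_iterYDeriv isOpen_compl_singleton hf I).continuousOn.mono hne)
  refine ne_top_of_le_ne_top (ENNReal.ofReal_ne_top (r := C)) ?_
  unfold Theta
  refine iSup₂_le fun I hI => iSup₂_le fun w hw => ?_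
  rw [G.iterDeriv_eq_iterYDeriv isOpen_compl_singleton hf I (hne w hw),
    Real.enorm_eq_ofReal_abs]
  exact ENNReal.ofReal_le_ofReal (hC I hI w hw)

/-- The horizontal derivatives of the cut-off kernel `f ψ` are controlled by `Θ`. -/
theorem exists_bound_iterYDeriv_mul {ψ : (Fin N → ℝ) → ℝ} (hψ : ContDiff ℝ ∞ ψ)
    (hψc : HasCompactSupport ψ) (hψ0 : (0 : Fin N → ℝ) ∉ tsupport ψ) (n k : ℕ) :
    ∃ C : ℝ, 0 ≤ C ∧ ∀ f : (Fin N → ℝ) → ℝ, ContDiffOn ℝ ∞ f {0}ᶜ →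
      (∀ r : ℝ, 0 < r → ∀ x, x ≠ 0 → r ^ n * f (G.dil r x) = f x) →
      ∀ I : List (Fin m), I.length ≤ k → ∀ x,
        |G.iterYDeriv I (fun x => f x * ψ x) x| ≤ C * (G.Theta f k).toReal := by
  obtain ⟨B, hB0, hB⟩ := exists_bound_of_length_le (F := fun I => G.iterYDeriv I ψ)
    (T := univ) k fun I => by
      have hc : HasCompactSupport (G.iterYDeriv I ψ) :=
        IsCompact.of_isClosed_subset hψc (isClosed_tsupport _) (G.tsupport_iterYDeriv_subset I ψ)
      obtain ⟨C, hC⟩ := hc.exists_bound_of_continuous (G.contDiff_iterYDeriv hψ I).continuous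
      exact ⟨C, fun x _ => hC x⟩
  obtain ⟨ρ, hρ0, hρ1, hρ⟩ : ∃ ρ : ℝ, 0 < ρ ∧ ρ ≤ 1 ∧ ∀ x ∈ tsupport ψ, ρ ≤ G.hnorm x := by
    rcases (tsupport ψ).eq_empty_or_nonempty with h | h
    · exact ⟨1, one_pos, le_rfl, by simp [h]⟩
    · obtain ⟨x, hx, hmin⟩ := hψc.isCompact.exists_isMinOn h G.continuous_hnorm.continuousOn
      refine ⟨min (G.hnorm x) 1, lt_min (G.hnorm_pos ?_) one_pos, min_le_right _ _,
        fun y hy => (min_le_left _ _).trans (hmin hy)⟩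
      rintro rfl; exact hψ0 hx
  refine ⟨2 ^ k * ((ρ ^ (n + k))⁻¹ * B), by positivity, fun f hf hhom I hI x => ?_⟩
  have hΘ0 : 0 ≤ (G.Theta f k).toReal := ENNReal.toReal_nonneg
  by_cases hx : x ∈ tsupport ψ
  · have hx0 : x ≠ 0 := by rintro rfl; exact hψ0 hx
    have hA : ∀ I : List (Fin m), I.length ≤ k →
        |G.iterYDeriv I f x| ≤ (ρ ^ (n + k))⁻¹ * (G.Theta f k).toReal := fun I hI => by
      have hpos := G.hnorm_pos hx0
      have h1 := G.iterYDeriv_homogeneous hf hhom I (inv_pos.2 hpos) x hx0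
      have h2 := G.abs_iterYDeriv_le_Theta hf (G.Theta_ne_top hf k) hI (G.exists_hnorm_eq_one hx0)
      rw [← h1, abs_mul, abs_of_pos (by positivity)]
      refine mul_le_mul ?_ h2 (abs_nonneg _) (by positivity)
      rw [inv_pow]
      refine inv_anti₀ (by positivity) ?_
      calc ρ ^ (n + k) ≤ ρ ^ (n + I.length) :=
            pow_le_pow_of_le_one hρ0.le hρ1 (by lia)
        _ ≤ _ := pow_le_pow_left₀ hρ0.le (hρ x hx) _
    have := G.abs_iterYDeriv_mul_le isOpen_compl_singleton (x := x) hx0 hf hψ.contDiffOn hA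
      (fun I hI => hB I hI x (mem_univ x)) I hI
    refine this.trans (le_of_eq ?_)
    ring
  · have h1 : x ∉ tsupport fun x => f x * ψ x := fun h => hx (tsupport_mul_subset_right h)
    rw [image_eq_zero_of_notMem_tsupport fun h => h1 (G.tsupport_iterYDeriv_subset I _ h),
      abs_zero]
    positivity

end CarnotGroup

namespace CarnotGroup

variable {N m : ℕ} {G : CarnotGroup N m}

/-! ### Dyadic decomposition of a homogeneous kernel -/

variable (G) in
/-- A smooth cut-off function supported away from the origin, whose dyadic dilates form a partition
of unity. -/
theorem exists_dyadic_cutoff : ∃ ψ : (Fin N → ℝ) → ℝ, ContDiff ℝ ∞ ψ ∧ HasCompactSupport ψ ∧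
    (0 : Fin N → ℝ) ∉ tsupport ψ ∧
    ∀ z, z ≠ 0 → HasSum (fun j : ℤ => ψ (G.dil ((2 : ℝ) ^ (-j))⁻¹ z)) 1 := by
  let χ : ContDiffBump (0 : Fin N → ℝ) := ⟨1, 2, one_pos, one_lt_two⟩
  have hχ : ContDiff ℝ ∞ χ := χ.contDiff
  refine ⟨fun z => χ z - χ (G.dil 2 z), hχ.sub (hχ.comp (G.contDiff_dil 2)), ?_, ?_, ?_⟩
  · refine χ.hasCompactSupport.sub ?_
    have h := hasCompactSupport_rescale (G := G) 0 (inv_pos.2 two_pos) χ.hasCompactSupport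
    have e : G.rescale 0 (2 : ℝ)⁻¹ χ = fun z => χ (G.dil 2 z) := by
      ext1 z; simp [rescale]
    rwa [e] at h
  · rw [notMem_tsupport_iff_eventuallyEq]
    have h1 := χ.eventuallyEq_one
    have h2 : Tendsto (G.dil 2) (𝓝 0) (𝓝 0) := by
      simpa using (G.contDiff_dil 2).continuous.tendsto 0
    filter_upwards [h1, h2.eventually h1] with z hz1 hz2
    simp [hz1, hz2]
  · intro z hz
    obtain ⟨i, hi⟩ := Function.ne_iff.1 hz
    have hzi : 0 < |z i| := abs_pos.2 hi
    obtain ⟨J₁, hJ₁⟩ := exists_nat_ge (2 / |z i|)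
    obtain ⟨J₂, hJ₂⟩ := exists_nat_ge ‖z‖
    have hlt : ∀ n : ℕ, (n : ℝ) ≤ 2 ^ n := fun n => by exact_mod_cast Nat.lt_two_pow_self.le
    have h := hasSum_telescope (a := fun j : ℤ => χ (G.dil ((2 : ℝ) ^ j) z)) (J := max J₁ J₂)
      (fun n hn => χ.zero_of_le_dist ?_) (fun n hn => χ.one_of_mem_closedBall ?_)
    · refine h.congr_fun fun j => ?_
      simp only [zpow_neg, inv_inv, dil_dil]
      rw [zpow_add_one₀ two_ne_zero, mul_comm (2 : ℝ)]
    · rw [dist_zero_right, zpow_natCast]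
      refine le_trans ?_ (norm_le_pi_norm _ i)
      rw [dil_apply, Real.norm_eq_abs, abs_mul, abs_of_pos (by positivity)]
      have h1 : (2 : ℝ) ^ n ≤ ((2 : ℝ) ^ n) ^ G.σ i :=
        le_self_pow₀ (one_le_pow₀ one_le_two) (by have := G.one_le_σ i; lia)
      have h2 : 2 / |z i| ≤ ((2 : ℝ) ^ n) ^ G.σ i := by
        refine hJ₁.trans (le_trans ?_ ((hlt n).trans h1))
        exact_mod_cast (le_max_left _ _).trans hn
      exact (div_le_iff₀ hzi).1 h2
    · rw [mem_closedBall_zero_iff]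
      refine (pi_norm_le_iff_of_nonneg zero_le_one).2 fun i => ?_
      rw [dil_apply, Real.norm_eq_abs, abs_mul, abs_of_pos (by positivity), zpow_neg, zpow_natCast]
      have h1 : (((2 : ℝ) ^ n)⁻¹) ^ G.σ i ≤ ((2 : ℝ) ^ n)⁻¹ :=
        pow_le_of_le_one (by positivity) (inv_le_one_of_one_le₀ (one_le_pow₀ one_le_two))
          (by have := G.one_le_σ i; lia)
      have h2 : |z i| ≤ 2 ^ n := by
        refine (norm_le_pi_norm z i).trans (hJ₂.trans (le_trans ?_ (hlt n)))
        exact_mod_cast (le_max_right _ _).trans hn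
      calc _ ≤ ((2 : ℝ) ^ n)⁻¹ * 2 ^ n := by gcongr
        _ = 1 := inv_mul_cancel₀ (by positivity)

/-- By homogeneity, a homogeneous function is the sum of the rescalings of its product with the
cut-off function. -/
theorem hasSum_rescale_mul_cutoff {f ψ : (Fin N → ℝ) → ℝ} {n : ℕ}
    (hhom : ∀ r : ℝ, 0 < r → ∀ x, x ≠ 0 → r ^ n * f (G.dil r x) = f x)
    {z : Fin N → ℝ} (hz : z ≠ 0)
    (hψ : HasSum (fun j : ℤ => ψ (G.dil ((2 : ℝ) ^ (-j))⁻¹ z)) 1) :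
    HasSum (fun j : ℤ => G.rescale n ((2 : ℝ) ^ (-j)) (fun z => f z * ψ z) z) (f z) := by
  have h := hψ.mul_left (f z)
  rw [mul_one] at h
  refine h.congr_fun fun j => ?_
  rw [rescale, ← mul_assoc, ← inv_pow, hhom _ (by positivity) z hz]

/-- The cut-off removes the singularity at the origin. -/
theorem contDiff_mul_cutoff {f ψ : (Fin N → ℝ) → ℝ} (hf : ContDiffOn ℝ ∞ f {0}ᶜ)
    (hψ : ContDiff ℝ ∞ ψ) (hψ0 : (0 : Fin N → ℝ) ∉ tsupport ψ) :
    ContDiff ℝ ∞ fun z => f z * ψ z := by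
  refine contDiff_iff_contDiffAt.2 fun x => ?_
  by_cases hx : x = 0
  · subst hx
    rw [notMem_tsupport_iff_eventuallyEq] at hψ0
    refine (contDiffAt_const (c := (0 : ℝ))).congr_of_eventuallyEq ?_
    filter_upwards [hψ0] with z hz
    simp [hz]
  · exact (hf.contDiffAt (isOpen_compl_singleton.mem_nhds hx)).mul hψ.contDiffAt

/-- The potential of a kernel which is the sum of the dyadic rescalings of `F` is the sum of the
potentials of these, provided that the homogeneity is integrable at the origin. -/
theorem integrable_and_hasSum_potential {f F φ : (Fin N → ℝ) → ℝ} {n : ℕ} (hn1 : 1 ≤ n)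
    (hn : n < G.Q) (hf : ContinuousOn f {0}ᶜ) (hF : Continuous F) (hFc : HasCompactSupport F)
    (hsum : ∀ z, z ≠ 0 → HasSum (fun j : ℤ => G.rescale n ((2 : ℝ) ^ (-j)) F z) (f z))
    (hφ : Continuous φ) (hφc : HasCompactSupport φ) (x : Fin N → ℝ) :
    Integrable (fun y => f (G.mul (G.inv y) x) * φ y) ∧
      HasSum (fun j : ℤ => G.potential (G.rescale n ((2 : ℝ) ^ (-j)) F) φ x)
        (G.potential f φ x) := by
  have hN : Nonempty (Fin N) := by
    -- otherwise `Q = 0`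
    by_contra h
    rw [not_nonempty_iff] at h
    have : G.Q = 0 := by simp [Q]
    lia
  have hf0 : AEStronglyMeasurable f := by
    have h1 : AEStronglyMeasurable f (volume.restrict {0}ᶜ) :=
      hf.aestronglyMeasurable (measurableSet_singleton 0).compl
    rwa [restrict_compl_singleton] at h1
  have hmp := G.measurePreserving_inv_mul x
  have hne : ∀ᵐ z : Fin N → ℝ, z ≠ 0 := by simp [ae_iff]
  have hr : ∀ j : ℤ, (0 : ℝ) < 2 ^ (-j) := fun j => by positivity
  refine integrable_and_hasSum_integral
    ((hf0.comp_measurePreserving hmp).mul hφ.aestronglyMeasurable)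
    (fun j => G.integrable_potential (continuous_rescale n _ hF) hφ hφc x) ?_ ?_
  · obtain ⟨C, hC⟩ := exists_bound_potential_rescale hn1 hn le_rfl hF.abs (K := fun z => |F z|)
      (φ := fun z => |φ z|) (hFc.comp_left abs_zero) hφ.abs (hφc.comp_left abs_zero)
    refine Summable.of_norm_bounded ((summable_pow_natAbs (κ := (2 : ℝ) ^ (-(1 : ℝ)))
      (by positivity) (two_rpow_neg_lt_one one_pos)).mul_left C) fun j => ?_
    refine le_trans (le_of_eq ?_) (hC j x)
    rw [potential, Real.norm_eq_abs]
    congr 1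
    refine integral_congr_ae (Eventually.of_forall fun y => ?_)
    simp only [Real.norm_eq_abs, abs_mul]
    rw [abs_rescale n (hr j)]
  · filter_upwards [hmp.quasiMeasurePreserving.ae hne] with y hy
    exact (hsum _ hy).mul_right (φ y)

/-- Termwise differentiation of a series of potentials of dyadic pieces. -/
theorem derivAlong_potential_series {K φ : (Fin N → ℝ) → ℝ} {n : ℕ} (i : Fin m)
    (hK : ContDiff ℝ ∞ K) (hKc : HasCompactSupport K) (hφ : Continuous φ)
    (hφc : HasCompactSupport φ) {u : (Fin N → ℝ) → ℝ}
    (hu : ∀ x, HasSum (fun j : ℤ => G.potential (G.rescale n ((2 : ℝ) ^ (-j)) K) φ x) (u x))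
    {b : ℤ → ℝ} (hb : Summable b)
    (hbd : ∀ (j : ℤ) x,
      |G.potential (G.rescale (n + 1) ((2 : ℝ) ^ (-j)) (G.YDeriv i K)) φ x| ≤ b j) :
    ∀ x, DifferentiableAlong (G.Y i) u x ∧
      HasSum (fun j : ℤ => G.potential (G.rescale (n + 1) ((2 : ℝ) ^ (-j)) (G.YDeriv i K)) φ x)
        (derivAlong (G.Y i) u x) := by
  intro x
  have key := differentiableAlong_and_derivAlong_eq (u := u) (x := x)
    (v := ∑' j : ℤ, G.potential (G.rescale (n + 1) ((2 : ℝ) ^ (-j)) (G.YDeriv i K)) φ x)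
    ((G.contDiff_Y i).of_le (by exact_mod_cast le_top)) fun γ h0 hγ => by
      obtain ⟨ε, hε, hγε⟩ := Metric.eventually_nhds_iff_ball.1 (eventually_eventually_nhds.2 hγ)
      have e : (fun t => u (γ t)) = fun t =>
          ∑' j : ℤ, G.potential (G.rescale n ((2 : ℝ) ^ (-j)) K) φ (γ t) :=
        funext fun t => (hu (γ t)).tsum_eq.symm
      rw [e]
      have h0' : (0 : ℝ) ∈ Metric.ball (0 : ℝ) ε := Metric.mem_ball_self hε
      have := hasDerivAt_tsum_of_isPreconnected (t := Metric.ball (0 : ℝ) ε) (y₀ := 0) (y := 0)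
        (g := fun (j : ℤ) t => G.potential (G.rescale n ((2 : ℝ) ^ (-j)) K) φ (γ t))
        (g' := fun (j : ℤ) t =>
          G.potential (G.rescale (n + 1) ((2 : ℝ) ^ (-j)) (G.YDeriv i K)) φ (γ t))
        hb Metric.isOpen_ball (convex_ball _ _).isPreconnected
        (fun j t ht => by
          have hr : (0 : ℝ) < 2 ^ (-j) := by positivity
          have := G.hasDerivAt_potential i (contDiff_rescale (G := G) n _ hK)
            (hasCompactSupport_rescale n hr hKc) hφ hφc (hγε t ht)
          rwa [YDeriv_rescale i n hr hK] at this)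
        (fun j t _ => hbd j _) h0' (hu _).summable h0'
      rwa [h0] at this
  refine ⟨key.1, ?_⟩
  rw [key.2]
  exact (Summable.of_norm_bounded hb fun j => hbd j x).hasSum

/-! ### Estimates for the sum of the dyadic potentials -/

theorem integral_abs_le_of_forall_notMem_eq_zero {X : Type*} [MeasurableSpace X] {μ : Measure X}
    {g : X → ℝ} {E : Set X} (hE : μ E < ⊤) (h0 : ∀ z, z ∉ E → g z = 0) {A : ℝ}
    (hA : ∀ z, |g z| ≤ A) : ∫ z, |g z| ∂μ ≤ A * (μ E).toReal := by
  rw [← setIntegral_eq_integral_of_forall_compl_eq_zero (s := E)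
    fun z hz => by rw [h0 z hz, abs_zero]]
  refine (le_abs_self _).trans ?_
  rw [← Real.norm_eq_abs]
  exact norm_setIntegral_le_of_norm_le_const hE fun z _ => by simpa using hA z

section Series

variable {K φ u : (Fin N → ℝ) → ℝ} {α H C M : ℝ} {S : Set (Fin N → ℝ)}

/-- Boundedness of the sum of the dyadic potentials. -/
theorem abs_le_of_hasSum_potential (hQ : 1 ≤ G.Q) (hα0 : 0 < α) (hα1 : α ≤ 1)
    (hK : Continuous K) (hKc : HasCompactSupport K) (h0 : ∫ z, K z = 0)
    (hφ : Continuous φ) (hφc : HasCompactSupport φ)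
    (hH0 : 0 ≤ H) (hH : ∀ x y, |φ x - φ y| ≤ H * G.cc x y ^ α) (hC0 : 0 ≤ C)
    (hS : IsCompact S) (hKS : ∀ z, K z ≠ 0 → z ∈ S) (hC : ∀ z ∈ S, G.cc 0 z ≤ C)
    (hM : ∀ z, |K z| ≤ M)
    (hu : ∀ x, HasSum (fun j : ℤ => G.potential (G.rescale G.Q ((2 : ℝ) ^ (-j)) K) φ x) (u x))
    (x : Fin N → ℝ) :
    |u x| ≤ (M * (volume S).toReal * (H * C ^ α) + M * ∫ y, |φ y|) *
      ∑' j : ℤ, ((2 : ℝ) ^ (-α)) ^ j.natAbs := by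
  have hs := summable_pow_natAbs (κ := (2 : ℝ) ^ (-α)) (by positivity) (two_rpow_neg_lt_one hα0)
  have hI := integral_abs_le_of_forall_notMem_eq_zero (μ := volume) hS.measure_lt_top
    (fun z hz => by_contra fun h => hz (hKS z h)) hM
  rw [← tsum_mul_left, ← Real.norm_eq_abs]
  refine (hu x).norm_le_of_bounded (hs.mul_left _).hasSum fun j => ?_
  refine (abs_potential_rescale_Q_le hQ hα0 hα1 hK hKc h0 hφ hφc hH0 hH hC0
    (fun z hz => hC z (hKS z hz)) hM j x).trans ?_
  have := Real.rpow_nonneg hC0 α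
  gcongr

/-- Hölder continuity of the sum of the dyadic potentials: at distance `d`, the regularity of the
kernel is used for the pieces of size at least `d`, and its cancellation for the smaller ones. -/
theorem abs_sub_le_of_hasSum_potential (hα0 : 0 < α) (hα1 : α < 1)
    (hK : ContDiff ℝ ∞ K) (hKc : HasCompactSupport K) (h0 : ∫ z, K z = 0)
    (hφ : Continuous φ) (hφc : HasCompactSupport φ)
    (hH0 : 0 ≤ H) (hH : ∀ x y, |φ x - φ y| ≤ H * G.cc x y ^ α) (hC0 : 0 ≤ C)
    (hS : IsCompact S) (hKS : ∀ z, K z ≠ 0 → z ∈ S) (hC : ∀ z ∈ S, G.cc 0 z ≤ C)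
    (hM0 : 0 ≤ M) (hM : ∀ z, |K z| ≤ M) (hYM : ∀ i z, |G.YDeriv i K z| ≤ M)
    (hu : ∀ x, HasSum (fun j : ℤ => G.potential (G.rescale G.Q ((2 : ℝ) ^ (-j)) K) φ x) (u x))
    (x x' : Fin N → ℝ) :
    |u x - u x'| ≤ (2 * (volume S).toReal * (m * M + 1) * (C ^ α + 1) +
        4 * (M * (volume S).toReal * C ^ α)) * H * G.cc x x' ^ α *
      ∑' j : ℤ, (max ((2 : ℝ) ^ (-α)) ((2 : ℝ) ^ (-(1 - α)))) ^ j.natAbs := by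
  set ρ := max ((2 : ℝ) ^ (-α)) ((2 : ℝ) ^ (-(1 - α))) with hρ
  set V := (volume S).toReal with hV
  set d := G.cc x x' with hd
  have hd0 : 0 ≤ d := G.cc_nonneg _ _
  have hρ0 : 0 < ρ := lt_max_of_lt_left (by positivity)
  have hρ1 : ρ < 1 := max_lt (two_rpow_neg_lt_one hα0) (two_rpow_neg_lt_one (by linarith))
  have hV0 : 0 ≤ V := ENNReal.toReal_nonneg
  have hCα : 0 ≤ C ^ α := Real.rpow_nonneg hC0 α
  have hI := integral_abs_le_of_forall_notMem_eq_zero (μ := volume) hS.measure_lt_top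
    (fun z hz => by_contra fun h => hz (hKS z h)) hM
  have hlarge : ∀ r : ℝ, 0 < r → d ≤ r →
      |G.potential (G.rescale G.Q r K) φ x - G.potential (G.rescale G.Q r K) φ x'| ≤
        2 * V * (m * M + 1) * (C ^ α + 1) * H * (d * r ^ (α - 1)) := fun r hr hdr => by
    have := abs_potential_rescale_sub_le hr hα0.le hK hKc hφ hφc hH0 hH hC0 hS hKS hC hM0 hYM
      x x' hdr
    rw [abs_sub_comm]
    linarith
  have hsmall : ∀ r : ℝ, 0 < r →
      |G.potential (G.rescale G.Q r K) φ x - G.potential (G.rescale G.Q r K) φ x'| ≤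
        2 * (M * V * C ^ α) * H * r ^ α := fun r hr => by
    have h1 := fun x => abs_potential_rescale_le_of_integral_eq_zero hr hα0.le hK.continuous hKc h0
      hφ hH0 hH hC0 (fun z hz => hC z (hKS z hz)) x
    have h2 : (∫ z, |K z|) * (H * C ^ α) * r ^ α ≤ M * V * (H * C ^ α) * r ^ α := by gcongr
    have h3 := abs_sub (G.potential (G.rescale G.Q r K) φ x) (G.potential (G.rescale G.Q r K) φ x')
    linarith [h1 x, h1 x']
  rcases hd0.eq_or_lt with hd0' | hdpos
  · -- at distance zero all pieces take the same value
    have : u x = u x' := by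
      refine (hu x).unique ((hu x').congr_fun fun j => ?_)
      have h1 := hlarge ((2 : ℝ) ^ (-j)) (by positivity) (by rw [← hd0']; positivity)
      rw [← hd0', zero_mul, mul_zero] at h1
      exact sub_eq_zero.1 (abs_nonpos_iff.1 h1)
    rw [this, sub_self, abs_zero]
    have : 0 ≤ ∑' j : ℤ, ρ ^ j.natAbs := tsum_nonneg fun j => by positivity
    positivity
  · -- `2 ^ (n + 1)` is the dyadic scale with `d ≤ 2 ^ (n + 1) < 2 * d`, and `k` counts from it
    obtain ⟨n, hn1, hn2⟩ := exists_mem_Ioc_zpow hdpos one_lt_two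
    have hs : Summable fun j : ℤ => ρ ^ j.natAbs := summable_pow_natAbs hρ0.le hρ1
    have hs' : HasSum (fun j : ℤ => ρ ^ (-(n + 1) - j).natAbs) (∑' j : ℤ, ρ ^ j.natAbs) :=
      ((Equiv.subLeft (-(n + 1))).hasSum_iff (f := fun j : ℤ => ρ ^ j.natAbs)).2 hs.hasSum
    rw [← Real.norm_eq_abs]
    refine ((hu x).sub (hu x')).norm_le_of_bounded (hs'.mul_left _) fun j => ?_
    rw [Real.norm_eq_abs]
    set k := -(n + 1) - j with hk
    have hr : (2 : ℝ) ^ (-j) = 2 ^ (n + 1) * 2 ^ k := by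
      rw [← zpow_add₀ two_ne_zero]; congr 1; lia
    have hdα : 0 ≤ d ^ α := Real.rpow_nonneg hd0 α
    have hρk : 0 ≤ ρ ^ k.natAbs := by positivity
    have hnn : 0 ≤ H * d ^ α * ρ ^ k.natAbs := by positivity
    rcases le_total 0 k with hk0 | hk0
    · have hle : (2 : ℝ) ^ (n + 1) ≤ 2 ^ (-j) := zpow_le_zpow_right₀ one_le_two (by lia)
      refine (hlarge _ (by positivity) (hn2.trans hle)).trans ?_
      have h1 : d * ((2 : ℝ) ^ (-j)) ^ (α - 1) ≤ d ^ α * ρ ^ k.natAbs := by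
        rw [hr, Real.mul_rpow (by positivity) (by positivity)]
        have e1 : ((2 : ℝ) ^ k) ^ (α - 1) = ((2 : ℝ) ^ (-(1 - α))) ^ k.natAbs := by
          have := two_zpow_neg_rpow_of_nonpos (α := 1 - α) (j := -k) (by lia)
          rw [neg_neg, neg_sub, Int.natAbs_neg] at this
          rw [this, neg_sub]
        have e2 : ((2 : ℝ) ^ (n + 1)) ^ (α - 1) ≤ d ^ (α - 1) :=
          Real.rpow_le_rpow_of_nonpos hdpos hn2 (by linarith)
        have e3 : d * d ^ (α - 1) = d ^ α := by
          rw [mul_comm, ← Real.rpow_add_one hdpos.ne', sub_add_cancel]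
        rw [e1, ← e3, ← mul_assoc]
        gcongr
        exact le_max_right _ _
      calc _ ≤ 2 * V * (m * M + 1) * (C ^ α + 1) * H * (d ^ α * ρ ^ k.natAbs) := by gcongr
        _ ≤ _ := by
          have : 0 ≤ 4 * (M * V * C ^ α) * (H * d ^ α * ρ ^ k.natAbs) := by positivity
          linarith
    · refine (hsmall _ (by positivity)).trans ?_
      have h1 : ((2 : ℝ) ^ (-j)) ^ α ≤ 2 * d ^ α * ρ ^ k.natAbs := by
        rw [hr, Real.mul_rpow (by positivity) (by positivity)]
        have e1 : ((2 : ℝ) ^ k) ^ α = ((2 : ℝ) ^ (-α)) ^ k.natAbs := by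
          have := two_zpow_neg_rpow_of_nonneg (α := α) (j := -k) (by lia)
          rwa [neg_neg, Int.natAbs_neg] at this
        have e2 : ((2 : ℝ) ^ (n + 1)) ^ α ≤ 2 * d ^ α := by
          have e3 : (2 : ℝ) ^ (n + 1) ≤ 2 * d := by
            rw [zpow_add_one₀ two_ne_zero]; linarith
          have e4 : (2 : ℝ) ^ α ≤ 2 := by
            simpa using Real.rpow_le_rpow_of_exponent_le one_le_two hα1.le
          calc _ ≤ (2 * d) ^ α := Real.rpow_le_rpow (by positivity) e3 hα0.le
            _ = 2 ^ α * d ^ α := Real.mul_rpow two_pos.le hd0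
            _ ≤ _ := by gcongr
        rw [e1]
        gcongr
        exact le_max_left _ _
      calc _ ≤ 2 * (M * V * C ^ α) * H * (2 * d ^ α * ρ ^ k.natAbs) := by gcongr
        _ ≤ _ := by
          have : 0 ≤ 2 * V * (m * M + 1) * (C ^ α + 1) * (H * d ^ α * ρ ^ k.natAbs) := by
            positivity
          linarith

end Series

/-! ### The operator `T_f` as a series -/

theorem IsHomogeneousTwoSubQ.pow_mul {f : (Fin N → ℝ) → ℝ} (hQ : 2 < G.Q)
    (hf : G.IsHomogeneousTwoSubQ f) (r : ℝ) (hr : 0 < r) (x : Fin N → ℝ) (hx : x ≠ 0) :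
    r ^ (G.Q - 2) * f (G.dil r x) = f x := by
  have e : (2 - (G.Q : ℤ)) = -((G.Q - 2 : ℕ) : ℤ) := by
    rw [Nat.cast_sub hQ.le]; push_cast; ring
  rw [hf r hr x hx, e, zpow_neg, zpow_natCast, mul_inv_cancel_left₀ (by positivity)]

/-- `T_f φ` is the sum of the potentials of the dyadic pieces of `Y_h Y_l f`, which have mean zero
because they are derivatives of compactly supported functions. -/
theorem tWellDefined_and_hasSum_T (hQ : 2 < G.Q) {α H : ℝ} (hα0 : 0 < α) (hα1 : α < 1)
    {f ψ φ : (Fin N → ℝ) → ℝ} (hf : ContDiffOn ℝ ∞ f {0}ᶜ) (hhom : G.IsHomogeneousTwoSubQ f)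
    (hψ : ContDiff ℝ ∞ ψ) (hψc : HasCompactSupport ψ) (hψ0 : (0 : Fin N → ℝ) ∉ tsupport ψ)
    (hψ1 : ∀ z, z ≠ 0 → HasSum (fun j : ℤ => ψ (G.dil ((2 : ℝ) ^ (-j))⁻¹ z)) 1) (h l : Fin m)
    (hφc : HasCompactSupport φ) (hH0 : 0 ≤ H) (hH : ∀ x y, |φ x - φ y| ≤ H * G.cc x y ^ α) :
    G.TWellDefined f h l φ ∧ ∀ x, HasSum (fun j : ℤ => G.potential (G.rescale G.Q ((2 : ℝ) ^ (-j))
      (G.iterYDeriv [h, l] fun z => f z * ψ z)) φ x) (G.T f h l φ x) := by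
  have hφ : Continuous φ := G.continuous_of_holder hα0 hH
  have hhom' := hhom.pow_mul hQ
  have hF := contDiff_mul_cutoff hf hψ hψ0
  set F : (Fin N → ℝ) → ℝ := fun z => f z * ψ z with hFdef
  have hFc : HasCompactSupport F := hψc.mul_left
  have hκ := summable_pow_natAbs (κ := (2 : ℝ) ^ (-α)) (by positivity) (two_rpow_neg_lt_one hα0)
  -- the series of `f`, `Y_l f` and `Y_h Y_l f` have kernels of degree `2 - Q`, `1 - Q` and `-Q`
  have hF1 := G.contDiff_YDeriv l hF
  have hF1c := G.hasCompactSupport_YDeriv l hFc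
  have hF2 := G.contDiff_YDeriv h hF1
  have hF2c := G.hasCompactSupport_YDeriv h hF1c
  have s0 := integrable_and_hasSum_potential (G := G) (n := G.Q - 2) (by lia) (by lia)
    hf.continuousOn hF.continuous hFc
    (fun z hz => hasSum_rescale_mul_cutoff hhom' hz (hψ1 z hz)) hφ hφc
  obtain ⟨C₁, hC₁⟩ := exists_bound_potential_rescale (G := G) (n := G.Q - 1) (by lia) (by lia)
    hα1.le hF1.continuous hF1c hφ hφc
  have s1 := derivAlong_potential_series l hF hFc hφ hφc (fun x => (s0 x).2) (hκ.mul_left C₁)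
    (by rwa [show G.Q - 2 + 1 = G.Q - 1 by lia])
  rw [show G.Q - 2 + 1 = G.Q - 1 by lia] at s1
  obtain ⟨C, hC⟩ := G.exists_ccDist_le_of_isCompact hF2c.isCompact
  obtain ⟨B, hB⟩ := hF2c.exists_bound_of_continuous hF2.continuous
  have s2 := derivAlong_potential_series h hF1 hF1c hφ hφc (fun x => (s1 x).2)
    (hκ.mul_left ((∫ z, |G.YDeriv h (G.YDeriv l F) z|) * (H * (C : ℝ) ^ α) + B * ∫ y, |φ y|))
    (by
      rw [show G.Q - 1 + 1 = G.Q by lia]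
      refine abs_potential_rescale_Q_le (by lia) hα0 hα1.le hF2.continuous hF2c
        (G.integral_YDeriv_eq_zero h hF1 hF1c) hφ hφc hH0 hH C.2 (fun z hz => ?_) hB
      exact ENNReal.toReal_le_coe_of_le_coe (hC z (subset_tsupport _ hz)))
  rw [show G.Q - 1 + 1 = G.Q by lia] at s2
  exact ⟨fun x => ⟨(s0 x).1, (s1 x).1, (s2 x).1⟩, fun x => (s2 x).2⟩

/-! ### Hölder seminorms -/

/-- Finiteness of the seminorm rules out that distinct values are taken at distance zero, where
the quotient in its definition is infinite. -/
theorem abs_sub_le_of_holderSeminorm {α : ℝ} (hα : 0 < α) {Ω : Set (Fin N → ℝ)}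
    {u : (Fin N → ℝ) → ℝ} (h : G.holderSeminorm α Ω u ≠ ⊤) {x x' : Fin N → ℝ} (hx : x ∈ Ω)
    (hx' : x' ∈ Ω) : |u x - u x'| ≤ (G.holderSeminorm α Ω u).toReal * G.cc x x' ^ α := by
  have hcc := Real.rpow_nonneg (G.cc_nonneg x x') α
  rcases eq_or_ne x x' with rfl | hne
  · simpa using mul_nonneg ENNReal.toReal_nonneg hcc
  have h1 : ‖u x - u x'‖ₑ / G.ccDist x x' ^ α ≤ G.holderSeminorm α Ω u :=
    le_iSup₂_of_le x hx (le_iSup₂_of_le x' hx' (le_iSup_of_le hne le_rfl))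
  have h2 : ‖u x - u x'‖ₑ ≤ G.holderSeminorm α Ω u * G.ccDist x x' ^ α := by
    by_cases h0 : G.ccDist x x' ^ α = 0
    · rw [h0] at h1 ⊢
      by_contra! h3
      rw [mul_zero] at h3
      rw [ENNReal.div_zero h3.ne'] at h1
      exact h (top_le_iff.1 h1)
    · exact (ENNReal.div_le_iff h0
        (ENNReal.rpow_ne_top_of_nonneg hα.le (G.ccDist_lt_top x x').ne)).1 h1
  rw [← G.ofReal_cc, ENNReal.ofReal_rpow_of_nonneg (G.cc_nonneg x x') hα.le,
    Real.enorm_eq_ofReal_abs, ← ENNReal.ofReal_toReal h,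
    ← ENNReal.ofReal_mul ENNReal.toReal_nonneg] at h2
  exact (ENNReal.ofReal_le_ofReal_iff (mul_nonneg ENNReal.toReal_nonneg hcc)).1 h2

theorem holderSeminorm_le_ofReal {α : ℝ} (hα : 0 < α) {Ω : Set (Fin N → ℝ)}
    {u : (Fin N → ℝ) → ℝ} {A : ℝ} (hA : 0 ≤ A) (h : ∀ x x', |u x - u x'| ≤ A * G.cc x x' ^ α) :
    G.holderSeminorm α Ω u ≤ ENNReal.ofReal A := by
  refine iSup₂_le fun x _ => iSup₂_le fun x' _ => iSup_le fun _ => ENNReal.div_le_of_le_mul ?_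
  rw [← G.ofReal_cc, ENNReal.ofReal_rpow_of_nonneg (G.cc_nonneg x x') hα.le,
    Real.enorm_eq_ofReal_abs, ← ENNReal.ofReal_mul hA]
  exact ENNReal.ofReal_le_ofReal (h x x')

theorem supNormOn_le_ofReal {Ω : Set (Fin N → ℝ)} {u : (Fin N → ℝ) → ℝ} {A : ℝ}
    (h : ∀ x, |u x| ≤ A) : supNormOn Ω u ≤ ENNReal.ofReal A :=
  iSup₂_le fun x _ => by
    rw [Real.enorm_eq_ofReal_abs]
    exact ENNReal.ofReal_le_ofReal (h x)

/-! ### Functions supported in a ball -/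

theorem isOpen_ball (x₀ : Fin N → ℝ) (R : ℝ) : IsOpen (G.ball x₀ R) :=
  isOpen_lt (G.continuous_hnorm.comp (G.contDiff_mul_left (G.inv x₀)).continuous) continuous_const

/-- A function supported in an open set `U` has the same Hölder seminorm on `U` and on the whole
space: an almost minimal curve leaving `U` passes, before it leaves, through a point of `U` where
the function vanishes. -/
theorem abs_sub_le_of_tsupport_subset {α : ℝ} (hα : 0 < α) {U : Set (Fin N → ℝ)} (hU : IsOpen U)
    {φ : (Fin N → ℝ) → ℝ} (hφ : tsupport φ ⊆ U) {H : ℝ} (hH0 : 0 ≤ H)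
    (hH : ∀ x ∈ U, ∀ y ∈ U, |φ x - φ y| ≤ H * G.cc x y ^ α) (x y : Fin N → ℝ) :
    |φ x - φ y| ≤ H * G.cc x y ^ α := by
  have hout : ∀ x, x ∉ U → φ x = 0 := fun x hx =>
    image_eq_zero_of_notMem_tsupport fun h => hx (hφ h)
  have key : ∀ x y, y ∉ U → |φ x| ≤ H * G.cc x y ^ α := fun x y hy => by
    by_cases hx : x ∈ tsupport φ
    swap
    · rw [image_eq_zero_of_notMem_tsupport hx, abs_zero]
      exact mul_nonneg hH0 (Real.rpow_nonneg (G.cc_nonneg _ _) _)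
    have h1 : ∀ ε : ℝ, 0 < ε → |φ x| ≤ H * (G.cc x y + ε) ^ α := fun ε hε => by
      have hlt : G.ccDist x y < ENNReal.ofReal (G.cc x y + ε) := by
        rw [← G.ofReal_cc]
        exact (ENNReal.ofReal_lt_ofReal_iff (by linarith [G.cc_nonneg x y])).2 (by linarith)
      obtain ⟨δ, hδ0, hδ, hne⟩ := G.exists_of_ccDist_lt hlt
      obtain ⟨z, ⟨hzU, hzS⟩, hz⟩ :=
        G.exists_mem_diff_of_exit hδ0 hne (isClosed_tsupport φ) hU hφ hx hy
      have h2 := hH x (hφ hx) z hzU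
      rw [image_eq_zero_of_notMem_tsupport hzS, sub_zero] at h2
      refine h2.trans (mul_le_mul_of_nonneg_left
        (Real.rpow_le_rpow (G.cc_nonneg _ _) ?_ hα.le) hH0)
      exact ENNReal.toReal_le_of_le_ofReal (by linarith [G.cc_nonneg x y]) (hz.trans hδ.le)
    have h2 : Tendsto (fun ε : ℝ => H * (G.cc x y + ε) ^ α) (𝓝[>] 0)
        (𝓝 (H * (G.cc x y + 0) ^ α)) := by
      have : Continuous fun ε : ℝ => H * (G.cc x y + ε) ^ α :=
        continuous_const.mul ((continuous_const.add continuous_id).rpow_const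
          fun _ => Or.inr hα.le)
      exact (this.tendsto 0).mono_left nhdsWithin_le_nhds
    rw [add_zero] at h2
    exact ge_of_tendsto h2 (eventually_mem_nhdsWithin.mono h1)
  by_cases hx : x ∈ U <;> by_cases hy : y ∈ U
  · exact hH x hx y hy
  · rw [hout y hy, sub_zero]
    exact key x y hy
  · rw [hout x hx, zero_sub, abs_neg, G.cc_comm]
    exact key y x hx
  · rw [hout x hx, hout y hy, sub_self, abs_zero]
    exact mul_nonneg hH0 (Real.rpow_nonneg (G.cc_nonneg _ _) _)

/-- Balls are relatively compact, as translates of balls centred at the origin. -/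
theorem hasCompactSupport_of_tsupport_subset_ball {x₀ : Fin N → ℝ} {R : ℝ} (hR : R ≤ 1)
    {φ : (Fin N → ℝ) → ℝ} (hφ : tsupport φ ⊆ G.ball x₀ R) : HasCompactSupport φ := by
  refine (G.isCompact_hnorm_le_one.image (G.contDiff_mul_left x₀).continuous).of_isClosed_subset
    (isClosed_tsupport φ) fun x hx => ?_
  exact ⟨G.mul (G.inv x₀) x, (le_of_lt (hφ hx)).trans hR, G.mul_inv_cancel_left x₀ x⟩

variable (G) in
/-- The unit ball of the homogeneous norm has finite diameter for the control distance. -/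
theorem exists_cc_le_of_hnorm_le_one : ∃ C : ℝ, 0 ≤ C ∧
    ∀ z w, G.hnorm z ≤ 1 → G.hnorm w ≤ 1 → G.cc z w ≤ C := by
  obtain ⟨C, hC⟩ := G.exists_ccDist_le_of_isCompact
    ((G.isCompact_hnorm_le_one.prod G.isCompact_hnorm_le_one).image
      (G.continuous_mul (G.continuous_inv continuous_fst) continuous_snd))
  refine ⟨C, C.2, fun z w hz hw => ?_⟩
  rw [G.cc_eq_zero_left]
  exact ENNReal.toReal_le_coe_of_le_coe (hC _ ⟨(z, w), ⟨hz, hw⟩, rfl⟩)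

/-- A function supported in a ball of radius at most one is controlled by its oscillation, since
it vanishes at a point at bounded distance. -/
theorem abs_le_of_tsupport_subset_ball (hN : 0 < N) {α H C : ℝ} (hα : 0 < α) (hH0 : 0 ≤ H)
    (hC0 : 0 ≤ C) (hC : ∀ z w, G.hnorm z ≤ 1 → G.hnorm w ≤ 1 → G.cc z w ≤ C)
    {x₀ : Fin N → ℝ} {R : ℝ} (hR : R ≤ 1) {φ : (Fin N → ℝ) → ℝ} (hφ : tsupport φ ⊆ G.ball x₀ R)
    (hH : ∀ x y, |φ x - φ y| ≤ H * G.cc x y ^ α) (x : Fin N → ℝ) : |φ x| ≤ H * C ^ α := by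
  by_cases hx : x ∈ tsupport φ
  swap
  · rw [image_eq_zero_of_notMem_tsupport hx, abs_zero]
    exact mul_nonneg hH0 (Real.rpow_nonneg hC0 _)
  have h1 : (fun _ => 1 : Fin N → ℝ) ≠ 0 := fun h => one_ne_zero (congrFun h ⟨0, hN⟩)
  obtain ⟨w, hw⟩ : ∃ w, G.hnorm w = 1 := ⟨_, G.exists_hnorm_eq_one h1⟩
  have hy : G.mul x₀ w ∉ tsupport φ := fun h => by
    have h2 : G.hnorm (G.mul (G.inv x₀) (G.mul x₀ w)) < R := hφ h
    rw [G.inv_mul_cancel_left, hw] at h2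
    linarith
  have h2 := hH x (G.mul x₀ w)
  rw [image_eq_zero_of_notMem_tsupport hy, sub_zero] at h2
  refine h2.trans (mul_le_mul_of_nonneg_left (Real.rpow_le_rpow (G.cc_nonneg _ _) ?_ hα.le) hH0)
  rw [← G.cc_mul_left (G.inv x₀), G.inv_mul_cancel_left]
  exact hC _ _ ((le_of_lt (hφ hx)).trans hR) hw.le

/-- By left invariance, a ball of radius at most one has at most the volume of the unit ball. -/
theorem integral_abs_le_of_tsupport_subset_ball {x₀ : Fin N → ℝ} {R A : ℝ} (hR : R ≤ 1)
    {φ : (Fin N → ℝ) → ℝ} (hφ : tsupport φ ⊆ G.ball x₀ R) (hA : ∀ x, |φ x| ≤ A) :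
    ∫ y, |φ y| ≤ A * (volume {z | G.hnorm z ≤ 1}).toReal := by
  have e := (G.measurePreserving_mul_left (G.inv x₀)).measure_preimage
    G.isCompact_hnorm_le_one.measurableSet.nullMeasurableSet
  rw [← e]
  refine integral_abs_le_of_forall_notMem_eq_zero ?_ (fun z hz => ?_) hA
  · rw [e]
    exact G.isCompact_hnorm_le_one.measure_lt_top
  · exact image_eq_zero_of_notMem_tsupport fun h => hz ((le_of_lt (hφ h)).trans hR)

variable (G) in
/-- The Hölder estimate on balls, with a constant depending on `f` only through `Θ`. -/
theorem exists_holderNorm_T_le (hQ : 2 < G.Q) {α : ℝ} (hα0 : 0 < α) (hα1 : α < 1) :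
    ∃ c : ℝ → ℝ, ∀ f : (Fin N → ℝ) → ℝ, ContDiffOn ℝ ∞ f {0}ᶜ → G.IsHomogeneousTwoSubQ f →
      ∀ (h l : Fin m) (R : ℝ), R ≤ 1 → ∀ (x₀ : Fin N → ℝ) (φ : (Fin N → ℝ) → ℝ),
        G.holderSeminorm α (G.ball x₀ R) φ ≠ ⊤ → tsupport φ ⊆ G.ball x₀ R →
        G.holderNorm α (G.ball x₀ R) (G.T f h l φ) ≤ ENNReal.ofReal
          (c (G.Theta f 3).toReal * (G.holderSeminorm α (G.ball x₀ R) φ).toReal) := by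
  obtain ⟨ψ, hψ, hψc, hψ0, hψ1⟩ := G.exists_dyadic_cutoff
  obtain ⟨Cψ, hCψ0, hCψ⟩ := G.exists_bound_iterYDeriv_mul hψ hψc hψ0 (G.Q - 2) 3
  obtain ⟨C, hC0, hCS⟩ : ∃ C : ℝ, 0 ≤ C ∧ ∀ z ∈ tsupport ψ, G.cc 0 z ≤ C := by
    obtain ⟨C, hC⟩ := G.exists_ccDist_le_of_isCompact hψc.isCompact
    exact ⟨C, C.2, fun z hz => ENNReal.toReal_le_coe_of_le_coe (hC z hz)⟩
  obtain ⟨C₁, hC₁0, hC₁⟩ := G.exists_cc_le_of_hnorm_le_one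
  have hN : 0 < N := by
    rcases Nat.eq_zero_or_pos N with rfl | h
    · simp [Q] at hQ
    · exact h
  set V := (volume (tsupport ψ)).toReal with hV
  set V₁ := (volume {z | G.hnorm z ≤ 1}).toReal with hV₁
  set ρ := max ((2 : ℝ) ^ (-α)) ((2 : ℝ) ^ (-(1 - α))) with hρ
  have hV0 : 0 ≤ V := ENNReal.toReal_nonneg
  have hV₁0 : 0 ≤ V₁ := ENNReal.toReal_nonneg
  have hρ0 : 0 < ρ := lt_max_of_lt_left (by positivity)
  have hS1 : 0 ≤ ∑' j : ℤ, ((2 : ℝ) ^ (-α)) ^ j.natAbs := tsum_nonneg fun j => by positivity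
  have hS2 : 0 ≤ ∑' j : ℤ, ρ ^ j.natAbs := tsum_nonneg fun j => by positivity
  refine ⟨fun θ => (Cψ * θ * V * C ^ α + Cψ * θ * (C₁ ^ α * V₁)) *
      (∑' j : ℤ, ((2 : ℝ) ^ (-α)) ^ j.natAbs) +
    (2 * V * (m * (Cψ * θ) + 1) * (C ^ α + 1) + 4 * (Cψ * θ * V * C ^ α)) *
      ∑' j : ℤ, ρ ^ j.natAbs, fun f hf hhom h l R hR x₀ φ hfin hφ => ?_⟩
  set θ := (G.Theta f 3).toReal with hθ
  set H := (G.holderSeminorm α (G.ball x₀ R) φ).toReal with hHdef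
  have hθ0 : 0 ≤ θ := ENNReal.toReal_nonneg
  have hH0 : 0 ≤ H := ENNReal.toReal_nonneg
  have hH : ∀ x y, |φ x - φ y| ≤ H * G.cc x y ^ α :=
    abs_sub_le_of_tsupport_subset hα0 (isOpen_ball x₀ R) hφ hH0 fun x hx y hy =>
      abs_sub_le_of_holderSeminorm hα0 hfin hx hy
  have hφc := hasCompactSupport_of_tsupport_subset_ball hR hφ
  have hφ' : Continuous φ := G.continuous_of_holder hα0 hH
  have hsup := abs_le_of_tsupport_subset_ball hN hα0 hH0 hC₁0 hC₁ hR hφ hH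
  have hint := integral_abs_le_of_tsupport_subset_ball hR hφ hsup
  rw [← hV₁] at hint
  have hT := (tWellDefined_and_hasSum_T hQ hα0 hα1 hf hhom hψ hψc hψ0 hψ1 h l hφc hH0 hH).2
  have hF := contDiff_mul_cutoff hf hψ hψ0
  have hFc : HasCompactSupport fun z => f z * ψ z := hψc.mul_left
  have hK := G.contDiff_iterYDeriv hF [h, l]
  have hKc : HasCompactSupport (G.iterYDeriv [h, l] fun z => f z * ψ z) :=
    G.hasCompactSupport_YDeriv h (G.hasCompactSupport_YDeriv l hFc)
  have h0 : ∫ z, G.iterYDeriv [h, l] (fun z => f z * ψ z) z = 0 :=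
    G.integral_YDeriv_eq_zero h (G.contDiff_YDeriv l hF) (G.hasCompactSupport_YDeriv l hFc)
  have hbd := hCψ f hf (hhom.pow_mul hQ)
  have hM : ∀ z, |G.iterYDeriv [h, l] (fun z => f z * ψ z) z| ≤ Cψ * θ := hbd [h, l] (by simp)
  have hYM : ∀ i z, |G.YDeriv i (G.iterYDeriv [h, l] fun z => f z * ψ z) z| ≤ Cψ * θ :=
    fun i => hbd [i, h, l] (by simp)
  have hKS : ∀ z, G.iterYDeriv [h, l] (fun z => f z * ψ z) z ≠ 0 → z ∈ tsupport ψ := fun z hz =>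
    tsupport_mul_subset_right (G.tsupport_iterYDeriv_subset _ _ (subset_tsupport _ hz))
  have hM0 : 0 ≤ Cψ * θ := by positivity
  have b1 := abs_le_of_hasSum_potential (by lia) hα0 hα1.le hK.continuous hKc h0 hφ' hφc hH0 hH
    hC0 hψc.isCompact hKS hCS hM hT
  rw [← hV] at b1
  have b2 := abs_sub_le_of_hasSum_potential hα0 hα1 hK hKc h0 hφ' hφc hH0 hH
    hC0 hψc.isCompact hKS hCS hM0 hM hYM hT
  rw [← hV, ← hρ] at b2
  have hCα : 0 ≤ C ^ α := Real.rpow_nonneg hC0 α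
  have hC₁α : 0 ≤ C₁ ^ α := Real.rpow_nonneg hC₁0 α
  rw [add_mul, ENNReal.ofReal_add (by positivity) (by positivity)]
  refine add_le_add (supNormOn_le_ofReal fun x => (b1 x).trans ?_)
    (holderSeminorm_le_ofReal hα0 (by positivity) fun x x' => (b2 x x').trans (le_of_eq ?_))
  · calc _ ≤ (Cψ * θ * V * (H * C ^ α) + Cψ * θ * (H * C₁ ^ α * V₁)) *
          (∑' j : ℤ, ((2 : ℝ) ^ (-α)) ^ j.natAbs) := by gcongr
      _ = _ := by ring
  · ring

end CarnotGroup

end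

open CarnotGroup in
theorem theorem3p2 {N m : ℕ} (G : CarnotGroup N m) (hQ : 2 < G.Q)
    (α : ℝ) (hα₀ : 0 < α) (hα₁ : α < 1) :
    (∀ f : (Fin N → ℝ) → ℝ, ContDiffOn ℝ ∞ f {0}ᶜ → G.IsHomogeneousTwoSubQ f →
      ∀ (h l : Fin m) (φ : (Fin N → ℝ) → ℝ),
        G.MemHolder α Set.univ φ → HasCompactSupport φ → G.TWellDefined f h l φ) ∧
    ∃ c₀ : ℝ≥0∞ → ℝ≥0, (∀ t, 0 < c₀ t) ∧
      ∀ f : (Fin N → ℝ) → ℝ, ContDiffOn ℝ ∞ f {0}ᶜ → G.IsHomogeneousTwoSubQ f →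
        ∀ (h l : Fin m) (R : ℝ) (_ : 0 < R) (_ : R ≤ 1) (xbar : Fin N → ℝ)
          (φ : (Fin N → ℝ) → ℝ),
          G.MemHolder α Set.univ φ → tsupport φ ⊆ G.ball xbar R →
          G.holderNorm α (G.ball xbar R) (G.T f h l φ) ≤
            c₀ (G.Theta f 3) * G.holderSeminorm α (G.ball xbar R) φ := by
  constructor
  · intro f hf hhom h l φ hφ hφc
    obtain ⟨ψ, hψ, hψc, hψ0, hψ1⟩ := G.exists_dyadic_cutoff
    exact (tWellDefined_and_hasSum_T hQ hα₀ hα₁ hf hhom hψ hψc hψ0 hψ1 h l hφc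
      ENNReal.toReal_nonneg fun x y => abs_sub_le_of_holderSeminorm hα₀ hφ.2.ne
        (Set.mem_univ x) (Set.mem_univ y)).1
  · obtain ⟨c, hc⟩ := G.exists_holderNorm_T_le hQ hα₀ hα₁
    -- the summand `1` makes the constant positive
    refine ⟨fun t => (c t.toReal).toNNReal + 1, fun t => by positivity,
      fun f hf hhom h l R _ hR xbar φ hφ hsupp => ?_⟩
    have hfin : G.holderSeminorm α (G.ball xbar R) φ ≠ ⊤ := by
      refine (lt_of_le_of_lt ?_ hφ.2).ne
      exact iSup₂_le fun x _ => iSup₂_le fun y _ => iSup_le fun hne =>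
        le_iSup₂_of_le x (Set.mem_univ x) (le_iSup₂_of_le y (Set.mem_univ y)
          (le_iSup_of_le hne le_rfl))
    refine (hc f hf hhom h l R hR xbar φ hfin hsupp).trans ?_
    rw [ENNReal.ofReal_mul' ENNReal.toReal_nonneg, ENNReal.ofReal_toReal hfin]
    gcongr
    push_cast
    exact le_self_add
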